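/- Let $A$ be a Frobenius algebra in a monoidal category with unit object $\underline{1}$ (for example, in the category of vector spaces over a field $\mathbb K$, with $\underline 1=\mathbb K$). That is, $A$ is a unital associative algebra with product $\mu$ and unit $1:\underline 1\to A$, and a counital coassociative coalgebra with coproduct $\Delta$ and counit $\epsilon:A\to\underline 1$, such that $$(\mu\otimes\mathrm{id})\circ(\mathrm{id}\otimes\Delta)=\Delta\circ\mu=(\mathrm{id}\otimes\mu)\circ(\Delta\otimes\mathrm{id}).$$ The algebra $A$ need not be commutative, symmetric or special. Put $\cup=\epsilon\circ\mu$ and $\cap=\Delta\circ 1$. A planar diagram with $m$ strands in and $n$ strands out is a drawing in the plane, read from top to bottom, with $m$ legs ending at distinct points of its top line and $n$ legs ending at distinct points of its bottom line. It is made of finitely many nodes, each of them one of $\mu,\Delta,\cup,\cap,1,\epsilon$, joined by vertically monotone continuous strands that do not cross. It represents the map $A^{\otimes m}\to A^{\otimes n}$ (with $A^{\otimes 0}=\underline 1$) obtained by composing and tensoring the maps of its nodes and identity maps. For $m,n,j\ge 0$ let $S_{m,n,j}:A^{\otimes m}\to A^{\otimes n}$ be the map of the standard diagram with $j$ beads,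 $$S_{m,n,j}=(\mathrm{id}^{\otimes (n-2)}\otimes\Delta)\circ\cdots\circ(\mathrm{id}\otimes\Delta)\circ\Delta\circ(\mu\circ\Delta)^j\circ\mu\circ(\mathrm{id}\otimes\mu)\circ\cdots\circ(\mathrm{id}^{\otimes (m-2)}\otimes\mu),$$ where the factors $\mu$ to the right of $(\mu\circ\Delta)^j$ are absent if $m=1$ and replaced by $1$ if $m=0$, and the factors $\Delta$ to its left are absent if $n=1$ and replaced by $\epsilon$ if $n=0$. If a map $f:A^{\otimes m}\to A^{\otimes n}$ is represented by a planar diagram $\Gamma$ which is a nonempty connected subset of the plane, then the complement of $\Gamma$ in the plane has only finitely many bounded connected components, and $f=S_{m,n,j}$, where $j$ is their number. In particular, if $m=n=0$, then $f=\dim_j:=\epsilon\circ(\mu\circ\Delta)^j\circ 1$. -/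

import Mathlib

open CategoryTheory MonoidalCategory MonObj ComonObj

universe v u

namespace PlanarSpider

section Algebra

variable {C : Type u} [Category.{v} C] [MonoidalCategory C]

/-- A Frobenius algebra in a monoidal category, in algebra-coalgebra form: a unital associative
algebra which is also a counital coassociative coalgebra, such that
`(μ ⊗ id) ∘ (id ⊗ Δ) = Δ ∘ μ = (id ⊗ μ) ∘ (Δ ⊗ id)`. No commutativity, symmetry or
specialness is required. -/
class FrobeniusObj (A : C) [MonObj A] [ComonObj A] : Prop where
  comul_right_mul : (A ◁ Δ[A]) ≫ (α_ A A A).inv ≫ (μ[A] ▷ A) = μ[A] ≫ Δ[A]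
  comul_left_mul : (Δ[A] ▷ A) ≫ (α_ A A A).hom ≫ (A ◁ μ[A]) = μ[A] ≫ Δ[A]

/-- The tensor power `A^{⊗ n}`, bracketed to the right; `A^{⊗ 0}` is the unit object. -/
def tensorPow (A : C) : ℕ → C
  | 0 => 𝟙_ C
  | n + 1 => A ⊗ tensorPow A n

variable (A : C) [MonObj A] [ComonObj A]

/-- The Frobenius form `∪ = ε ∘ μ`. -/
def cup : A ⊗ A ⟶ 𝟙_ C := μ[A] ≫ ε[A]

/-- The copairing `∩ = Δ ∘ 1`. -/
def cap : 𝟙_ C ⟶ A ⊗ A := η[A] ≫ Δ[A]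

/-- `j` beads, `(μ ∘ Δ)^j`. -/
def beads : ℕ → (A ⟶ A)
  | 0 => 𝟙 A
  | j + 1 => (Δ[A] ≫ μ[A]) ≫ beads j

/-- The iterated product `μ ∘ (id ⊗ μ) ∘ ⋯ ∘ (id^{⊗ (m-2)} ⊗ μ)`; it is `1` for `m = 0` and the
identity (up to the unit isomorphism) for `m = 1`. -/
def merge : (m : ℕ) → (tensorPow A m ⟶ A)
  | 0 => η[A]
  | 1 => (ρ_ A).hom
  | m + 2 => (A ◁ merge (m + 1)) ≫ μ[A]

/-- The iterated coproduct `(id^{⊗ (n-2)} ⊗ Δ) ∘ ⋯ ∘ (id ⊗ Δ) ∘ Δ`; it is `ε` for `n = 0` and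
the identity (up to the unit isomorphism) for `n = 1`. -/
def split : (n : ℕ) → (A ⟶ tensorPow A n)
  | 0 => ε[A]
  | 1 => (ρ_ A).inv
  | n + 2 => Δ[A] ≫ (A ◁ split (n + 1))

/-- The map given by the standard diagram with `m` strands going in, `n` strands going out and
`j` beads. -/
def standard (m n j : ℕ) : tensorPow A m ⟶ tensorPow A n :=
  merge A m ≫ beads A j ≫ split A n

/-- The higher Frobenius dimension `dim_j = ε ∘ (μ ∘ Δ)^j ∘ 1`, an endomorphism of the unit
object (a scalar, for vector spaces). -/
def higherDim (j : ℕ) : 𝟙_ C ⟶ 𝟙_ C := η[A] ≫ beads A j ≫ ε[A]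

end Algebra

/-- A horizontal row of nodes, listed from left to right, each with its `x`-coordinate. The row
has `m` strands arriving from above and `n` strands leaving below. A node is a point on a
through-going strand, a product, a coproduct, a cup, a cap, a unit or a counit. -/
inductive Level : ℕ → ℕ → Type
  | nil : Level 0 0
  | strand {m n : ℕ} (x : ℝ) (L : Level m n) : Level (m + 1) (n + 1)
  | mul {m n : ℕ} (x : ℝ) (L : Level m n) : Level (m + 2) (n + 1)
  | comul {m n : ℕ} (x : ℝ) (L : Level m n) : Level (m + 1) (n + 2)
  | cup {m n : ℕ} (x : ℝ) (L : Level m n) : Level (m + 2) n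
  | cap {m n : ℕ} (x : ℝ) (L : Level m n) : Level m (n + 2)
  | unit {m n : ℕ} (x : ℝ) (L : Level m n) : Level m (n + 1)
  | counit {m n : ℕ} (x : ℝ) (L : Level m n) : Level (m + 1) n

namespace Level

/-- The `x`-coordinates of the nodes, from left to right. -/
def nodes : {m n : ℕ} → Level m n → List ℝ
  | _, _, nil => []
  | _, _, strand x L => x :: L.nodes
  | _, _, mul x L => x :: L.nodes
  | _, _, comul x L => x :: L.nodes
  | _, _, cup x L => x :: L.nodes
  | _, _, cap x L => x :: L.nodes
  | _, _, unit x L => x :: L.nodes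
  | _, _, counit x L => x :: L.nodes

/-- The `x`-coordinate at which the `i`-th strand from above ends: that of its node. -/
def inPos : {m n : ℕ} → Level m n → Fin m → ℝ
  | _, _, nil => Fin.elim0
  | _, _, strand x L => Fin.cons x L.inPos
  | _, _, mul x L => Fin.cons x (Fin.cons x L.inPos)
  | _, _, comul x L => Fin.cons x L.inPos
  | _, _, cup x L => Fin.cons x (Fin.cons x L.inPos)
  | _, _, cap _ L => L.inPos
  | _, _, unit _ L => L.inPos
  | _, _, counit x L => Fin.cons x L.inPos

/-- The `x`-coordinate at which the `i`-th strand below starts: that of its node. -/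
def outPos : {m n : ℕ} → Level m n → Fin n → ℝ
  | _, _, nil => Fin.elim0
  | _, _, strand x L => Fin.cons x L.outPos
  | _, _, mul x L => Fin.cons x L.outPos
  | _, _, comul x L => Fin.cons x (Fin.cons x L.outPos)
  | _, _, cup _ L => L.outPos
  | _, _, cap x L => Fin.cons x (Fin.cons x L.outPos)
  | _, _, unit x L => Fin.cons x L.outPos
  | _, _, counit _ L => L.outPos

/-- The map represented by a row of nodes: the tensor product of the maps of its nodes. -/
def eval {C : Type u} [Category.{v} C] [MonoidalCategory C] (A : C) [MonObj A] [ComonObj A] :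
    {m n : ℕ} → Level m n → (tensorPow A m ⟶ tensorPow A n)
  | _, _, nil => 𝟙 (𝟙_ C)
  | _, _, strand _ L => A ◁ L.eval A
  | _, _, mul (m := m) _ L => (α_ A A (tensorPow A m)).inv ≫ (μ[A] ⊗ₘ L.eval A)
  | _, _, comul (n := n) _ L => (Δ[A] ⊗ₘ L.eval A) ≫ (α_ A A (tensorPow A n)).hom
  | _, _, cup (m := m) (n := n) _ L =>
      (α_ A A (tensorPow A m)).inv ≫ (PlanarSpider.cup A ⊗ₘ L.eval A) ≫ (λ_ (tensorPow A n)).hom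
  | _, _, cap (m := m) (n := n) _ L =>
      (λ_ (tensorPow A m)).inv ≫ (PlanarSpider.cap A ⊗ₘ L.eval A) ≫ (α_ A A (tensorPow A n)).hom
  | _, _, unit (m := m) _ L => (λ_ (tensorPow A m)).inv ≫ (η[A] ⊗ₘ L.eval A)
  | _, _, counit (n := n) _ L => (ε[A] ⊗ₘ L.eval A) ≫ (λ_ (tensorPow A n)).hom

end Level

/-- A horizontal band of the plane, `bot ≤ y ≤ top`, crossed by `k` strands. Strand `i` is the
curve `x = strand i y`. In the interior of the band the strands are disjoint and numbered
from left to right; on the two boundary lines they may meet (at a node). -/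
structure Band (k : ℕ) where
  top : ℝ
  bot : ℝ
  bot_lt_top : bot < top
  strand : Fin k → ℝ → ℝ
  continuousOn : ∀ i, ContinuousOn (strand i) (Set.Icc bot top)
  strictMono : ∀ y ∈ Set.Ioo bot top, StrictMono fun i => strand i y

/-- The subset of the plane drawn in a band. -/
def Band.carrier {k : ℕ} (B : Band k) : Set (ℝ × ℝ) :=
  {p | p.2 ∈ Set.Icc B.bot B.top ∧ ∃ i, p.1 = B.strand i p.2}

/-- An alternating sequence of bands and rows of nodes, read from top to bottom, which starts and
ends with a band and has matching numbers of strands. The pieces need not yet fit together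
geometrically, see `Drawing.Fits`. -/
inductive Drawing : ℕ → ℕ → Type
  | last {n : ℕ} (B : Band n) : Drawing n n
  | cons {m k n : ℕ} (B : Band m) (L : Level m k) (D : Drawing k n) : Drawing m n

namespace Drawing

/-- The band at the top. -/
def firstBand : {m n : ℕ} → Drawing m n → Band m
  | _, _, last B => B
  | _, _, cons B _ _ => B

/-- The pieces of the drawing fit together: at each row the nodes are distinct and ordered from
left to right, every strand of the band above ends, and every strand of the band below starts,
at its node, the second band starting at the height where the first one ends. At the bottom
line of the drawing the outgoing strands are distinct. -/
def Fits : {m n : ℕ} → Drawing m n → Prop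
  | _, _, last B => StrictMono fun i => B.strand i B.bot
  | _, _, cons B L D =>
      L.nodes.Pairwise (· < ·) ∧
      (∀ i, B.strand i B.bot = L.inPos i) ∧
      D.firstBand.top = B.bot ∧
      (∀ i, D.firstBand.strand i D.firstBand.top = L.outPos i) ∧
      D.Fits

/-- The subset of the plane that is drawn. The nodes are included, being ends of strands. -/
def carrier : {m n : ℕ} → Drawing m n → Set (ℝ × ℝ)
  | _, _, last B => B.carrier
  | _, _, cons B _ D => B.carrier ∪ D.carrier

/-- The map read off a drawing from top to bottom. -/
def eval {C : Type u} [Category.{v} C] [MonoidalCategory C] (A : C) [MonObj A] [ComonObj A] :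
    {m n : ℕ} → Drawing m n → (tensorPow A m ⟶ tensorPow A n)
  | _, _, last (n := n) _ => 𝟙 (tensorPow A n)
  | _, _, cons _ L D => L.eval A ≫ D.eval A

end Drawing

/-- A planar diagram with `m` strands coming in at the top and `n` strands going out at the
bottom, built from products, coproducts, cups, caps, units and counits joined by strands
that are monotone in the vertical direction and do not cross. -/
structure PlanarDiagram (m n : ℕ) where
  drawing : Drawing m n
  fits : drawing.Fits
  top_strictMono : StrictMono fun i => drawing.firstBand.strand i drawing.firstBand.top

namespace PlanarDiagram

/-- The diagram as a subset of the plane. -/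
def carrier {m n : ℕ} (Γ : PlanarDiagram m n) : Set (ℝ × ℝ) := Γ.drawing.carrier

/-- The map `A^{⊗ m} ⟶ A^{⊗ n}` represented by the diagram. -/
def eval {C : Type u} [Category.{v} C] [MonoidalCategory C] (A : C) [MonObj A] [ComonObj A]
    {m n : ℕ} (Γ : PlanarDiagram m n) : tensorPow A m ⟶ tensorPow A n :=
  Γ.drawing.eval A

end PlanarDiagram

/-- The bounded connected components of a subset of the plane. -/
def boundedComponents (U : Set (ℝ × ℝ)) : Set (Set (ℝ × ℝ)) :=
  {K | (∃ p ∈ U, K = connectedComponentIn U p) ∧ Bornology.IsBounded K}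

end PlanarSpider

/-! ### Frobenius towers and the calculus of beads. -/

namespace PlanarSpider

universe w w'

/-! The rows of nodes turn a diagram into a word in products, coproducts, units and counits, each
beside identity strands. Two facts are needed: a connected word equals a standard one, by the
Frobenius axioms alone, and its number of beads is the number of bounded regions.

The rewriting is done in an abstract `Tower`. A unit together with the beads and coproducts
following it (a `Source`) is pushed down through the word. Each later step commutes with it, is
swallowed by it, closes it by a counit, or multiplies it into a neighbouring strand, and then a unit
law removes the unit (`IsSplit.step`, `Source.step`). So a connected word is standard or can be
rewritten without units (`RWord.unit_free`). Reversing all arrows disposes of the counits in the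
same way. A word in products and coproducts only is a juxtaposition of components of the form merge,
beads, split (`Blocks.step`), and if connected it has a single one.

Components and regions are counted by evaluating the same word in two towers of additive maps
between spaces of `ℕ`-valued functions. `StrandHom` counts the two-colourings of strands that agree
at nodes, `2 ^ c` for `c` components. `RegionHom` counts two-colourings of regions; with the outer
colour fixed, the standard word with `j` beads gives `2 ^ j` (`RegionHom.std_app`). Geometrically, a
compatible strand colouring splits the drawing into two disjoint closed pieces, so a connected
drawing has exactly two (`PlanarDiagram.count_eq_two`). A region colouring is a locally constant
function on the complement with a prescribed value on the unbounded components, so these functions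
number `2` to the number of bounded components (`PlanarDiagram.encard_boundedComponents`). Neither
the Jordan curve theorem nor Euler's formula enters.

The rewriting runs once, in the product of `StrandHom`, `PowHom A` and `RegionHom`. Hence the same
`j` describes the map of the diagram and its regions. -/

/-- The morphisms between the powers of a Frobenius monad: a category with objects the natural
numbers, a shift `sh` (whiskering by one strand on the left), and natural structure maps acting on
the first strands. -/
class Tower (H : ℕ → ℕ → Type w) where
  idn (n : ℕ) : H n n
  comp {m n k : ℕ} (f : H m n) (g : H n k) : H m k
  sh {m n : ℕ} (f : H m n) : H (m + 1) (n + 1)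
  unitAt (n : ℕ) : H n (n + 1)
  mulAt (n : ℕ) : H (n + 2) (n + 1)
  counitAt (n : ℕ) : H (n + 1) n
  comulAt (n : ℕ) : H (n + 1) (n + 2)
  id_comp {m n : ℕ} (f : H m n) : comp (idn m) f = f
  comp_id {m n : ℕ} (f : H m n) : comp f (idn n) = f
  assoc {m n k l : ℕ} (f : H m n) (g : H n k) (h : H k l) :
    comp (comp f g) h = comp f (comp g h)
  sh_id (n : ℕ) : sh (idn n) = idn (n + 1)
  sh_comp {m n k : ℕ} (f : H m n) (g : H n k) : sh (comp f g) = comp (sh f) (sh g)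
  unitAt_natural {m n : ℕ} (f : H m n) : comp f (unitAt n) = comp (unitAt m) (sh f)
  mulAt_natural {m n : ℕ} (f : H m n) : comp (sh (sh f)) (mulAt n) = comp (mulAt m) (sh f)
  counitAt_natural {m n : ℕ} (f : H m n) : comp (sh f) (counitAt n) = comp (counitAt m) f
  comulAt_natural {m n : ℕ} (f : H m n) : comp (sh f) (comulAt n) = comp (comulAt m) (sh (sh f))
  mulAt_assoc (n : ℕ) : comp (sh (mulAt n)) (mulAt n) = comp (mulAt (n + 1)) (mulAt n)
  unitAt_mulAt (n : ℕ) : comp (unitAt (n + 1)) (mulAt n) = idn (n + 1)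
  mulAt_unitAt (n : ℕ) : comp (sh (unitAt n)) (mulAt n) = idn (n + 1)
  comulAt_assoc (n : ℕ) : comp (comulAt n) (sh (comulAt n)) = comp (comulAt n) (comulAt (n + 1))
  counitAt_comulAt (n : ℕ) : comp (comulAt n) (counitAt (n + 1)) = idn (n + 1)
  comulAt_counitAt (n : ℕ) : comp (comulAt n) (sh (counitAt n)) = idn (n + 1)
  frob_left (n : ℕ) : comp (sh (comulAt n)) (mulAt (n + 1)) = comp (mulAt n) (comulAt n)
  frob_right (n : ℕ) : comp (comulAt (n + 1)) (sh (mulAt n)) = comp (mulAt n) (comulAt n)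

/-- Composition in a tower, in diagrammatic order. -/
infixr:80 " ⊙ " => Tower.comp

/-- The tower with all arrows reversed. -/
def Dual (H : ℕ → ℕ → Type w) (m n : ℕ) : Type w := H n m

namespace Tower

attribute [simp] id_comp comp_id assoc sh_id sh_comp

variable {H : ℕ → ℕ → Type w} [Tower H] {m n k l m' n' : ℕ}

/-- The axioms come in pairs exchanged by reversing arrows, the two Frobenius laws being one such
pair. Every statement on products and units thus yields one on coproducts and counits. -/
instance : Tower (Dual H) where
  idn n := (idn n : H n n)
  comp {m n k} f g := ((g : H k n) ⊙ (f : H n m) : H k m)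
  sh {m n} f := (sh (f : H n m) : H (n + 1) (m + 1))
  unitAt n := (counitAt n : H (n + 1) n)
  mulAt n := (comulAt n : H (n + 1) (n + 2))
  counitAt n := (unitAt n : H n (n + 1))
  comulAt n := (mulAt n : H (n + 2) (n + 1))
  id_comp f := comp_id (H := H) f
  comp_id f := id_comp (H := H) f
  assoc f g h := (assoc (H := H) h g f).symm
  sh_id := sh_id (H := H)
  sh_comp f g := sh_comp (H := H) g f
  unitAt_natural f := (counitAt_natural (H := H) f).symm
  mulAt_natural f := (comulAt_natural (H := H) f).symm
  counitAt_natural f := (unitAt_natural (H := H) f).symm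
  comulAt_natural f := (mulAt_natural (H := H) f).symm
  mulAt_assoc := comulAt_assoc (H := H)
  unitAt_mulAt := counitAt_comulAt (H := H)
  mulAt_unitAt := comulAt_counitAt (H := H)
  comulAt_assoc := mulAt_assoc (H := H)
  counitAt_comulAt := unitAt_mulAt (H := H)
  comulAt_counitAt := mulAt_unitAt (H := H)
  frob_left := frob_right (H := H)
  frob_right := frob_left (H := H)

section reassoc

theorem unitAt_natural_assoc (f : H m n) (g : H (n + 1) k) :
    f ⊙ unitAt n ⊙ g = unitAt m ⊙ sh f ⊙ g := by
  rw [← assoc, unitAt_natural, assoc]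

theorem mulAt_natural_assoc (f : H m n) (g : H (n + 1) k) :
    sh (sh f) ⊙ mulAt n ⊙ g = mulAt m ⊙ sh f ⊙ g := by
  rw [← assoc, mulAt_natural, assoc]

theorem comulAt_natural_assoc (f : H m n) (g : H (n + 2) k) :
    sh f ⊙ comulAt n ⊙ g = comulAt m ⊙ sh (sh f) ⊙ g := by
  rw [← assoc, comulAt_natural, assoc]

theorem counitAt_natural_assoc (f : H m n) (g : H n k) :
    sh f ⊙ counitAt n ⊙ g = counitAt m ⊙ f ⊙ g := by
  rw [← assoc, counitAt_natural, assoc]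

theorem unitAt_mulAt_assoc (g : H (n + 1) k) : unitAt (n + 1) ⊙ mulAt n ⊙ g = g := by
  rw [← assoc, unitAt_mulAt, id_comp]

theorem mulAt_unitAt_assoc (g : H (n + 1) k) : sh (unitAt n) ⊙ mulAt n ⊙ g = g := by
  rw [← assoc, mulAt_unitAt, id_comp]

theorem counitAt_comulAt_assoc (g : H (n + 1) k) : comulAt n ⊙ counitAt (n + 1) ⊙ g = g := by
  rw [← assoc, counitAt_comulAt, id_comp]

theorem comulAt_assoc_assoc (g : H (n + 3) k) :
    comulAt n ⊙ sh (comulAt n) ⊙ g = comulAt n ⊙ comulAt (n + 1) ⊙ g := by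
  rw [← assoc, comulAt_assoc, assoc]

theorem frob_left_assoc (g : H (n + 2) k) :
    sh (comulAt n) ⊙ mulAt (n + 1) ⊙ g = mulAt n ⊙ comulAt n ⊙ g := by
  rw [← assoc, frob_left, assoc]

theorem frob_right_assoc (g : H (n + 2) k) :
    comulAt (n + 1) ⊙ sh (mulAt n) ⊙ g = mulAt n ⊙ comulAt n ⊙ g := by
  rw [← assoc, frob_right, assoc]

end reassoc

/-- One bead on the first strand. -/
def beadAt (n : ℕ) : H (n + 1) (n + 1) := comulAt n ⊙ mulAt n

theorem beadAt_natural (f : H m n) : sh f ⊙ beadAt n = beadAt m ⊙ sh f := by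
  simp only [beadAt, assoc, comulAt_natural_assoc, mulAt_natural]

/-- Coassociativity and one Frobenius law slide a bead onto the second leg; the other Frobenius law
slides it onto the first. Beads can therefore move anywhere within a component, without
commutativity. -/
theorem beadAt_comulAt (n : ℕ) : (beadAt n : H _ _) ⊙ comulAt n = comulAt n ⊙ sh (beadAt n) := by
  simp only [beadAt, assoc, sh_comp, comulAt_assoc_assoc, frob_right]

theorem beadAt_comulAt_first (n : ℕ) :
    (beadAt n : H _ _) ⊙ comulAt n = comulAt n ⊙ beadAt (n + 1) := by
  simp only [beadAt, assoc]
  rw [← comulAt_assoc_assoc, frob_left]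

theorem mulAt_beadAt (n : ℕ) : (mulAt n : H _ _) ⊙ beadAt n = sh (beadAt n) ⊙ mulAt n :=
  beadAt_comulAt (H := Dual H) n

theorem mulAt_beadAt_first (n : ℕ) : (mulAt n : H _ _) ⊙ beadAt n = beadAt (n + 1) ⊙ mulAt n :=
  (beadAt_comulAt_first (H := Dual H) n)

/-- `j` beads on the first strand. -/
def beadsAt : (j n : ℕ) → H (n + 1) (n + 1)
  | 0, n => idn (n + 1)
  | j + 1, n => beadAt n ⊙ beadsAt j n

theorem beadsAt_add (i j n : ℕ) : (beadsAt (i + j) n : H _ _) = beadsAt i n ⊙ beadsAt j n := by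
  induction i with
  | zero => simp [beadsAt]
  | succ i ih => rw [Nat.add_right_comm]; simp [beadsAt, ih]

/-- Reversal puts the recursive bead at the other end, so this is not definitional; `beadsAt_add`
moves it back. -/
theorem beadsAt_dual (j n : ℕ) :
    @Eq (H (n + 1) (n + 1)) (beadsAt (H := Dual H) j n) (beadsAt j n) := by
  induction j with
  | zero => rfl
  | succ j ih =>
    change comp (H := H) (beadsAt (H := Dual H) j n) (beadAt n) = _
    rw [ih, beadsAt_add j 1 n]
    simp [beadsAt]

theorem beadsAt_natural (f : H m n) (j : ℕ) : sh f ⊙ beadsAt j n = beadsAt j m ⊙ sh f := by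
  induction j with
  | zero => simp [beadsAt]
  | succ j ih =>
    rw [beadsAt, ← assoc, beadAt_natural, assoc, ih, beadsAt, assoc]

theorem beadsAt_comulAt (j n : ℕ) :
    (beadsAt j n : H _ _) ⊙ comulAt n = comulAt n ⊙ sh (beadsAt j n) := by
  induction j with
  | zero => simp [beadsAt]
  | succ j ih => rw [beadsAt, assoc, ih, ← assoc, beadAt_comulAt, sh_comp, assoc]

theorem beadsAt_mulAt_first (j n : ℕ) :
    (beadsAt j (n + 1) : H _ _) ⊙ mulAt n = mulAt n ⊙ beadsAt j n := by
  induction j with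
  | zero => simp [beadsAt]
  | succ j ih =>
    simp only [beadsAt, assoc, ih]
    rw [← assoc, ← mulAt_beadAt_first, assoc]

theorem sh_beadsAt_mulAt (j n : ℕ) :
    sh (beadsAt j n : H _ _) ⊙ mulAt n = mulAt n ⊙ beadsAt j n := by
  induction j with
  | zero => simp [beadsAt]
  | succ j ih =>
    simp only [beadsAt, sh_comp, assoc, ih]
    rw [← assoc, ← mulAt_beadAt, assoc]

theorem beadsAt_natural_assoc (f : H m n) (j : ℕ) (g : H (n + 1) k) :
    sh f ⊙ beadsAt j n ⊙ g = beadsAt j m ⊙ sh f ⊙ g := by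
  rw [← assoc, beadsAt_natural, assoc]

theorem sh_beadsAt_mulAt_assoc (j n : ℕ) (g : H (n + 1) k) :
    sh (beadsAt j n : H _ _) ⊙ mulAt n ⊙ g = mulAt n ⊙ beadsAt j n ⊙ g := by
  rw [← assoc, sh_beadsAt_mulAt, assoc]

theorem beadsAt_mulAt_first_assoc (j n : ℕ) (g : H (n + 1) k) :
    (beadsAt j (n + 1) : H _ _) ⊙ mulAt n ⊙ g = mulAt n ⊙ beadsAt j n ⊙ g := by
  rw [← assoc, beadsAt_mulAt_first, assoc]

theorem beadsAt_comulAt_assoc (j n : ℕ) (g : H (n + 2) k) :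
    (beadsAt j n : H _ _) ⊙ comulAt n ⊙ g = comulAt n ⊙ sh (beadsAt j n) ⊙ g := by
  rw [← assoc, beadsAt_comulAt, assoc]

end Tower

/-! ### Steps, words and components, and pushing a source through a word. -/

open Tower

/-- Iterated coproducts splitting the first strand into at least one strand. -/
inductive IsSplit (H : ℕ → ℕ → Type w) [Tower H] (n : ℕ) : (k : ℕ) → H (n + 1) k → Prop
  | idn : IsSplit H n (n + 1) (idn (n + 1))
  | comulAt {k : ℕ} {f : H (n + 1) k} (hf : IsSplit H n k f) :
      IsSplit H n (k + 1) (comulAt n ⊙ sh f)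

/-- Iterated products merging the first strands. -/
def IsMerge (H : ℕ → ℕ → Type w) [Tower H] (n k : ℕ) (f : H k (n + 1)) : Prop :=
  IsSplit (Dual H) n k f

/-- A single product, coproduct, unit (if `U`) or counit (if `C`) beside identity strands. -/
inductive Step (H : ℕ → ℕ → Type w) [Tower H] (U C : Prop) : (m n : ℕ) → H m n → Prop
  | mulAt (n : ℕ) : Step H U C (n + 2) (n + 1) (mulAt n)
  | comulAt (n : ℕ) : Step H U C (n + 1) (n + 2) (comulAt n)
  | unitAt (n : ℕ) (h : U) : Step H U C n (n + 1) (unitAt n)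
  | counitAt (n : ℕ) (h : C) : Step H U C (n + 1) n (counitAt n)
  | sh {m n : ℕ} {f : H m n} (hf : Step H U C m n f) : Step H U C (m + 1) (n + 1) (sh f)

/-- A composite of steps, the first step outermost. -/
inductive Word (H : ℕ → ℕ → Type w) [Tower H] (U C : Prop) : (m n : ℕ) → H m n → Prop
  | nil (n : ℕ) : Word H U C n n (idn n)
  | cons {m n k : ℕ} {f : H m n} {g : H n k} (hf : Step H U C m n f) (hg : Word H U C n k g) :
      Word H U C m k (f ⊙ g)

/-- A composite of steps, the last step outermost. -/
inductive RWord (H : ℕ → ℕ → Type w) [Tower H] (U C : Prop) : (m n : ℕ) → H m n → Prop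
  | nil (n : ℕ) : RWord H U C n n (idn n)
  | snoc {m n k : ℕ} {f : H m n} {g : H n k} (hf : RWord H U C m n f) (hg : Step H U C n k g) :
      RWord H U C m k (f ⊙ g)

/-- A connected component with no inputs, with at least one output, beside identity strands. -/
inductive Source (H : ℕ → ℕ → Type w) [Tower H] : (m n : ℕ) → H m n → Prop
  | here (j n : ℕ) {k : ℕ} {f : H (n + 1) k} (hf : IsSplit H n k f) :
      Source H n k (unitAt n ⊙ beadsAt j n ⊙ f)
  | sh {m n : ℕ} {f : H m n} (hf : Source H m n f) : Source H (m + 1) (n + 1) (sh f)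

/-- A connected component with no inputs and no outputs, beside identity strands. -/
inductive Closed (H : ℕ → ℕ → Type w) [Tower H] : (n : ℕ) → H n n → Prop
  | here (j n : ℕ) : Closed H n (unitAt n ⊙ beadsAt j n ⊙ counitAt n)
  | sh {n : ℕ} {f : H n n} (hf : Closed H n f) : Closed H (n + 1) (sh f)

variable {H : ℕ → ℕ → Type w} [Tower H] {m n k l : ℕ} {U C : Prop}

theorem Word.trans {f : H m n} {g : H n k} (hf : Word H U C m n f) (hg : Word H U C n k g) :
    Word H U C m k (f ⊙ g) := by
  induction hf with
  | nil => simpa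
  | cons hs _ ih => rw [Tower.assoc]; exact .cons hs (ih hg)

theorem RWord.trans {f : H m n} {g : H n k} (hf : RWord H U C m n f) (hg : RWord H U C n k g) :
    RWord H U C m k (f ⊙ g) := by
  induction hg with
  | nil => simpa
  | snoc _ hs ih => rw [← Tower.assoc]; exact .snoc ih hs

theorem Step.word {f : H m n} (hf : Step H U C m n f) : Word H U C m n f := by
  simpa using Word.cons hf (.nil n)

theorem Step.rword {f : H m n} (hf : Step H U C m n f) : RWord H U C m n f := by
  simpa using RWord.snoc (.nil m) hf

theorem Word.sh {f : H m n} (hf : Word H U C m n f) :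
    Word H U C (m + 1) (n + 1) (sh f) := by
  induction hf with
  | nil => rw [sh_id]; exact .nil _
  | cons hs _ ih => rw [sh_comp]; exact .cons hs.sh ih

theorem RWord.sh {f : H m n} (hf : RWord H U C m n f) :
    RWord H U C (m + 1) (n + 1) (sh f) := by
  induction hf with
  | nil => rw [sh_id]; exact .nil _
  | snoc _ hs ih => rw [sh_comp]; exact .snoc ih hs.sh

theorem Word.rword {f : H m n} (hf : Word H U C m n f) : RWord H U C m n f := by
  induction hf with
  | nil => exact .nil _
  | cons hs _ ih => exact hs.rword.trans ih

theorem Step.mono {U' C' : Prop} (hU : U → U') (hC : C → C') {f : H m n}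
    (hf : Step H U C m n f) : Step H U' C' m n f := by
  induction hf with
  | mulAt n => exact .mulAt n
  | comulAt n => exact .comulAt n
  | unitAt n h => exact .unitAt n (hU h)
  | counitAt n h => exact .counitAt n (hC h)
  | sh _ ih => exact .sh ih

theorem RWord.mono {U' C' : Prop} (hU : U → U') (hC : C → C') {f : H m n}
    (hf : RWord H U C m n f) : RWord H U' C' m n f := by
  induction hf with
  | nil => exact .nil _
  | snoc _ hs ih => exact .snoc ih (hs.mono hU hC)

theorem Step.dual {f : H m n} (hf : Step H U C m n f) : Step (Dual H) C U n m f := by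
  induction hf with
  | mulAt n => exact Step.comulAt (H := Dual H) n
  | comulAt n => exact Step.mulAt (H := Dual H) n
  | unitAt n h => exact Step.counitAt (H := Dual H) n h
  | counitAt n h => exact Step.unitAt (H := Dual H) n h
  | sh _ ih => exact Step.sh (H := Dual H) ih

theorem Word.dual {f : H m n} (hf : Word H U C m n f) : RWord (Dual H) C U n m f := by
  induction hf with
  | nil => exact RWord.nil (H := Dual H) _
  | cons hs _ ih => exact RWord.snoc (H := Dual H) ih hs.dual

theorem RWord.dual {f : H m n} (hf : RWord H U C m n f) : Word (Dual H) C U n m f := by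
  induction hf with
  | nil => exact Word.nil (H := Dual H) _
  | snoc _ hs ih => exact Word.cons (H := Dual H) hs.dual ih

theorem word_beadsAt (j n : ℕ) : Word H U C (n + 1) (n + 1) (beadsAt j n) := by
  induction j with
  | zero => exact .nil _
  | succ j ih =>
    rw [beadsAt, beadAt, Tower.assoc]
    exact .cons (.comulAt n) (.cons (.mulAt n) ih)

namespace IsSplit

theorem word {f : H (n + 1) k} (hf : IsSplit H n k f) : Word H U C (n + 1) k f := by
  induction hf with
  | idn => exact .nil _
  | comulAt _ ih => exact .cons (.comulAt n) ih.sh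

/-- Splittings are kept as combs, each coproduct acting on the second leg of the previous one. A
coproduct on the first leg of `f` is carried up by naturality and reassociated into the comb. -/
theorem trans {f : H (n + 1) (k + 1)} {g : H (k + 1) l} (hf : IsSplit H n (k + 1) f)
    (hg : IsSplit H k l g) : IsSplit H n l (f ⊙ g) := by
  induction hg with
  | idn => simpa
  | comulAt hg ih =>
    cases hf with
    | idn => simpa using IsSplit.comulAt hg
    | @comulAt _ f hf =>
      rw [Tower.assoc, comulAt_natural_assoc, ← comulAt_assoc_assoc, ← sh_comp, ← sh_comp,
        ← Tower.assoc]
      exact .comulAt ih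

/-- A product with one extra strand on the left may be taken before splitting. -/
theorem sh_mulAt {f : H (n + 1) (k + 1)} (hf : IsSplit H n (k + 1) f) :
    Tower.sh f ⊙ Tower.mulAt k = Tower.mulAt n ⊙ f := by
  cases hf with
  | idn => simp
  | comulAt hf => rw [sh_comp, Tower.assoc, mulAt_natural, frob_left_assoc]

end IsSplit

/-- The possible results of a step (not a unit) after splitting the first strand. -/
inductive SplitStep (H : ℕ → ℕ → Type w) [Tower H] (C : Prop) : (n k : ℕ) → H (n + 1) k → Prop
  | legs {n k : ℕ} (j : ℕ) {f : H (n + 1) k} (hf : IsSplit H n k f) :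
      SplitStep H C n k (beadsAt j n ⊙ f)
  | right {n m k : ℕ} {s : H n m} {f : H (m + 1) k} (hs : Step H False C n m s)
      (hf : IsSplit H m k f) : SplitStep H C n k (sh s ⊙ f)
  | mulAt {n k : ℕ} {f : H (n + 1) k} (hf : IsSplit H n k f) : SplitStep H C (n + 1) k (mulAt n ⊙ f)
  | counitAt {n : ℕ} (h : C) : SplitStep H C n n (counitAt n)

theorem SplitStep.legs_zero {f : H (n + 1) k} (hf : IsSplit H n k f) : SplitStep H C n k f := by
  simpa [beadsAt] using SplitStep.legs (C := C) 0 hf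

/-- A coproduct on a leg joins the comb, a product of two neighbouring legs becomes a bead, a counit
removes a leg, and a step right of all legs commutes. A product of the last leg with the next strand
can be done before the splitting. A counit survives only on an unsplit strand. -/
theorem IsSplit.step {f : H (n + 1) k} (hf : IsSplit H n k f) {s : H k l}
    (hs : Step H False C k l s) : SplitStep H C n l (f ⊙ s) := by
  induction hf generalizing l with
  | idn =>
    rw [Tower.id_comp]
    cases hs with
    | mulAt n => simpa using SplitStep.mulAt (C := C) (IsSplit.idn (H := H) (n := n))
    | comulAt n =>
      exact .legs_zero (by simpa using IsSplit.comulAt (IsSplit.idn (H := H) (n := n)))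
    | unitAt n h => exact h.elim
    | counitAt n h => exact .counitAt h
    | sh hs => simpa using SplitStep.right hs (IsSplit.idn (H := H))
  | @comulAt k f hf ih =>
    cases hs with
    | mulAt k =>
      cases hf with
      | idn =>
        simpa [beadsAt, beadAt] using SplitStep.legs (C := C) 1 (IsSplit.idn (H := H) (n := n))
      | @comulAt _ f' hf =>
        -- Naturality brings the product up to the second coproduct; the Frobenius law then places
        -- it before that coproduct, where it forms a bead with the first.
        have : (Tower.comulAt n ⊙ sh (Tower.comulAt n ⊙ sh f')) ⊙ Tower.mulAt _ =
            beadsAt 1 n ⊙ Tower.comulAt n ⊙ sh f' := by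
          simp only [sh_comp, Tower.assoc, mulAt_natural, frob_left_assoc, beadsAt, beadAt,
            Tower.id_comp]
        rw [this]
        exact .legs 1 (.comulAt hf)
    | comulAt k =>
      rw [Tower.assoc, comulAt_natural, ← comulAt_assoc_assoc, ← sh_comp]
      exact .legs_zero (.comulAt (.comulAt hf))
    | unitAt n h => exact h.elim
    | counitAt k h =>
      rw [Tower.assoc, counitAt_natural, counitAt_comulAt_assoc]
      exact .legs_zero hf
    | @sh _ _ s hs =>
      rw [Tower.assoc, ← sh_comp]
      generalize hg : f ⊙ s = g
      have := hg ▸ ih hs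
      cases this with
      | legs j hf =>
        rw [sh_comp, ← beadsAt_comulAt_assoc]
        exact .legs j (.comulAt hf)
      | right hs hf =>
        rw [sh_comp, ← comulAt_natural_assoc]
        exact .right hs (.comulAt hf)
      | mulAt hf =>
        rw [sh_comp, frob_right_assoc]
        exact .mulAt (.comulAt hf)
      | counitAt h =>
        rw [comulAt_counitAt]
        exact .legs_zero .idn

/-- The possible results of a step (not a unit) after a source. -/
inductive SourceStep (H : ℕ → ℕ → Type w) [Tower H] (C : Prop) : (m k : ℕ) → H m k → Prop
  | commute {m m' k : ℕ} {w : H m m'} {i : H m' k} (hw : Word H False C m m' w)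
      (hi : Source H m' k i) : SourceStep H C m k (w ⊙ i)
  | absorb {m k : ℕ} {w : H m k} (hw : Word H False C m k w) : SourceStep H C m k w
  | closed {m k : ℕ} {i : H m m} {w : H m k} (hi : Closed H m i) (hw : Word H False C m k w) :
      SourceStep H C m k (i ⊙ w)

theorem SourceStep.commute_zero {i : H m k} (hi : Source H m k i) : SourceStep H C m k i := by
  simpa using SourceStep.commute (C := C) (.nil _) hi

theorem SourceStep.sh {f : H m k} (hf : SourceStep H C m k f) :
    SourceStep H C (m + 1) (k + 1) (sh f) := by
  cases hf with
  | commute hw hi => rw [sh_comp]; exact .commute hw.sh hi.sh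
  | absorb hw => exact .absorb hw.sh
  | closed hi hw => rw [sh_comp]; exact .closed hi.sh hw.sh

/-- By `IsSplit.step` only a product with a strand outside the source, or a counit on its sole leg,
is new. The product can be moved up to the unit, which disappears by a unit law; the counit closes
the component. -/
theorem Source.step {i : H m k} (hi : Source H m k i) {s : H k l}
    (hs : Step H False C k l s) : SourceStep H C m l (i ⊙ s) := by
  induction hi generalizing l with
  | here j n hf =>
    rename_i k f
    rw [Tower.assoc, Tower.assoc]
    generalize hg : f ⊙ s = g
    have := hg ▸ hf.step hs
    cases this with
    | legs i hf =>
      rw [← Tower.assoc (beadsAt j n), ← beadsAt_add]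
      exact .commute_zero (.here _ _ hf)
    | right hs hf =>
      rw [← beadsAt_natural_assoc, ← unitAt_natural_assoc]
      exact .commute hs.word (.here _ _ hf)
    | mulAt hf =>
      rw [beadsAt_mulAt_first_assoc, unitAt_mulAt_assoc]
      exact .absorb ((word_beadsAt _ _).trans hf.word)
    | counitAt h => simpa using SourceStep.closed (.here j n) (Word.nil (U := False) (C := C) n)
  | @sh m k i hi ih =>
    cases hs with
    | mulAt k =>
      cases hi with
      | here j m hf =>
        -- Here the product joins the source to the strand on its left. It passes the splitting and
        -- the beads and meets the unit.
        rw [sh_comp, sh_comp, Tower.assoc, Tower.assoc, hf.sh_mulAt, sh_beadsAt_mulAt_assoc,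
          mulAt_unitAt_assoc]
        exact .absorb ((word_beadsAt _ _).trans hf.word)
      | sh hi =>
        rw [mulAt_natural]
        exact .commute (Step.mulAt _).word hi.sh
    | comulAt k =>
      rw [comulAt_natural]
      exact .commute (Step.comulAt _).word hi.sh.sh
    | unitAt n h => exact h.elim
    | counitAt k h =>
      rw [counitAt_natural]
      exact .commute (Step.counitAt _ h).word hi
    | sh hs => rw [← sh_comp]; exact (ih hs).sh

/-- The possible results of a word without units after a source. -/
inductive SourceWord (H : ℕ → ℕ → Type w) [Tower H] (C : Prop) : (m k : ℕ) → H m k → Prop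
  | stuck {m m' k : ℕ} {w : H m m'} {i : H m' k} (hw : Word H False C m m' w)
      (hi : Source H m' k i) : SourceWord H C m k (w ⊙ i)
  | absorb {m k : ℕ} {w : H m k} (hw : Word H False C m k w) : SourceWord H C m k w
  | closed {m m' k : ℕ} {v : H m m'} {i : H m' m'} {w : H m' k} (hv : Word H False C m m' v)
      (hi : Closed H m' i) (hw : Word H False C m' k w) : SourceWord H C m k (v ⊙ i ⊙ w)

theorem Source.comp_word {i : H m k} (hi : Source H m k i) {w : H k l}
    (hw : Word H False C k l w) : SourceWord H C m l (i ⊙ w) := by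
  induction hw generalizing m with
  | nil => simpa using SourceWord.stuck (C := C) (.nil _) hi
  | @cons k k' l s w hs hw ih =>
    rw [← Tower.assoc]
    generalize hg : i ⊙ s = g
    have := hg ▸ hi.step hs
    cases this with
    | @commute _ _ v i hv hi =>
      rw [Tower.assoc]
      generalize hg : i ⊙ w = g
      have := hg ▸ ih hi
      cases this with
      | stuck hw hi => rw [← Tower.assoc]; exact .stuck (hv.trans hw) hi
      | absorb hw => exact .absorb (hv.trans hw)
      | closed hu hi hw => rw [← Tower.assoc]; exact .closed (hv.trans hu) hi hw
    | absorb hv => exact .absorb (hv.trans hw)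
    | closed hi hv =>
      rw [Tower.assoc]
      simpa using SourceWord.closed (.nil _) hi (hv.trans hw)

end PlanarSpider

/-! ### Standard morphisms, elimination of units and counits, and words made of blocks. -/

namespace PlanarSpider

universe w w'

open Tower

variable {H : ℕ → ℕ → Type w} [Tower H] {m n k l : ℕ} {U C : Prop}

section Standard

variable (H)

/-- The iterated product of all strands. -/
def mergeAll : (m : ℕ) → H m 1
  | 0 => unitAt 0
  | 1 => idn 1
  | m + 2 => sh (mergeAll (m + 1)) ⊙ mulAt 0

/-- The iterated coproduct onto all strands. -/
def splitAll : (n : ℕ) → H 1 n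
  | 0 => counitAt 0
  | 1 => idn 1
  | n + 2 => comulAt 0 ⊙ sh (splitAll (n + 1))

/-- The standard morphism with `j` beads. -/
def std (m n j : ℕ) : H m n := mergeAll H m ⊙ beadsAt j 0 ⊙ splitAll H n

/-- All units. -/
def units : (m : ℕ) → H 0 m
  | 0 => idn 0
  | m + 1 => units m ⊙ unitAt m

/-- All counits. -/
def counits : (n : ℕ) → H n 0
  | 0 => idn 0
  | n + 1 => counitAt n ⊙ counits n

end Standard

theorem mergeAll_dual (m : ℕ) : @Eq (H 1 m) (mergeAll (Dual H) m) (splitAll H m) := by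
  match m with
  | 0 => rfl
  | 1 => rfl
  | m + 2 =>
    change comp (H := H) (comulAt 0) (sh (H := H) (mergeAll (Dual H) (m + 1))) = _
    rw [mergeAll_dual (m + 1)]
    rfl

theorem splitAll_dual (m : ℕ) : @Eq (H m 1) (splitAll (Dual H) m) (mergeAll H m) := by
  match m with
  | 0 => rfl
  | 1 => rfl
  | m + 2 =>
    change comp (H := H) (sh (H := H) (splitAll (Dual H) (m + 1))) (mulAt 0) = _
    rw [splitAll_dual (m + 1)]
    rfl

theorem std_dual (m n j : ℕ) : @Eq (H m n) (std (Dual H) n m j) (std H m n j) := by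
  change comp (H := H) (comp (H := H) (splitAll (Dual H) m) (beadsAt (H := Dual H) j 0))
    (mergeAll (Dual H) n) = _
  rw [mergeAll_dual, splitAll_dual, beadsAt_dual, Tower.assoc]
  rfl

theorem units_mergeAll (m : ℕ) : units H m ⊙ mergeAll H m = unitAt 0 := by
  match m with
  | 0 => simp [units, mergeAll]
  | 1 => simp [units, mergeAll]
  | m + 2 =>
    rw [units, mergeAll, Tower.assoc, ← unitAt_natural_assoc, unitAt_mulAt, Tower.comp_id,
      units_mergeAll (m + 1)]

theorem splitAll_counits (n : ℕ) : splitAll H n ⊙ counits H n = counitAt 0 := by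
  match n with
  | 0 => simp [counits, splitAll]
  | 1 => simp [counits, splitAll]
  | n + 2 =>
    rw [counits, splitAll, Tower.assoc, counitAt_natural_assoc, splitAll_counits (n + 1),
      ← Tower.assoc, counitAt_comulAt, Tower.id_comp]

/-- Closing every leg removes merging and splitting, so that only the beads have to be evaluated in
a model. -/
theorem units_std_counits (m n j : ℕ) :
    units H m ⊙ std H m n j ⊙ counits H n = unitAt 0 ⊙ beadsAt j 0 ⊙ counitAt 0 := by
  rw [std, Tower.assoc, Tower.assoc, splitAll_counits, ← Tower.assoc, units_mergeAll]

/-- With no strands to the right, a comb is determined by its number of legs; it has at least one.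
-/
theorem IsSplit.eq_splitAll {f : H 1 n} (hf : IsSplit H 0 n f) : f = splitAll H n := by
  induction n with
  | zero => cases hf
  | succ n ih =>
    cases hf with
    | idn => rfl
    | comulAt hf =>
      cases n with
      | zero => cases hf
      | succ n => rw [ih hf, splitAll]

theorem IsMerge.eq_mergeAll {f : H m 1} (hf : IsMerge H 0 m f) : f = mergeAll H m :=
  (IsSplit.eq_splitAll (H := Dual H) hf).trans (splitAll_dual m)

theorem IsMerge.trans {f : H (n + 1) (k + 1)} {g : H l (n + 1)} (hg : IsMerge H n l g)
    (hf : IsMerge H k (n + 1) f) : IsMerge H k l (g ⊙ f) :=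
  IsSplit.trans (H := Dual H) hf hg

theorem IsMerge.sh_mulAt {g : H k (n + 1)} (hg : IsMerge H n k g) :
    IsMerge H n (k + 1) (sh g ⊙ mulAt n) :=
  IsSplit.comulAt (H := Dual H) hg

theorem IsMerge.idn : IsMerge H n (n + 1) (idn (n + 1)) := IsSplit.idn (H := Dual H)

section UnitFree

theorem RWord.weaken {f : H m n} (hf : RWord H U C m n f) : RWord H True True m n f :=
  hf.mono (fun _ => trivial) fun _ => trivial

/-- The identity of the object `0`. -/
inductive IsTrivial (H : ℕ → ℕ → Type w) [Tower H] : (m n : ℕ) → H m n → Prop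
  | intro : IsTrivial H 0 0 (idn 0)

theorem IsTrivial.dual {f : H m n} (hf : IsTrivial H m n f) : IsTrivial (Dual H) n m f := by
  cases hf
  exact .intro (H := Dual H)

theorem Step.free_or_source {s : H m n} (hs : Step H U C m n s) :
    Step H False C m n s ∨ Source H m n s := by
  induction hs with
  | mulAt n => exact .inl (.mulAt n)
  | comulAt n => exact .inl (.comulAt n)
  | unitAt n h =>
    right
    simpa [beadsAt] using Source.here 0 n (IsSplit.idn (H := H))
  | counitAt n h => exact .inl (.counitAt n h)
  | sh _ ih => exact ih.imp .sh .sh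

theorem Source.eq_std {i : H 0 n} (hi : Source H 0 n i) : ∃ j, i = std H 0 n j := by
  cases hi with
  | here j _ hf => exact ⟨j, by rw [hf.eq_splitAll]; rfl⟩

theorem Closed.eq_std {i : H 0 0} (hi : Closed H 0 i) : ∃ j, i = std H 0 0 j := by
  cases hi with
  | here j _ => exact ⟨j, rfl⟩

/-- Assuming a count of connected components `2 ^ c`, a connected word is standard or may be
written without units. -/
theorem RWord.unit_free (cnt : ∀ {m n : ℕ}, H m n → ℕ)
    (hsource : ∀ {m n k : ℕ} (f : H m n) {i : H n k}, Source H n k i → cnt (f ⊙ i) = 2 * cnt f)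
    (hclosed : ∀ {m n k : ℕ} (f : H m n) {i : H n n} (g : H n k), Closed H n i →
      cnt (f ⊙ i ⊙ g) = 2 * cnt (f ⊙ g))
    (htriv : ∀ {m n k : ℕ} {f : H m n} {g : H n k}, RWord H True True m n f →
      RWord H True True n k g → cnt (f ⊙ g) = 1 → IsTrivial H m n f ∧ IsTrivial H n k g)
    {f : H m n} (hf : RWord H U C m n f) {g : H n k} (hg : Word H False C n k g)
    (h : cnt (f ⊙ g) = 2) : Word H False C m k (f ⊙ g) ∨ ∃ j, f ⊙ g = std H m k j := by
  induction hf with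
  | nil => left; simpa
  | @snoc n' n f s hf hs ih =>
    rw [Tower.assoc] at h ⊢
    -- The last step of `f` moves over to `g`. If unit-free it lengthens `g`; if a unit, it is a
    -- source to be pushed through `g`.
    rcases hs.free_or_source with hs | hs
    · exact ih (.cons hs hg) h
    · generalize hx : s ⊙ g = x at h ⊢
      have hx := hx ▸ hs.comp_word hg
      cases hx with
      | @stuck l _ w i hw hi =>
        -- A source reaching the bottom is a component of its own, so the rest has count `1` and is
        -- empty.
        right
        rw [← Tower.assoc, hsource _ hi] at h
        have ht := (htriv (hf.weaken.trans hw.rword.weaken) (.nil _)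
          (by rw [Tower.comp_id]; omega)).1
        rw [← Tower.assoc]
        generalize f ⊙ w = y at ht ⊢
        cases ht
        rw [Tower.id_comp]
        exact hi.eq_std
      | absorb hw => exact ih hw h
      | @closed l _ v i w hv hi hw =>
        -- Likewise a closed component uses up the factor `2`, and the words on both sides of it are
        -- empty.
        right
        rw [← Tower.assoc, hclosed _ _ hi] at h
        have ht := htriv (hf.weaken.trans hv.rword.weaken) hw.rword.weaken (by omega)
        rw [← Tower.assoc]
        generalize f ⊙ v = y at ht ⊢
        obtain ⟨h1, h2⟩ := ht
        cases h1
        cases h2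
        rw [Tower.id_comp, Tower.comp_id]
        exact hi.eq_std

end UnitFree

/-- A juxtaposition of `c` connected components, each with inputs and outputs. -/
inductive Blocks (H : ℕ → ℕ → Type w) [Tower H] : (c m n : ℕ) → H m n → Prop
  | nil : Blocks H 0 0 0 (idn 0)
  | cons {c m n k l : ℕ} {g : H k (m + 1)} {f : H (n + 1) l} {B : H m n}
      (hg : IsMerge H m k g) (j : ℕ) (hB : Blocks H c m n B) (hf : IsSplit H n l f) :
      Blocks H (c + 1) k l (g ⊙ beadsAt j m ⊙ sh B ⊙ f)

theorem exists_blocks_idn (n : ℕ) : ∃ c, Blocks H c n n (idn n) := by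
  induction n with
  | zero => exact ⟨0, .nil⟩
  | succ n ih =>
    obtain ⟨c, hc⟩ := ih
    exact ⟨c + 1, by simpa [beadsAt] using Blocks.cons .idn 0 hc .idn⟩

/-- By `IsSplit.step` for the first block, the step adds a leg or a bead there, acts on the later
blocks, or multiplies the last leg of the first block with the first leg of the next one; then the
two blocks fuse. -/
theorem Blocks.step {c : ℕ} {B : H m n} (hB : Blocks H c m n B) {s : H n k}
    (hs : Step H False False n k s) : ∃ c, Blocks H c m k (B ⊙ s) := by
  induction hB generalizing k with
  | nil =>
    cases hs with
    | unitAt _ h => exact h.elim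
  | @cons c m n m' n' g f B hg j hB hf ih =>
    simp only [Tower.assoc]
    generalize hx : f ⊙ s = x
    have hx := hx ▸ hf.step hs
    cases hx with
    | @legs _ _ i f hf =>
      refine ⟨c + 1, ?_⟩
      rw [beadsAt_natural_assoc, ← Tower.assoc (beadsAt j m), ← beadsAt_add]
      exact .cons hg _ hB hf
    | right hs hf =>
      obtain ⟨c', hc⟩ := ih hs
      refine ⟨c' + 1, ?_⟩
      rw [← Tower.assoc (sh B), ← sh_comp]
      exact .cons hg j hc hf
    | @mulAt n'' _ f hf =>
      -- The product takes a strand of `B`, so `B` has a first block. Fusing concatenates the merges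
      -- and the splittings and adds the numbers of beads.
      cases hB with
      | @cons c m₂ n₂ _ _ g₂ f₂ B₂ hg₂ j₂ hB₂ hf₂ =>
        refine ⟨c + 1, ?_⟩
        have := Blocks.cons (hg.trans hg₂.sh_mulAt) (j + j₂) hB₂ (hf₂.trans hf)
        convert this using 1
        simp only [Tower.assoc, sh_comp]
        rw [← Tower.assoc (sh f₂), hf₂.sh_mulAt, Tower.assoc, mulAt_natural_assoc,
          sh_beadsAt_mulAt_assoc, beadsAt_add, Tower.assoc, ← beadsAt_natural_assoc,
          beadsAt_mulAt_first_assoc]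
    | counitAt h => exact h.elim

theorem RWord.blocks {f : H m n} (hf : RWord H False False m n f) : ∃ c, Blocks H c m n f := by
  induction hf with
  | nil => exact exists_blocks_idn _
  | snoc _ hs ih =>
    obtain ⟨c, hc⟩ := ih
    exact hc.step hs

theorem Blocks.eq_std {f : H m n} (hf : Blocks H 1 m n f) : ∃ j, f = std H m n j := by
  cases hf with
  | cons hg j hB hf =>
    cases hB
    exact ⟨j, by rw [hg.eq_mergeAll, hf.eq_splitAll, sh_id, Tower.id_comp, std]⟩

theorem Closed.of_dual {i : Dual H n n} (hi : Closed (Dual H) n i) : Closed H n i := by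
  induction hi with
  | here j n =>
    have := Closed.here (H := H) j n
    rw [← Tower.assoc, ← beadsAt_dual] at this
    exact this
  | sh _ ih => exact Closed.sh (H := H) ih

/-- A word is standard if its number of connected components is one, as seen from a function `cnt`
which behaves like `2 ^ c`, where `c` is the number of connected components. -/
theorem RWord.eq_std (cnt : ∀ {m n : ℕ}, H m n → ℕ)
    (hsource : ∀ {m n k : ℕ} (f : H m n) {i : H n k}, Source H n k i → cnt (f ⊙ i) = 2 * cnt f)
    (hsink : ∀ {m n k : ℕ} (f : H n k) {i : H m n}, Source (Dual H) n m i →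
      cnt (i ⊙ f) = 2 * cnt f)
    (hclosed : ∀ {m n k : ℕ} (f : H m n) {i : H n n} (g : H n k), Closed H n i →
      cnt (f ⊙ i ⊙ g) = 2 * cnt (f ⊙ g))
    (htriv : ∀ {m n k : ℕ} {f : H m n} {g : H n k}, RWord H True True m n f →
      RWord H True True n k g → cnt (f ⊙ g) = 1 → IsTrivial H m n f ∧ IsTrivial H n k g)
    (hblocks : ∀ {c m n : ℕ} {f : H m n}, Blocks H c m n f → cnt f = 2 ^ c)
    {f : H m n} (hf : RWord H U C m n f) (h : cnt f = 2) : ∃ j, f = std H m n j := by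
  -- In the dual tower the units are the counits of `f`, and the count of sinks becomes that of
  -- sources.
  have key : ∀ f : Dual H n m, RWord (Dual H) C False n m f → cnt (m := m) (n := n) f = 2 →
      Word (Dual H) False False n m f ∨ ∃ j, f = std (Dual H) n m j := by
    intro f hf h
    simpa using RWord.unit_free (H := Dual H) (fun {m n} f => cnt (m := n) (n := m) f)
      (fun f _ hi => hsink f hi)
      (fun f i g hi => 
        (congrArg cnt (Tower.assoc (H := H) g i f)).trans (hclosed g f hi.of_dual))
      (fun hf hg h => by
        have := htriv hg.dual.rword hf.dual.rword h
        exact ⟨this.2.dual, this.1.dual⟩) hf (.nil m) (by simpa using h)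
  -- Units are removed first, then counits in the dual. What remains consists of blocks, and `2 ^ c
  -- = 2` leaves one.
  rcases RWord.unit_free (H := H) cnt hsource hclosed htriv hf (.nil n) (by simpa)
    with hw | ⟨j, hj⟩
  · rw [Tower.comp_id] at hw
    rcases key f hw.dual h with hw | ⟨j, hj⟩
    · obtain ⟨c, hc⟩ := (hw.dual : RWord H False False m n f).blocks
      have hc' := hblocks hc
      rw [h] at hc'
      have : c = 1 := Nat.pow_right_injective le_rfl (by simpa using hc'.symm)
      subst this
      exact hc.eq_std
    · exact ⟨j, hj.trans (std_dual ..)⟩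
  · exact ⟨j, by simpa using hj⟩

end PlanarSpider

/-! ### Drawings as words, and the tower of tensor powers. -/

namespace PlanarSpider

universe w w'

open Tower

/-- The row of nodes in a tower. -/
def Level.evalIn (H : ℕ → ℕ → Type w) [Tower H] : {m n : ℕ} → Level m n → H m n
  | _, _, nil => idn 0
  | _, _, strand _ L => sh (L.evalIn H)
  | _, _, mul (n := n) _ L => sh (sh (L.evalIn H)) ⊙ mulAt n
  | _, _, comul (n := n) _ L => sh (L.evalIn H) ⊙ comulAt n
  | _, _, cup (n := n) _ L => sh (sh (L.evalIn H)) ⊙ mulAt n ⊙ counitAt n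
  | _, _, cap (n := n) _ L => L.evalIn H ⊙ unitAt n ⊙ comulAt n
  | _, _, unit (n := n) _ L => L.evalIn H ⊙ unitAt n
  | _, _, counit (n := n) _ L => sh (L.evalIn H) ⊙ counitAt n

/-- The drawing in a tower. -/
def Drawing.evalIn (H : ℕ → ℕ → Type w) [Tower H] : {m n : ℕ} → Drawing m n → H m n
  | _, _, last (n := n) _ => idn n
  | _, _, cons _ L D => L.evalIn H ⊙ D.evalIn H

theorem Level.rword (H : ℕ → ℕ → Type w) [Tower H] {m n : ℕ} (L : Level m n) :
    RWord H True True m n (L.evalIn H) := by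
  induction L with
  | nil => exact .nil 0
  | strand _ _ ih => exact ih.sh
  | mul _ _ ih => exact ih.sh.sh.snoc (.mulAt _)
  | comul _ _ ih => exact ih.sh.snoc (.comulAt _)
  | cup _ _ ih =>
    rw [evalIn, ← Tower.assoc]
    exact (ih.sh.sh.snoc (.mulAt _)).snoc (.counitAt _ trivial)
  | cap _ _ ih =>
    rw [evalIn, ← Tower.assoc]
    exact (ih.snoc (.unitAt _ trivial)).snoc (.comulAt _)
  | unit _ _ ih => exact ih.snoc (.unitAt _ trivial)
  | counit _ _ ih => exact ih.sh.snoc (.counitAt _ trivial)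

theorem Drawing.rword (H : ℕ → ℕ → Type w) [Tower H] {m n : ℕ} (D : Drawing m n) :
    RWord H True True m n (D.evalIn H) := by
  induction D with
  | last _ => exact .nil _
  | cons _ L _ ih => exact (L.rword H).trans ih

section Category

variable {C : Type u} [Category.{v} C] [MonoidalCategory C] (A : C)

section

variable (X : C) [MonObj A] [ComonObj A]

-- This and the following lemmas are the algebra, coalgebra and Frobenius axioms tensored on the
-- right with `X`; beyond the axiom there is only coherence.
omit [ComonObj A] in
theorem whisker_mul_assoc :
    A ◁ ((α_ A A X).inv ≫ μ[A] ▷ X) ≫ (α_ A A X).inv ≫ μ[A] ▷ X =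
      ((α_ A A (A ⊗ X)).inv ≫ μ[A] ▷ (A ⊗ X)) ≫ (α_ A A X).inv ≫ μ[A] ▷ X := by
  calc _ = 𝟙 _ ⊗≫ ((α_ A A A).hom ≫ A ◁ μ[A] ≫ μ[A]) ▷ X := by monoidal
    _ = 𝟙 _ ⊗≫ (μ[A] ▷ A ≫ μ[A]) ▷ X := by rw [MonObj.mul_assoc]
    _ = _ := by monoidal

omit [ComonObj A] in
theorem whisker_one_mul :
    ((λ_ (A ⊗ X)).inv ≫ η[A] ▷ (A ⊗ X)) ≫ (α_ A A X).inv ≫ μ[A] ▷ X = 𝟙 (A ⊗ X) := by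
  calc _ = 𝟙 _ ⊗≫ (η[A] ▷ A ≫ μ[A]) ▷ X := by monoidal
    _ = 𝟙 _ ⊗≫ (λ_ A).hom ▷ X := by rw [MonObj.one_mul]
    _ = _ := by monoidal

omit [ComonObj A] in
theorem whisker_mul_one :
    A ◁ ((λ_ X).inv ≫ η[A] ▷ X) ≫ (α_ A A X).inv ≫ μ[A] ▷ X = 𝟙 (A ⊗ X) := by
  calc _ = 𝟙 _ ⊗≫ (A ◁ η[A] ≫ μ[A]) ▷ X := by monoidal
    _ = 𝟙 _ ⊗≫ (ρ_ A).hom ▷ X := by rw [MonObj.mul_one]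
    _ = _ := by monoidal

omit [MonObj A] in
theorem whisker_comul_assoc :
    (Δ[A] ▷ X ≫ (α_ A A X).hom) ≫ A ◁ (Δ[A] ▷ X ≫ (α_ A A X).hom) =
      (Δ[A] ▷ X ≫ (α_ A A X).hom) ≫ Δ[A] ▷ (A ⊗ X) ≫ (α_ A A (A ⊗ X)).hom := by
  calc _ = (Δ[A] ≫ A ◁ Δ[A]) ▷ X ⊗≫ 𝟙 _ := by monoidal
    _ = (Δ[A] ≫ Δ[A] ▷ A ≫ (α_ A A A).hom) ▷ X ⊗≫ 𝟙 _ := by rw [ComonObj.comul_assoc]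
    _ = _ := by monoidal

omit [MonObj A] in
theorem whisker_counit_comul :
    (Δ[A] ▷ X ≫ (α_ A A X).hom) ≫ ε[A] ▷ (A ⊗ X) ≫ (λ_ (A ⊗ X)).hom = 𝟙 (A ⊗ X) := by
  calc _ = (Δ[A] ≫ ε[A] ▷ A) ▷ X ⊗≫ 𝟙 _ := by monoidal
    _ = (λ_ A).inv ▷ X ⊗≫ 𝟙 _ := by rw [ComonObj.counit_comul]
    _ = _ := by monoidal

omit [MonObj A] in
theorem whisker_comul_counit :
    (Δ[A] ▷ X ≫ (α_ A A X).hom) ≫ A ◁ (ε[A] ▷ X ≫ (λ_ X).hom) = 𝟙 (A ⊗ X) := by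
  calc _ = (Δ[A] ≫ A ◁ ε[A]) ▷ X ⊗≫ 𝟙 _ := by monoidal
    _ = (ρ_ A).inv ▷ X ⊗≫ 𝟙 _ := by rw [ComonObj.comul_counit]
    _ = _ := by monoidal

theorem whisker_frob_left [FrobeniusObj A] :
    A ◁ (Δ[A] ▷ X ≫ (α_ A A X).hom) ≫ (α_ A A (A ⊗ X)).inv ≫ μ[A] ▷ (A ⊗ X) =
      ((α_ A A X).inv ≫ μ[A] ▷ X) ≫ Δ[A] ▷ X ≫ (α_ A A X).hom := by
  calc _ = 𝟙 _ ⊗≫ ((A ◁ Δ[A]) ≫ (α_ A A A).inv ≫ (μ[A] ▷ A)) ▷ X ⊗≫ 𝟙 _ := by monoidal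
    _ = 𝟙 _ ⊗≫ (μ[A] ≫ Δ[A]) ▷ X ⊗≫ 𝟙 _ := by rw [FrobeniusObj.comul_right_mul]
    _ = _ := by monoidal

theorem whisker_frob_right [FrobeniusObj A] :
    (Δ[A] ▷ (A ⊗ X) ≫ (α_ A A (A ⊗ X)).hom) ≫ A ◁ ((α_ A A X).inv ≫ μ[A] ▷ X) =
      ((α_ A A X).inv ≫ μ[A] ▷ X) ≫ Δ[A] ▷ X ≫ (α_ A A X).hom := by
  calc _ = 𝟙 _ ⊗≫ ((Δ[A] ▷ A) ≫ (α_ A A A).hom ≫ (A ◁ μ[A])) ▷ X ⊗≫ 𝟙 _ := by monoidal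
    _ = 𝟙 _ ⊗≫ (μ[A] ≫ Δ[A]) ▷ X ⊗≫ 𝟙 _ := by rw [FrobeniusObj.comul_left_mul]
    _ = _ := by monoidal
end

/-- The morphisms between tensor powers of `A`. -/
def PowHom (m n : ℕ) : Type v := tensorPow A m ⟶ tensorPow A n

variable [MonObj A] [ComonObj A]

/-- Structure maps act on the leftmost factors and the shift is left whiskering, so naturality is
the interchange law. -/
instance [FrobeniusObj A] : Tower (PowHom A) where
  idn n := 𝟙 (tensorPow A n)
  comp {m n k} (f : tensorPow A m ⟶ tensorPow A n) (g : tensorPow A n ⟶ tensorPow A k) := f ≫ g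
  sh {m n} (f : tensorPow A m ⟶ tensorPow A n) := A ◁ f
  unitAt n := (λ_ (tensorPow A n)).inv ≫ η[A] ▷ tensorPow A n
  mulAt n := (α_ A A (tensorPow A n)).inv ≫ μ[A] ▷ tensorPow A n
  counitAt n := ε[A] ▷ tensorPow A n ≫ (λ_ (tensorPow A n)).hom
  comulAt n := Δ[A] ▷ tensorPow A n ≫ (α_ A A (tensorPow A n)).hom
  id_comp f := Category.id_comp _
  comp_id f := Category.comp_id _
  assoc f g h := Category.assoc _ _ _
  sh_id n := whiskerLeft_id _ _
  sh_comp f g := whiskerLeft_comp _ _ _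
  unitAt_natural {m n} f := by
    change tensorPow A m ⟶ tensorPow A n at f
    change f ≫ _ ≫ _ = (_ ≫ _) ≫ A ◁ f
    rw [Category.assoc, ← whisker_exchange, leftUnitor_inv_naturality_assoc]
  mulAt_natural {m n} f := by
    change tensorPow A m ⟶ tensorPow A n at f
    change A ◁ A ◁ f ≫ _ ≫ _ = (_ ≫ _) ≫ A ◁ f
    rw [Category.assoc, ← whisker_exchange, associator_inv_naturality_right_assoc]
  counitAt_natural {m n} f := by
    change tensorPow A m ⟶ tensorPow A n at f
    change A ◁ f ≫ _ ≫ _ = (_ ≫ _) ≫ f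
    rw [Category.assoc, ← leftUnitor_naturality, whisker_exchange_assoc]
  comulAt_natural {m n} f := by
    change tensorPow A m ⟶ tensorPow A n at f
    change A ◁ f ≫ _ ≫ _ = (_ ≫ _) ≫ A ◁ A ◁ f
    rw [Category.assoc, ← associator_naturality_right, whisker_exchange_assoc]
  mulAt_assoc n := whisker_mul_assoc A (tensorPow A n)
  unitAt_mulAt n := whisker_one_mul A (tensorPow A n)
  mulAt_unitAt n := whisker_mul_one A (tensorPow A n)
  comulAt_assoc n := whisker_comul_assoc A (tensorPow A n)
  counitAt_comulAt n := whisker_counit_comul A (tensorPow A n)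
  comulAt_counitAt n := whisker_comul_counit A (tensorPow A n)
  frob_left n := whisker_frob_left A (tensorPow A n)
  frob_right n := whisker_frob_right A (tensorPow A n)

section

omit [ComonObj A] in
theorem mul_tensorHom {X Y : C} (f : X ⟶ Y) :
    A ◁ A ◁ f ≫ (α_ A A Y).inv ≫ μ[A] ▷ Y = (α_ A A X).inv ≫ (μ[A] ⊗ₘ f) := by
  simp [tensorHom_def']

omit [MonObj A] in
theorem comul_tensorHom {X Y : C} (f : X ⟶ Y) :
    A ◁ f ≫ Δ[A] ▷ Y ≫ (α_ A A Y).hom = (Δ[A] ⊗ₘ f) ≫ (α_ A A Y).hom := by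
  simp [tensorHom_def']

theorem cup_tensorHom {X Y : C} (f : X ⟶ Y) :
    A ◁ A ◁ f ≫ ((α_ A A Y).inv ≫ μ[A] ▷ Y) ≫ ε[A] ▷ Y ≫ (λ_ Y).hom =
      (α_ A A X).inv ≫ (cup A ⊗ₘ f) ≫ (λ_ Y).hom := by
  simp [tensorHom_def', cup]

theorem cap_tensorHom {X Y : C} (f : X ⟶ Y) :
    f ≫ ((λ_ Y).inv ≫ η[A] ▷ Y) ≫ Δ[A] ▷ Y ≫ (α_ A A Y).hom =
      (λ_ X).inv ≫ (cap A ⊗ₘ f) ≫ (α_ A A Y).hom := by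
  simp [tensorHom_def', cap]

omit [ComonObj A] in
theorem unit_tensorHom {X Y : C} (f : X ⟶ Y) :
    f ≫ (λ_ Y).inv ≫ η[A] ▷ Y = (λ_ X).inv ≫ (η[A] ⊗ₘ f) := by
  simp [tensorHom_def']

omit [MonObj A] in
theorem counit_tensorHom {X Y : C} (f : X ⟶ Y) :
    A ◁ f ≫ ε[A] ▷ Y ≫ (λ_ Y).hom = (ε[A] ⊗ₘ f) ≫ (λ_ Y).hom := by
  simp [tensorHom_def']

omit [ComonObj A] in
theorem whisker_mul_rightUnitor {X : C} (f : X ⟶ A ⊗ 𝟙_ C) :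
    (A ◁ f ≫ (α_ A A (𝟙_ C)).inv ≫ μ[A] ▷ 𝟙_ C) ≫ (ρ_ A).hom =
      A ◁ (f ≫ (ρ_ A).hom) ≫ μ[A] := by
  simp

omit [MonObj A] in
theorem whisker_comul_rightUnitor {X : C} (f : A ⊗ 𝟙_ C ⟶ X) :
    (ρ_ A).inv ≫ (Δ[A] ▷ 𝟙_ C ≫ (α_ A A (𝟙_ C)).hom) ≫ A ◁ f =
      Δ[A] ≫ A ◁ ((ρ_ A).inv ≫ f) := by
  simp

omit [MonObj A] [ComonObj A] in
theorem whisker_rightUnitor {X Y : C} (f : X ⟶ A ⊗ 𝟙_ C) (g : A ⊗ 𝟙_ C ⟶ Y) (h : A ⟶ A) :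
    f ≫ h ▷ 𝟙_ C ≫ g = (f ≫ (ρ_ A).hom) ≫ h ≫ (ρ_ A).inv ≫ g := by
  simp

end

variable [FrobeniusObj A]

/-- By the interchange law, performing the nodes of a row one at a time, from the right, gives their
tensor product. -/
theorem Level.evalIn_powHom {m n : ℕ} (L : Level m n) :
    @Eq (tensorPow A m ⟶ tensorPow A n) (L.evalIn (PowHom A)) (L.eval A) := by
  induction L with
  | nil => rfl
  | strand x L ih => exact congrArg (A ◁ ·) ih
  | mul x L ih => exact Eq.trans (by rw [evalIn, ih]; rfl) (mul_tensorHom A (L.eval A))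
  | comul x L ih => exact Eq.trans (by rw [evalIn, ih]; rfl) (comul_tensorHom A (L.eval A))
  | cup x L ih => exact Eq.trans (by rw [evalIn, ih]; rfl) (cup_tensorHom A (L.eval A))
  | cap x L ih => exact Eq.trans (by rw [evalIn, ih]; rfl) (cap_tensorHom A (L.eval A))
  | unit x L ih => exact Eq.trans (by rw [evalIn, ih]; rfl) (unit_tensorHom A (L.eval A))
  | counit x L ih => exact Eq.trans (by rw [evalIn, ih]; rfl) (counit_tensorHom A (L.eval A))

theorem Drawing.evalIn_powHom {m n : ℕ} (D : Drawing m n) :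
    @Eq (tensorPow A m ⟶ tensorPow A n) (D.evalIn (PowHom A)) (D.eval A) := by
  induction D with
  | last _ => rfl
  | cons _ L D ih => exact congrArg₂ (· ≫ ·) (L.evalIn_powHom A) ih

/-- The tower ends in `A ⊗ 𝟙_ C` instead of `A`, hence the unitor. -/
theorem mergeAll_powHom (m : ℕ) :
    @Eq (tensorPow A m ⟶ A) ((show tensorPow A m ⟶ A ⊗ 𝟙_ C from mergeAll (PowHom A) m) ≫
      (ρ_ A).hom) (merge A m) := by
  match m with
  | 0 =>
    change ((λ_ (𝟙_ C)).inv ≫ η[A] ▷ 𝟙_ C) ≫ (ρ_ A).hom = η[A]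
    simp [unitors_inv_equal]
  | 1 => exact Category.id_comp _
  | m + 2 =>
    change (A ◁ (show tensorPow A (m + 1) ⟶ A ⊗ 𝟙_ C from mergeAll (PowHom A) (m + 1)) ≫
      (α_ _ _ _).inv ≫ μ[A] ▷ 𝟙_ C) ≫ (ρ_ A).hom = A ◁ merge A (m + 1) ≫ μ[A]
    rw [← mergeAll_powHom (m + 1)]
    exact whisker_mul_rightUnitor A _

theorem splitAll_powHom (n : ℕ) :
    @Eq (A ⟶ tensorPow A n) ((ρ_ A).inv ≫
      (show A ⊗ 𝟙_ C ⟶ tensorPow A n from splitAll (PowHom A) n)) (split A n) := by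
  match n with
  | 0 =>
    change (ρ_ A).inv ≫ ε[A] ▷ 𝟙_ C ≫ (λ_ (𝟙_ C)).hom = ε[A]
    simp [unitors_equal]
  | 1 => exact Category.comp_id _
  | n + 2 =>
    change (ρ_ A).inv ≫ (Δ[A] ▷ 𝟙_ C ≫ (α_ _ _ _).hom) ≫
      A ◁ (show A ⊗ 𝟙_ C ⟶ tensorPow A (n + 1) from splitAll (PowHom A) (n + 1)) =
      Δ[A] ≫ A ◁ split A (n + 1)
    rw [← splitAll_powHom (n + 1)]
    exact whisker_comul_rightUnitor A _

theorem beadsAt_powHom (j : ℕ) :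
    @Eq (A ⊗ 𝟙_ C ⟶ A ⊗ 𝟙_ C) (beadsAt (H := PowHom A) j 0) (beads A j ▷ 𝟙_ C) := by
  induction j with
  | zero => exact (id_whiskerRight _ _).symm
  | succ j ih =>
    change ((Δ[A] ▷ 𝟙_ C ≫ (α_ _ _ _).hom) ≫ (α_ _ _ _).inv ≫ μ[A] ▷ 𝟙_ C) ≫
      (show A ⊗ 𝟙_ C ⟶ A ⊗ 𝟙_ C from beadsAt (H := PowHom A) j 0) = _
    rw [ih, beads]
    simp

theorem std_powHom (m n j : ℕ) :
    @Eq (tensorPow A m ⟶ tensorPow A n) (std (PowHom A) m n j) (standard A m n j) := by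
  rw [standard, ← mergeAll_powHom, ← splitAll_powHom]
  change (show tensorPow A m ⟶ A ⊗ 𝟙_ C from mergeAll (PowHom A) m) ≫
    (show A ⊗ 𝟙_ C ⟶ A ⊗ 𝟙_ C from beadsAt (H := PowHom A) j 0) ≫
    (show A ⊗ 𝟙_ C ⟶ tensorPow A n from splitAll (PowHom A) n) = _
  rw [beadsAt_powHom]
  exact whisker_rightUnitor A _ _ _

end Category

/-! ### Products and maps of towers. -/

section Product

variable (H : ℕ → ℕ → Type w) (K : ℕ → ℕ → Type w') [Tower H] [Tower K]

/-- Pairs of morphisms of two towers. -/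
def ProdHom (m n : ℕ) : Type (max w w') := H m n × K m n

/-- An identity in the product holds in both factors with the same number of beads; this ties the
evaluation in `A` to the counting models. -/
instance : Tower (ProdHom H K) where
  idn n := (idn n, idn n)
  comp f g := (f.1 ⊙ g.1, f.2 ⊙ g.2)
  sh f := (sh f.1, sh f.2)
  unitAt n := (unitAt n, unitAt n)
  mulAt n := (mulAt n, mulAt n)
  counitAt n := (counitAt n, counitAt n)
  comulAt n := (comulAt n, comulAt n)
  id_comp f := Prod.ext (id_comp f.1) (id_comp f.2)
  comp_id f := Prod.ext (comp_id f.1) (comp_id f.2)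
  assoc f g h := Prod.ext (Tower.assoc f.1 g.1 h.1) (Tower.assoc f.2 g.2 h.2)
  sh_id n := Prod.ext (sh_id n) (sh_id n)
  sh_comp f g := Prod.ext (sh_comp f.1 g.1) (sh_comp f.2 g.2)
  unitAt_natural f := Prod.ext (unitAt_natural f.1) (unitAt_natural f.2)
  mulAt_natural f := Prod.ext (mulAt_natural f.1) (mulAt_natural f.2)
  counitAt_natural f := Prod.ext (counitAt_natural f.1) (counitAt_natural f.2)
  comulAt_natural f := Prod.ext (comulAt_natural f.1) (comulAt_natural f.2)
  mulAt_assoc n := Prod.ext (mulAt_assoc n) (mulAt_assoc n)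
  unitAt_mulAt n := Prod.ext (unitAt_mulAt n) (unitAt_mulAt n)
  mulAt_unitAt n := Prod.ext (mulAt_unitAt n) (mulAt_unitAt n)
  comulAt_assoc n := Prod.ext (comulAt_assoc n) (comulAt_assoc n)
  counitAt_comulAt n := Prod.ext (counitAt_comulAt n) (counitAt_comulAt n)
  comulAt_counitAt n := Prod.ext (comulAt_counitAt n) (comulAt_counitAt n)
  frob_left n := Prod.ext (frob_left n) (frob_left n)
  frob_right n := Prod.ext (frob_right n) (frob_right n)

variable {H K}

/-- A map of towers. -/
structure TowerHom (H : ℕ → ℕ → Type w) (K : ℕ → ℕ → Type w') [Tower H] [Tower K] where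
  map {m n : ℕ} : H m n → K m n
  map_idn (n : ℕ) : map (idn n) = idn n
  map_comp {m n k : ℕ} (f : H m n) (g : H n k) : map (f ⊙ g) = map f ⊙ map g
  map_sh {m n : ℕ} (f : H m n) : map (sh f) = sh (map f)
  map_unitAt (n : ℕ) : map (unitAt n) = unitAt n
  map_mulAt (n : ℕ) : map (mulAt n) = mulAt n
  map_counitAt (n : ℕ) : map (counitAt n) = counitAt n
  map_comulAt (n : ℕ) : map (comulAt n) = comulAt n

/-- The first projection. -/
def TowerHom.fst : TowerHom (ProdHom H K) H where
  map f := f.1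
  map_idn _ := rfl
  map_comp _ _ := rfl
  map_sh _ := rfl
  map_unitAt _ := rfl
  map_mulAt _ := rfl
  map_counitAt _ := rfl
  map_comulAt _ := rfl

/-- The second projection. -/
def TowerHom.snd : TowerHom (ProdHom H K) K where
  map f := f.2
  map_idn _ := rfl
  map_comp _ _ := rfl
  map_sh _ := rfl
  map_unitAt _ := rfl
  map_mulAt _ := rfl
  map_counitAt _ := rfl
  map_comulAt _ := rfl

namespace TowerHom

attribute [simp] map_idn map_comp map_sh map_unitAt map_mulAt map_counitAt map_comulAt

variable (φ : TowerHom H K) {m n : ℕ}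

theorem map_beadsAt (j n : ℕ) : φ.map (beadsAt j n) = beadsAt j n := by
  induction j with
  | zero => simp [beadsAt]
  | succ j ih => simp [beadsAt, beadAt, ih]

theorem map_mergeAll (m : ℕ) : φ.map (mergeAll H m) = mergeAll K m := by
  match m with
  | 0 => simp [mergeAll]
  | 1 => simp [mergeAll]
  | m + 2 => simp [mergeAll, map_mergeAll (m + 1)]

theorem map_splitAll (n : ℕ) : φ.map (splitAll H n) = splitAll K n := by
  match n with
  | 0 => simp [splitAll]
  | 1 => simp [splitAll]
  | n + 2 => simp [splitAll, map_splitAll (n + 1)]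

theorem map_std (m n j : ℕ) : φ.map (std H m n j) = std K m n j := by
  simp [std, map_mergeAll, map_splitAll, map_beadsAt]

theorem map_levelEvalIn (L : Level m n) : φ.map (L.evalIn H) = L.evalIn K := by
  induction L with
  | nil => exact φ.map_idn 0
  | _ _ _ ih => simp [Level.evalIn, ih]

theorem map_evalIn (D : Drawing m n) : φ.map (D.evalIn H) = D.evalIn K := by
  induction D with
  | last _ => exact φ.map_idn _
  | cons _ L D ih => simp [Drawing.evalIn, ih, map_levelEvalIn]

end TowerHom

end Product

end PlanarSpider

/-! ### The counting towers: colours of strands and colours of regions. -/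

namespace PlanarSpider

universe w w'

open Tower

/-- A row of `n` colours. -/
def Row : ℕ → Type
  | 0 => Unit
  | n + 1 => Bool × Row n

namespace Row

instance instFintype : ∀ n, Fintype (Row n)
  | 0 => inferInstanceAs (Fintype Unit)
  | n + 1 => letI := instFintype n; inferInstanceAs (Fintype (Bool × Row n))

/-- The row with a single colour. -/
def const : (n : ℕ) → Bool → Row n
  | 0, _ => ()
  | n + 1, c => (c, const n c)

theorem sum_zero (f : Row 0 → ℕ) : ∑ x, f x = f () :=
  Fintype.sum_unique (fun x : Unit => f x)

theorem sum_succ {n : ℕ} (f : Row (n + 1) → ℕ) :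
    ∑ x, f x = ∑ t : Row n, f (true, t) + ∑ t : Row n, f (false, t) :=
  (Fintype.sum_prod_type (f : Bool × Row n → ℕ)).trans (Fintype.sum_bool _)

end Row

/-- Additive maps between functions on rows of colours of strands. -/
def StrandHom (m n : ℕ) : Type := (Row m → ℕ) →+ (Row n → ℕ)

/-- Additive maps between functions on rows of colours of regions, for a given colour of the
leftmost region. -/
def RegionHom (m n : ℕ) : Type := Bool → (Row m → ℕ) →+ (Row n → ℕ)

/-- The underlying additive map. -/
def StrandHom.app {m n : ℕ} (f : StrandHom m n) : (Row m → ℕ) →+ (Row n → ℕ) := f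

/-- The underlying additive maps. -/
def RegionHom.app {m n : ℕ} (f : RegionHom m n) : Bool → (Row m → ℕ) →+ (Row n → ℕ) := f

/-- This is the Frobenius algebra of functions on a two-point set: colours agree at a node, the unit
leaves the new colour free and the counit sums over a colour. -/
instance : Tower StrandHom where
  idn n := AddMonoidHom.id (Row n → ℕ)
  comp {m n k} f g :=
    AddMonoidHom.comp g.app f.app
  sh {m n} f :=
    { toFun v r := f.app (fun t => v (r.1, t)) r.2
      map_zero' := funext fun r =>
        congrFun (map_zero f.app) r.2
      map_add' v w := funext fun r =>
        congrFun (map_add f.app (fun t => v (r.1, t))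
          fun t => w (r.1, t)) r.2 }
  unitAt n :=
    { toFun v r := v r.2
      map_zero' := rfl
      map_add' _ _ := rfl }
  mulAt n :=
    { toFun v r := v (r.1, r.1, r.2)
      map_zero' := rfl
      map_add' _ _ := rfl }
  counitAt n :=
    { toFun v r := v (true, r) + v (false, r)
      map_zero' := rfl
      map_add' v w := funext fun r => add_add_add_comm (v (true, r)) _ _ _ }
  comulAt n :=
    { toFun v r := if r.1 = r.2.1 then v (r.1, r.2.2) else 0
      map_zero' := funext fun r => ite_self _
      map_add' v w := funext fun r => by
        change (if r.1 = r.2.1 then v (r.1, r.2.2) + w (r.1, r.2.2) else 0) =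
          (if r.1 = r.2.1 then v (r.1, r.2.2) else 0) + if r.1 = r.2.1 then w (r.1, r.2.2) else 0
        split <;> rfl }
  id_comp f := rfl
  comp_id f := rfl
  assoc f g h := rfl
  sh_id n := rfl
  sh_comp f g := rfl
  unitAt_natural f := rfl
  mulAt_natural f := rfl
  counitAt_natural {m n} f := AddMonoidHom.ext fun v => funext fun r =>
    (congrFun (map_add f.app (fun t => v (true, t))
      fun t => v (false, t)) r).symm
  comulAt_natural {m n} f := AddMonoidHom.ext fun v => funext fun r => by
    change (if r.1 = r.2.1 then f.app (fun t => v (r.1, t)) r.2.2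
      else 0) = f.app
        (fun t => if r.1 = r.2.1 then v (r.1, t) else 0) r.2.2
    split
    · rfl
    · exact (congrFun (map_zero f.app) _).symm
  mulAt_assoc n := rfl
  unitAt_mulAt n := rfl
  mulAt_unitAt n := rfl
  comulAt_assoc n := AddMonoidHom.ext fun v => funext fun (a, b, c, r) => by
    change (if b = c then (if a = b then v (a, r) else 0) else 0) =
      if a = b then (if a = c then v (a, r) else 0) else 0
    split_ifs <;> simp_all
  counitAt_comulAt n := AddMonoidHom.ext fun v => funext fun (a, r) => by
    change (if true = a then v (true, r) else 0) + (if false = a then v (false, r) else 0) =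
      v (a, r)
    cases a <;> simp
  comulAt_counitAt n := AddMonoidHom.ext fun v => funext fun (a, r) => by
    change (if a = true then v (a, r) else 0) + (if a = false then v (a, r) else 0) = v (a, r)
    cases a <;> simp
  frob_left n := rfl
  frob_right n := AddMonoidHom.ext fun v => funext fun (a, b, r) => by
    change (if a = b then v (a, b, r) else 0) = if a = b then v (a, a, r) else 0
    split_ifs <;> simp_all

/-- Each strand records the colour on its right. A product sums over the region that it closes off,
a coproduct opens a region of free colour, and at a unit or counit the colours on both sides agree.
The shift hands the colour right of the new strand to the rest as its leftmost colour. -/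
instance : Tower RegionHom where
  idn n _ := AddMonoidHom.id (Row n → ℕ)
  comp {m n k} f g c :=
    AddMonoidHom.comp (g.app c) (f.app c)
  sh {m n} f _ :=
    { toFun v r := (f.app r.1) (fun t => v (r.1, t)) r.2
      map_zero' := funext fun r =>
        congrFun (map_zero (f.app r.1)) r.2
      map_add' v w := funext fun r =>
        congrFun (map_add (f.app r.1) (fun t => v (r.1, t))
          fun t => w (r.1, t)) r.2 }
  unitAt n c :=
    { toFun v r := if r.1 = c then v r.2 else 0
      map_zero' := funext fun r => ite_self _
      map_add' v w := funext fun r => by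
        change (if r.1 = c then v r.2 + w r.2 else 0) =
          (if r.1 = c then v r.2 else 0) + if r.1 = c then w r.2 else 0
        split <;> rfl }
  mulAt n _ :=
    { toFun v r := v (true, r) + v (false, r)
      map_zero' := rfl
      map_add' v w := funext fun r => add_add_add_comm (v (true, r)) _ _ _ }
  counitAt n c :=
    { toFun v r := v (c, r)
      map_zero' := rfl
      map_add' v w := rfl }
  comulAt n _ :=
    { toFun v r := v r.2
      map_zero' := rfl
      map_add' v w := rfl }
  id_comp f := rfl
  comp_id f := rfl
  assoc f g h := rfl
  sh_id n := rfl
  sh_comp f g := rfl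
  unitAt_natural {m n} f := funext fun c => AddMonoidHom.ext fun v => funext fun (a, r) => by
    change (if a = c then (f.app c) v r else 0) =
      (f.app a) (fun t => if a = c then v t else 0) r
    split_ifs with h
    · rw [h]
    · exact (congrFun (map_zero (f.app a)) _).symm
  mulAt_natural {m n} f := funext fun c => AddMonoidHom.ext fun v => funext fun (a, r) =>
    (congrFun (map_add (f.app a) (fun t => v (true, a, t))
      fun t => v (false, a, t)) r).symm
  counitAt_natural f := rfl
  comulAt_natural f := rfl
  mulAt_assoc n := funext fun c => AddMonoidHom.ext fun v => funext fun (a, r) =>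
    add_add_add_comm (v (true, true, a, r)) _ _ _
  unitAt_mulAt n := funext fun c => AddMonoidHom.ext fun v => funext fun (a, r) => by
    change (if true = c then v (a, r) else 0) + (if false = c then v (a, r) else 0) = v (a, r)
    cases c <;> simp
  mulAt_unitAt n := funext fun c => AddMonoidHom.ext fun v => funext fun (a, r) => by
    change (if a = true then v (true, r) else 0) + (if a = false then v (false, r) else 0) =
      v (a, r)
    cases a <;> simp
  comulAt_assoc n := rfl
  counitAt_comulAt n := rfl
  comulAt_counitAt n := rfl
  frob_left n := rfl
  frob_right n := rfl

/-- The sum of all values of a function on rows. -/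
def total {n : ℕ} (v : Row n → ℕ) : ℕ := ∑ y, v y

/-- The number of colourings of strands, `2 ^ c` for `c` connected components. -/
def StrandHom.count {m n : ℕ} (f : StrandHom m n) : ℕ := total (f.app 1)

section Count

variable {H : ℕ → ℕ → Type w} [Tower H] (φ : TowerHom H StrandHom) {m n k c : ℕ}

theorem StrandHom.comp_app (f : StrandHom m n) (g : StrandHom n k) (v : Row m → ℕ) :
    (f ⊙ g).app v = g.app (f.app v) := rfl

/-- Copying a colour and comparing the copies changes nothing: this algebra is special. -/
theorem StrandHom.beadsAt_eq (j n : ℕ) : (beadsAt j n : StrandHom _ _) = idn (n + 1) := by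
  induction j with
  | zero => rfl
  | succ j ih =>
    rw [beadsAt, ih, Tower.comp_id]
    refine AddMonoidHom.ext fun v => funext fun r => ?_
    exact if_pos rfl

theorem total_sh (f : StrandHom m n) (v : Row (m + 1) → ℕ) :
    total ((sh f : StrandHom _ _).app v) =
      total (f.app fun t => v (true, t)) + total (f.app fun t => v (false, t)) :=
  Row.sum_succ _

theorem total_succ (v : Row (n + 1) → ℕ) :
    total v = total (fun t => v (true, t)) + total fun t => v (false, t) :=
  Row.sum_succ _

theorem total_unitAt (v : Row n → ℕ) : total ((unitAt n : StrandHom _ _).app v) = 2 * total v := by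
  rw [total_succ, two_mul]
  rfl

/-- Splitting only repeats a colour, so colourings of the two ends correspond. -/
theorem total_split {f : H (n + 1) k} (hf : IsSplit H n k f) (v : Row (n + 1) → ℕ) :
    total ((φ.map f).app v) = total v := by
  induction hf generalizing v with
  | idn => rw [φ.map_idn]; rfl
  | @comulAt k f hf ih =>
    rw [φ.map_comp, φ.map_sh, φ.map_comulAt, StrandHom.comp_app, total_sh, total_succ v]
    refine (congrArg₂ (· + ·) ((ih _).trans (total_succ _))
      ((ih _).trans (total_succ _))).trans ?_
    change (∑ t, (if true = true then v (true, t) else 0) +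
      ∑ t, (if true = false then v (true, t) else 0)) +
      (∑ t, (if false = true then v (false, t) else 0) +
      ∑ t, (if false = false then v (false, t) else 0)) = ∑ t, v (true, t) + ∑ t, v (false, t)
    simp

theorem app_sh_mulAt {f : H k (n + 1)} (hf : (φ.map f).app 1 = 1) :
    (φ.map (sh f ⊙ mulAt n)).app 1 = 1 := by
  rw [φ.map_comp, φ.map_sh, φ.map_mulAt, StrandHom.comp_app]
  have : (sh (φ.map f) : StrandHom _ _).app 1 = 1 := funext fun r => congrFun hf r.2
  rw [this]
  rfl

/-- Each colouring below a merge comes from exactly one above it. -/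
theorem app_merge {f : Dual H (n + 1) k} (hf : IsSplit (Dual H) n k f) :
    (φ.map (m := k) (n := n + 1) f).app 1 = 1 := by
  induction hf with
  | idn => exact congrArg (fun g => StrandHom.app g 1) (φ.map_idn (n + 1))
  | comulAt _ ih => exact app_sh_mulAt φ ih

/-- A new component brings one free colour. Sinks and closed components give the factor `2`
likewise. -/
theorem total_source {i : H n k} (hi : Source H n k i) (v : Row n → ℕ) :
    total ((φ.map i).app v) = 2 * total v := by
  induction hi with
  | here j n hf =>
    rw [φ.map_comp, φ.map_comp, φ.map_beadsAt, StrandHom.beadsAt_eq, Tower.id_comp,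
      StrandHom.comp_app, total_split φ hf, φ.map_unitAt, total_unitAt]
  | sh _ ih => rw [φ.map_sh, total_sh, ih, ih, ← mul_add, ← total_succ]

theorem app_beadsAt_counitAt {f : H k (n + 1)} (hf : (φ.map f).app 1 = 1) (j : ℕ) :
    (φ.map ((f ⊙ beadsAt j n) ⊙ counitAt n)).app 1 = 2 := by
  rw [φ.map_comp, φ.map_comp, φ.map_beadsAt, StrandHom.beadsAt_eq, Tower.comp_id,
    StrandHom.comp_app, hf, φ.map_counitAt]
  rfl

theorem app_sh_sink {f : H m n} (hf : (φ.map f).app 1 = 2) : (φ.map (sh f)).app 1 = 2 := by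
  rw [φ.map_sh]
  exact funext fun r => congrFun hf r.2

theorem app_sink {i : Dual H n m} (hi : Source (Dual H) n m i) :
    (φ.map (m := m) (n := n) i).app 1 = 2 := by
  induction hi with
  | @here j n k f hf =>
    change (φ.map (comp (H := H) (comp (H := H) (m := k) f (beadsAt (H := Dual H) j n))
      (counitAt n))).app 1 = 2
    rw [beadsAt_dual]
    exact app_beadsAt_counitAt φ (app_merge φ hf) j
  | sh _ ih => exact app_sh_sink φ ih

theorem app_closed {i : H n n} (hi : Closed H n i) (v : Row n → ℕ) :
    (φ.map i).app v = 2 • v := by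
  induction hi with
  | here j n =>
    rw [φ.map_comp, φ.map_comp, φ.map_beadsAt, StrandHom.beadsAt_eq, Tower.id_comp,
      StrandHom.comp_app, φ.map_unitAt, φ.map_counitAt, two_nsmul]
    rfl
  | sh _ ih =>
    rw [φ.map_sh]
    exact funext fun r => congrFun (ih fun t => v (r.1, t)) r.2

/-- Both constant colourings occur, and they are counted separately if there are no strands. -/
def IsGood {n : ℕ} (v : Row n → ℕ) : Prop :=
  (∀ c, 1 ≤ v (Row.const n c)) ∧ (n = 0 → ∀ r, 2 ≤ v r)

theorem IsGood.two_le_total {v : Row n → ℕ} (hv : IsGood v) : 2 ≤ total v := by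
  cases n with
  | zero => rw [total, Row.sum_zero]; exact hv.2 rfl _
  | succ n =>
    rw [total_succ]
    have h1 : v (true, Row.const n true) ≤ total fun t => v (true, t) :=
      Finset.single_le_sum (f := fun t => v (true, t)) (fun _ _ => Nat.zero_le _)
        (Finset.mem_univ _)
    have h2 : v (false, Row.const n false) ≤ total fun t => v (false, t) :=
      Finset.single_le_sum (f := fun t => v (false, t)) (fun _ _ => Nat.zero_le _)
        (Finset.mem_univ _)
    have := hv.1 true
    have := hv.1 false
    simp only [Row.const] at *
    omega

theorem one_le_step {U C : Prop} {s : H m n} (hs : Step H U C m n s) {c : Bool} {v : Row m → ℕ}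
    (hv : 1 ≤ v (Row.const m c)) : 1 ≤ (φ.map s).app v (Row.const n c) := by
  induction hs with
  | mulAt n => rw [φ.map_mulAt]; exact hv
  | comulAt n =>
    rw [φ.map_comulAt]
    exact hv.trans_eq (if_pos rfl).symm
  | unitAt n _ => rw [φ.map_unitAt]; exact hv
  | counitAt n _ =>
    rw [φ.map_counitAt]
    change 1 ≤ v (true, _) + v (false, _)
    cases c
    · exact le_add_left hv
    · exact le_add_right hv
  | sh _ ih =>
    rw [φ.map_sh]
    exact ih (v := fun t => v (c, t)) hv

theorem IsGood.step {U C : Prop} {s : H m n} (hs : Step H U C m n s) {v : Row m → ℕ}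
    (hv : IsGood v) : IsGood ((φ.map s).app v) := by
  refine ⟨fun c => one_le_step φ hs (hv.1 c), ?_⟩
  rintro rfl r
  cases hs with
  | counitAt _ _ =>
    rw [φ.map_counitAt]
    exact add_le_add (hv.1 true) (hv.1 false)

theorem IsGood.rword {U C : Prop} {f : H m n} (hf : RWord H U C m n f) {v : Row m → ℕ}
    (hv : IsGood v) : IsGood ((φ.map f).app v) := by
  induction hf with
  | nil => rw [φ.map_idn]; exact hv
  | snoc _ hs ih => rw [φ.map_comp]; exact ih.step φ hs

/-- A nonempty word starting from no strands starts with a unit, where both constant colourings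
appear. No later step loses them, and a counit ending the last strand adds them up to at least `2`.
Hence count `1` forces the empty word. -/
theorem RWord.trivial_or_good {U C : Prop} {f : H m n} (hf : RWord H U C m n f) :
    IsTrivial H m n f ∨ IsGood ((φ.map f).app 1) := by
  induction hf with
  | nil =>
    cases m with
    | zero => exact .inl .intro
    | succ m =>
      right
      rw [φ.map_idn]
      exact ⟨fun _ => le_rfl, fun h => absurd h (Nat.succ_ne_zero m)⟩
  | snoc _ hs ih =>
    right
    rcases ih with ih | ih
    · cases ih
      cases hs with
      | unitAt _ _ =>
        rw [φ.map_comp, φ.map_idn, Tower.id_comp, φ.map_unitAt]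
        exact ⟨fun _ => le_rfl, fun h => absurd h one_ne_zero⟩
    · rw [φ.map_comp]; exact ih.step φ hs

theorem RWord.trivial_of_count {f : H m n} {g : H n k} (hf : RWord H True True m n f)
    (hg : RWord H True True n k g) (h : (φ.map (f ⊙ g)).count = 1) :
    IsTrivial H m n f ∧ IsTrivial H n k g := by
  rcases hf.trivial_or_good φ with hf' | hf'
  · refine ⟨hf', ?_⟩
    cases hf'
    rcases hg.trivial_or_good φ with hg' | hg'
    · exact hg'
    · rw [Tower.id_comp] at h
      exact absurd (hg'.two_le_total.trans_eq h) (by norm_num)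
  · rw [φ.map_comp] at h
    exact absurd ((hf'.rword φ hg).two_le_total.trans_eq h) (by norm_num)

theorem Blocks.count_eq {f : H m n} (hf : Blocks H c m n f) : (φ.map f).count = 2 ^ c := by
  induction hf with
  | nil =>
    rw [φ.map_idn]
    exact Row.sum_zero _
  | cons hg j hB hf ih =>
    rw [φ.map_comp, φ.map_comp, φ.map_comp, StrandHom.count, StrandHom.comp_app, app_merge φ hg,
      φ.map_beadsAt, StrandHom.beadsAt_eq, Tower.id_comp, StrandHom.comp_app, total_split φ hf,
      φ.map_sh, total_sh, pow_succ, mul_two]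
    exact congrArg₂ (· + ·) ih ih

/-- A connected word is standard. -/
theorem RWord.eq_std_of_count {U C : Prop} {f : H m n} (hf : RWord H U C m n f)
    (h : (φ.map f).count = 2) : ∃ j, f = std H m n j := by
  refine RWord.eq_std (fun f => (φ.map f).count) ?_ ?_ ?_ (RWord.trivial_of_count φ)
    (Blocks.count_eq φ) hf h
  · intro m n k f i hi
    rw [φ.map_comp, StrandHom.count, StrandHom.comp_app, total_source φ hi]
    rfl
  · intro m n k f i hi
    rw [φ.map_comp, StrandHom.count, StrandHom.comp_app, app_sink φ hi]
    have : (2 : Row n → ℕ) = 2 • (1 : Row n → ℕ) := by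
      rw [two_nsmul, one_add_one_eq_two]
    rw [this, map_nsmul]
    exact (Finset.mul_sum ..).symm
  · intro m n k f i g hi
    rw [φ.map_comp, φ.map_comp, φ.map_comp, StrandHom.count, StrandHom.comp_app,
      StrandHom.comp_app, app_closed φ hi, map_nsmul]
    exact (Finset.mul_sum ..).symm

end Count

/-! ### The value of a standard morphism in the region tower. -/

section Region

variable {m n : ℕ}

theorem RegionHom.comp_app {k : ℕ} (f : RegionHom m n) (g : RegionHom n k) (c : Bool)
    (v : Row m → ℕ) : (f ⊙ g).app c v = g.app c (f.app c v) := rfl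

open Classical in
theorem RegionHom.units_app (n : ℕ) (c : Bool) :
    (units RegionHom n).app c 1 = fun r => if r = Row.const n c then 1 else 0 := by
  induction n with
  | zero => exact funext fun r => (if_pos rfl).symm
  | succ n ih =>
    rw [units, comp_app, ih]
    refine funext fun (a, r) => ?_
    change (if a = c then (if r = Row.const n c then 1 else 0) else 0) = _
    by_cases ha : a = c
    · by_cases hr : r = Row.const n c
      · rw [if_pos ha, if_pos hr, ha, hr]
        exact (if_pos rfl).symm
      · rw [if_pos ha, if_neg hr]
        exact (if_neg fun h => hr (Prod.ext_iff.1 h).2).symm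
    · rw [if_neg ha]
      exact (if_neg fun h => ha (Prod.ext_iff.1 h).1).symm

theorem RegionHom.counits_app (n : ℕ) (c : Bool) (v : Row n → ℕ) :
    (counits RegionHom n).app c v = fun _ => v (Row.const n c) := by
  induction n with
  | zero => rfl
  | succ n ih =>
    rw [counits, comp_app, ih]
    rfl

theorem RegionHom.beadsAt_app (j n : ℕ) (c : Bool) (v : Row (n + 1) → ℕ) :
    (beadsAt j n : RegionHom _ _).app c v = 2 ^ j • v := by
  induction j generalizing v with
  | zero => exact (one_nsmul v).symm
  | succ j ih =>
    rw [beadsAt, comp_app, ih, pow_succ, mul_nsmul']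
    congr 1
    exact (two_nsmul v).symm

open Classical in
-- Units above and counits below force the colour `c` in all outer gaps, so this entry belongs to
-- the closed diagram of `units_std_counits`; each bead encloses one region of free colour.
theorem RegionHom.std_app (m n j : ℕ) (c : Bool) :
    (std RegionHom m n j).app c (fun r => if r = Row.const m c then 1 else 0) (Row.const n c) =
      2 ^ j := by
  have := congrArg (fun f : RegionHom 0 0 => f.app c 1 ())
    (units_std_counits (H := RegionHom) m n j)
  simp only [comp_app, units_app, counits_app, beadsAt_app] at this
  rw [this]
  change 2 ^ j • (if c = c then 1 else 0) = 2 ^ j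
  simp

end Region

end PlanarSpider

/-! ### Matrix entries of a drawing as numbers of colourings. -/

namespace PlanarSpider

universe w w'

open Tower

/-- Colours of the strands above and below a row of nodes which agree at each node. -/
def Level.StrandCompat : {m n : ℕ} → Level m n → Row m → Row n → Prop
  | _, _, nil, _, _ => True
  | _, _, strand _ L, x, y => y.1 = x.1 ∧ L.StrandCompat x.2 y.2
  | _, _, mul _ L, x, y => (y.1 = x.1 ∧ x.2.1 = x.1) ∧ L.StrandCompat x.2.2 y.2
  | _, _, comul _ L, x, y => (y.1 = x.1 ∧ y.2.1 = x.1) ∧ L.StrandCompat x.2 y.2.2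
  | _, _, cup _ L, x, y => x.2.1 = x.1 ∧ L.StrandCompat x.2.2 y
  | _, _, cap _ L, x, y => y.2.1 = y.1 ∧ L.StrandCompat x y.2.2
  | _, _, unit _ L, x, y => L.StrandCompat x y.2
  | _, _, counit _ L, x, y => L.StrandCompat x.2 y

/-- Colours of the regions to the right of the strands above and below a row of nodes, with
leftmost colour `c`, which agree between the nodes. -/
def Level.RegionCompat (c : Bool) : {m n : ℕ} → Level m n → Row m → Row n → Prop
  | _, _, nil, _, _ => True
  | _, _, strand _ L, x, y => y.1 = x.1 ∧ L.RegionCompat x.1 x.2 y.2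
  | _, _, mul _ L, x, y => y.1 = x.2.1 ∧ L.RegionCompat x.2.1 x.2.2 y.2
  | _, _, comul _ L, x, y => y.2.1 = x.1 ∧ L.RegionCompat x.1 x.2 y.2.2
  | _, _, cup _ L, x, y => x.2.1 = c ∧ L.RegionCompat c x.2.2 y
  | _, _, cap _ L, x, y => y.2.1 = c ∧ L.RegionCompat c x y.2.2
  | _, _, unit _ L, x, y => y.1 = c ∧ L.RegionCompat c x y.2
  | _, _, counit _ L, x, y => x.1 = c ∧ L.RegionCompat c x.2 y

section LevelCount

open Classical

theorem Level.evalIn_strandHom {m n : ℕ} (L : Level m n) (v : Row m → ℕ) (y : Row n) :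
    (L.evalIn StrandHom).app v y = ∑ x, if L.StrandCompat x y then v x else 0 := by
  induction L with
  | nil => rw [Row.sum_zero]; exact (if_pos trivial).symm
  | strand _ L ih =>
    obtain ⟨a, y⟩ := y
    change (L.evalIn StrandHom).app (fun t => v (a, t)) y = _
    rw [ih, Row.sum_succ]
    cases a <;> simp [StrandCompat]
  | mul _ L ih =>
    obtain ⟨a, y⟩ := y
    change (L.evalIn StrandHom).app (fun t => v (a, a, t)) y = _
    rw [ih]
    simp only [Row.sum_succ]
    cases a <;> simp [StrandCompat]
  | comul _ L ih =>
    obtain ⟨a, b, y⟩ := y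
    change (if a = b then (L.evalIn StrandHom).app (fun t => v (a, t)) y else 0) = _
    rw [ih]
    simp only [Row.sum_succ]
    cases a <;> cases b <;> simp [StrandCompat]
  | cup _ L ih =>
    change (L.evalIn StrandHom).app (fun t => v (true, true, t)) y +
      (L.evalIn StrandHom).app (fun t => v (false, false, t)) y = _
    rw [ih, ih]
    simp only [Row.sum_succ]
    simp [StrandCompat]
  | cap _ L ih =>
    obtain ⟨a, b, y⟩ := y
    change (if a = b then (L.evalIn StrandHom).app v y else 0) = _
    rw [ih]
    cases a <;> cases b <;> simp [StrandCompat]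
  | unit _ L ih => exact ih v y.2
  | counit _ L ih =>
    change (L.evalIn StrandHom).app (fun t => v (true, t)) y +
      (L.evalIn StrandHom).app (fun t => v (false, t)) y = _
    rw [ih, ih, Row.sum_succ]
    rfl

theorem Level.evalIn_regionHom {m n : ℕ} (L : Level m n) (c : Bool) (v : Row m → ℕ) (y : Row n) :
    (L.evalIn RegionHom).app c v y = ∑ x, if L.RegionCompat c x y then v x else 0 := by
  induction L generalizing c with
  | nil => rw [Row.sum_zero]; exact (if_pos trivial).symm
  | strand _ L ih =>
    obtain ⟨a, y⟩ := y
    change (L.evalIn RegionHom).app a (fun t => v (a, t)) y = _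
    rw [ih, Row.sum_succ]
    cases a <;> simp [RegionCompat]
  | mul _ L ih =>
    obtain ⟨a, y⟩ := y
    change (L.evalIn RegionHom).app a (fun t => v (true, a, t)) y +
      (L.evalIn RegionHom).app a (fun t => v (false, a, t)) y = _
    rw [ih, ih]
    simp only [Row.sum_succ]
    cases a <;> simp [RegionCompat]
  | comul _ L ih =>
    obtain ⟨a, b, y⟩ := y
    change (L.evalIn RegionHom).app b (fun t => v (b, t)) y = _
    rw [ih]
    simp only [Row.sum_succ]
    cases b <;> simp [RegionCompat]
  | cup _ L ih =>
    change (L.evalIn RegionHom).app c (fun t => v (true, c, t)) y +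
      (L.evalIn RegionHom).app c (fun t => v (false, c, t)) y = _
    rw [ih, ih]
    simp only [Row.sum_succ]
    cases c <;> simp [RegionCompat]
  | cap _ L ih =>
    obtain ⟨a, b, y⟩ := y
    change (if b = c then (L.evalIn RegionHom).app c v y else 0) = _
    rw [ih]
    cases b <;> cases c <;> simp [RegionCompat]
  | unit _ L ih =>
    obtain ⟨a, y⟩ := y
    change (if a = c then (L.evalIn RegionHom).app c v y else 0) = _
    rw [ih]
    cases a <;> cases c <;> simp [RegionCompat]
  | counit _ L ih =>
    change (L.evalIn RegionHom).app c (fun t => v (c, t)) y = _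
    rw [ih, Row.sum_succ]
    cases c <;> simp [RegionCompat]

end LevelCount

/-- Rows of colours for all bands of a drawing. -/
def Coloring : {m n : ℕ} → Drawing m n → Type
  | _, _, .last (n := n) _ => Row n
  | _, _, .cons (m := m) _ _ D => Row m × Coloring D

namespace Coloring

instance instFintype : ∀ {m n : ℕ} (D : Drawing m n), Fintype (Coloring D)
  | _, _, .last (n := n) _ => Row.instFintype n
  | _, _, .cons (m := m) _ _ D =>
    letI := instFintype D
    inferInstanceAs (Fintype (Row m × Coloring D))

/-- The colours in the first band. -/
def first : {m n : ℕ} → {D : Drawing m n} → Coloring D → Row m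
  | _, _, .last _, z => z
  | _, _, .cons _ _ _, z => z.1

/-- The colours in the last band. -/
def final : {m n : ℕ} → {D : Drawing m n} → Coloring D → Row n
  | _, _, .last _, z => z
  | _, _, .cons _ _ _, z => final z.2

/-- The colours are compatible at each row of nodes. -/
def Compat (R : ∀ {m n : ℕ}, Level m n → Row m → Row n → Prop) :
    {m n : ℕ} → {D : Drawing m n} → Coloring D → Prop
  | _, _, .last _, _ => True
  | _, _, .cons _ L _, z => R L z.1 z.2.first ∧ z.2.Compat R

end Coloring

/-- A drawing as a composite of additive maps, one for each row of nodes. -/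
def Drawing.run (E : ∀ {m n : ℕ}, Level m n → (Row m → ℕ) →+ (Row n → ℕ)) :
    {m n : ℕ} → Drawing m n → (Row m → ℕ) → (Row n → ℕ)
  | _, _, last _, v => v
  | _, _, cons _ L D, v => D.run E (E L v)

section DrawingCount

open Classical

/-- An entry of a product of 0-1 matrices counts paths, and a path chooses one row of colours in
each band. -/
theorem Drawing.run_eq {E : ∀ {m n : ℕ}, Level m n → (Row m → ℕ) →+ (Row n → ℕ)}
    {R : ∀ {m n : ℕ}, Level m n → Row m → Row n → Prop}
    (hE : ∀ {m n : ℕ} (L : Level m n) (v : Row m → ℕ) (y : Row n),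
      E L v y = ∑ x, if R L x y then v x else 0)
    {m n : ℕ} (D : Drawing m n) (v : Row m → ℕ) (y : Row n) :
    D.run E v y = ∑ z : Coloring D, if z.Compat R ∧ z.final = y then v z.first else 0 := by
  induction D with
  | @last n B =>
    refine Eq.trans (b := ∑ z : Row n, if True ∧ z = y then v z else 0) ?_
      (Finset.sum_congr rfl fun z _ => if_congr Iff.rfl rfl rfl)
    change v y = _
    simp
  | @cons m k n B L D ih =>
    refine (ih (E L v) y).trans ?_
    refine Eq.trans (b := ∑ z : Row m × Coloring D,
      if (R L z.1 z.2.first ∧ z.2.Compat R) ∧ z.2.final = y then v z.1 else 0) ?_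
      (Finset.sum_congr rfl fun z _ => if_congr Iff.rfl rfl rfl)
    rw [Fintype.sum_prod_type_right]
    refine Finset.sum_congr rfl fun z _ => ?_
    rw [hE]
    by_cases h : z.Compat R ∧ z.final = y
    · rw [if_pos h]
      exact Finset.sum_congr rfl fun x _ => by simp [h]
    · rw [if_neg h]
      exact (Finset.sum_eq_zero fun x _ => if_neg fun h' => h ⟨h'.1.2, h'.2⟩).symm

theorem Drawing.count_strandHom {m n : ℕ} (D : Drawing m n) :
    (D.evalIn StrandHom).count = Fintype.card {z : Coloring D // z.Compat Level.StrandCompat} := by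
  have h : ∀ {m n : ℕ} (D : Drawing m n) (v : Row m → ℕ), (D.evalIn StrandHom).app v =
      D.run (fun L => (L.evalIn StrandHom).app) v := by
    intro m n D
    induction D with
    | last B => exact fun v => rfl
    | cons B L D ih => exact fun v => ih _
  rw [StrandHom.count, h, total, Fintype.card_subtype, Finset.card_filter]
  simp_rw [D.run_eq Level.evalIn_strandHom, Pi.one_apply]
  rw [Finset.sum_comm]
  refine Finset.sum_congr rfl fun z _ => ?_
  by_cases hz : z.Compat Level.StrandCompat <;> simp [hz]

/-- Both end rows are constant `c` because the gaps at the top and bottom lines open to the outside.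
-/
theorem Drawing.card_regionHom {m n : ℕ} (D : Drawing m n) (c : Bool) :
    (D.evalIn RegionHom).app c (fun r => if r = Row.const m c then 1 else 0) (Row.const n c) =
      Fintype.card {z : Coloring D // z.Compat (Level.RegionCompat c) ∧
        z.first = Row.const m c ∧ z.final = Row.const n c} := by
  have h : ∀ {m n : ℕ} (D : Drawing m n) (v : Row m → ℕ), (D.evalIn RegionHom).app c v =
      D.run (fun L => (L.evalIn RegionHom).app c) v := by
    intro m n D
    induction D with
    | last B => exact fun v => rfl
    | cons B L D ih => exact fun v => ih _
  rw [h, Fintype.card_subtype, Finset.card_filter,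
    D.run_eq (R := Level.RegionCompat c) fun L => L.evalIn_regionHom c]
  refine Finset.sum_congr rfl fun z _ => ?_
  rw [← ite_and]
  exact if_congr (by tauto) rfl rfl

end DrawingCount

end PlanarSpider

/-! ### Connected drawings have only constant strand colourings. -/

namespace PlanarSpider

/-- The entries of a row of colours. -/
def Row.get : {n : ℕ} → Row n → Fin n → Bool
  | 0, _ => Fin.elim0
  | _ + 1, x => Fin.cons x.1 (Row.get x.2)

theorem Row.get_const (n : ℕ) (c : Bool) (i : Fin n) : (Row.const n c).get i = c := by
  induction n with
  | zero => exact i.elim0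
  | succ n ih => exact Fin.cases rfl ih i

theorem Row.ext_get {n : ℕ} {x y : Row n} (h : ∀ i, x.get i = y.get i) : x = y := by
  induction n with
  | zero => rfl
  | succ n ih => exact Prod.ext (h 0) (ih fun i => h i.succ)

namespace Level

theorem inPos_mem {m n : ℕ} (L : Level m n) (i : Fin m) : L.inPos i ∈ L.nodes := by
  induction L with
  | nil => exact i.elim0
  | strand x L ih | comul x L ih | counit x L ih =>
    exact Fin.cases (by simp [inPos, nodes]) (fun i => by simp [inPos, nodes, ih]) i
  | mul x L ih | cup x L ih =>
    exact Fin.cases (by simp [inPos, nodes])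
      (Fin.cases (by simp [inPos, nodes]) fun i => by simp [inPos, nodes, ih]) i
  | cap x L ih | unit x L ih => simp [inPos, nodes, ih]

theorem outPos_mem {m n : ℕ} (L : Level m n) (i : Fin n) : L.outPos i ∈ L.nodes := by
  induction L with
  | nil => exact i.elim0
  | strand x L ih | mul x L ih | unit x L ih =>
    exact Fin.cases (by simp [outPos, nodes]) (fun i => by simp [outPos, nodes, ih]) i
  | comul x L ih | cap x L ih =>
    exact Fin.cases (by simp [outPos, nodes])
      (Fin.cases (by simp [outPos, nodes]) fun i => by simp [outPos, nodes, ih]) i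
  | cup x L ih | counit x L ih => simp [outPos, nodes, ih]

theorem strandCompat_const {m n : ℕ} (L : Level m n) (c : Bool) :
    L.StrandCompat (Row.const m c) (Row.const n c) := by
  induction L <;> simp_all [StrandCompat, Row.const]

/-- Compatible colours of strands are colours of the nodes. -/
theorem StrandCompat.exists_nodes {m n : ℕ} {L : Level m n} (hL : L.nodes.Pairwise (· < ·))
    {x : Row m} {y : Row n} (h : L.StrandCompat x y) :
    ∃ ψ : ℝ → Bool, (∀ i, x.get i = ψ (L.inPos i)) ∧ ∀ i, y.get i = ψ (L.outPos i) := by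
  -- The new node lies strictly left of the others, so giving it a colour affects none of them.
  have key : ∀ {m n : ℕ} (L : Level m n) (t : ℝ) (a : Bool) (ψ : ℝ → Bool) (x : Row m) (y : Row n),
      (∀ s ∈ L.nodes, t < s) → (∀ i, x.get i = ψ (L.inPos i)) → (∀ i, y.get i = ψ (L.outPos i)) →
      (∀ i, x.get i = Function.update ψ t a (L.inPos i)) ∧
        ∀ i, y.get i = Function.update ψ t a (L.outPos i) := by
    intro m n L t a ψ x y ht hx hy
    refine ⟨fun i => ?_, fun i => ?_⟩
    · rw [hx, Function.update_of_ne (ht _ (L.inPos_mem i)).ne']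
    · rw [hy, Function.update_of_ne (ht _ (L.outPos_mem i)).ne']
  induction L with
  | nil => exact ⟨fun _ => true, fun i => i.elim0, fun i => i.elim0⟩
  | strand t L ih =>
    obtain ⟨ht, hL⟩ := List.pairwise_cons.1 hL
    obtain ⟨ψ, hx, hy⟩ := ih hL h.2
    obtain ⟨hx, hy⟩ := key L t x.1 ψ _ _ ht hx hy
    exact ⟨Function.update ψ t x.1, Fin.cases (by simp [Row.get, inPos]) hx,
      Fin.cases (by simp [Row.get, outPos, h.1]) hy⟩
  | mul t L ih =>
    obtain ⟨ht, hL⟩ := List.pairwise_cons.1 hL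
    obtain ⟨ψ, hx, hy⟩ := ih hL h.2
    obtain ⟨hx, hy⟩ := key L t x.1 ψ _ _ ht hx hy
    exact ⟨Function.update ψ t x.1, Fin.cases (by simp [Row.get, inPos])
      (Fin.cases (by simp [Row.get, inPos, h.1.2]) hx),
      Fin.cases (by simp [Row.get, outPos, h.1.1]) hy⟩
  | comul t L ih =>
    obtain ⟨ht, hL⟩ := List.pairwise_cons.1 hL
    obtain ⟨ψ, hx, hy⟩ := ih hL h.2
    obtain ⟨hx, hy⟩ := key L t x.1 ψ _ _ ht hx hy
    exact ⟨Function.update ψ t x.1, Fin.cases (by simp [Row.get, inPos]) hx,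
      Fin.cases (by simp [Row.get, outPos, h.1.1])
      (Fin.cases (by simp [Row.get, outPos, h.1.2]) hy)⟩
  | cup t L ih =>
    obtain ⟨ht, hL⟩ := List.pairwise_cons.1 hL
    obtain ⟨ψ, hx, hy⟩ := ih hL h.2
    obtain ⟨hx, hy⟩ := key L t x.1 ψ _ _ ht hx hy
    exact ⟨Function.update ψ t x.1, Fin.cases (by simp [Row.get, inPos])
      (Fin.cases (by simp [Row.get, inPos, h.1]) hx), hy⟩
  | cap t L ih =>
    obtain ⟨ht, hL⟩ := List.pairwise_cons.1 hL
    obtain ⟨ψ, hx, hy⟩ := ih hL h.2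
    obtain ⟨hx, hy⟩ := key L t y.1 ψ _ _ ht hx hy
    exact ⟨Function.update ψ t y.1, hx, Fin.cases (by simp [Row.get, outPos])
      (Fin.cases (by simp [Row.get, outPos, h.1]) hy)⟩
  | unit t L ih =>
    obtain ⟨ht, hL⟩ := List.pairwise_cons.1 hL
    obtain ⟨ψ, hx, hy⟩ := ih hL h
    obtain ⟨hx, hy⟩ := key L t y.1 ψ _ _ ht hx hy
    exact ⟨Function.update ψ t y.1, hx, Fin.cases (by simp [Row.get, outPos]) hy⟩
  | counit t L ih =>
    obtain ⟨ht, hL⟩ := List.pairwise_cons.1 hL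
    obtain ⟨ψ, hx, hy⟩ := ih hL h
    obtain ⟨hx, hy⟩ := key L t x.1 ψ _ _ ht hx hy
    exact ⟨Function.update ψ t x.1, Fin.cases (by simp [Row.get, inPos]) hx, hy⟩

end Level

/-- The part of a band covered by strands of colour `c`. -/
def Band.colored {n : ℕ} (B : Band n) (x : Row n) (c : Bool) : Set (ℝ × ℝ) :=
  {p | p.2 ∈ Set.Icc B.bot B.top ∧ ∃ i, p.1 = B.strand i p.2 ∧ x.get i = c}

theorem Band.isCompact_colored {n : ℕ} (B : Band n) (x : Row n) (c : Bool) :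
    IsCompact (B.colored x c) := by
  have : B.colored x c = ⋃ i ∈ {i | x.get i = c},
      (fun y => (B.strand i y, y)) '' Set.Icc B.bot B.top := by
    ext p
    simp only [colored, Set.mem_ofPred_eq, Set.mem_iUnion, Set.mem_image, exists_prop]
    constructor
    · rintro ⟨hp, i, hi, hc⟩
      exact ⟨i, hc, p.2, hp, Prod.ext hi.symm rfl⟩
    · rintro ⟨i, hc, y, hy, rfl⟩
      exact ⟨hy, i, rfl, hc⟩
  rw [this]
  exact (Set.toFinite _).isCompact_biUnion fun i _ =>
    isCompact_Icc.image_of_continuousOn ((B.continuousOn i).prodMk continuousOn_id)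

namespace Drawing

variable {m n : ℕ} {D : Drawing m n}

theorem Fits.le_top (hD : D.Fits) {p : ℝ × ℝ} (hp : p ∈ D.carrier) : p.2 ≤ D.firstBand.top := by
  induction D with
  | last B => exact hp.1.2
  | cons B L D ih =>
    rcases hp with hp | hp
    · exact hp.1.2
    · exact ((ih hD.2.2.2.2 hp).trans_eq hD.2.2.1).trans B.bot_lt_top.le

end Drawing

namespace Coloring

/-- The part of a drawing covered by strands of colour `c`. -/
def piece (c : Bool) : {m n : ℕ} → {D : Drawing m n} → Coloring D → Set (ℝ × ℝ)
  | _, _, .last B, z => B.colored z c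
  | _, _, .cons B _ _, z => B.colored z.1 c ∪ z.2.piece c

variable {m n : ℕ} {D : Drawing m n}

theorem isCompact_piece (z : Coloring D) (c : Bool) : IsCompact (z.piece c) := by
  induction D with
  | last B => exact B.isCompact_colored z c
  | cons B L D ih => exact (B.isCompact_colored z.1 c).union (ih z.2)

theorem piece_union (z : Coloring D) : z.piece true ∪ z.piece false = D.carrier := by
  have h : ∀ {n : ℕ} (B : Band n) (x : Row n),
      B.colored x true ∪ B.colored x false = B.carrier := by
    intro n B x
    ext p
    constructor
    · rintro (⟨hp, i, hi, -⟩ | ⟨hp, i, hi, -⟩) <;> exact ⟨hp, i, hi⟩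
    · rintro ⟨hp, i, hi⟩
      cases hc : x.get i
      · exact .inr ⟨hp, i, hi, hc⟩
      · exact .inl ⟨hp, i, hi, hc⟩
  induction D with
  | last B => exact h B z
  | cons B L D ih =>
    change (B.colored z.1 true ∪ z.2.piece true) ∪ (B.colored z.1 false ∪ z.2.piece false) =
      B.carrier ∪ D.carrier
    rw [Set.union_union_union_comm, h, ih]

theorem piece_subset (z : Coloring D) (c : Bool) : z.piece c ⊆ D.carrier := by
  rw [← piece_union z]
  cases c
  · exact Set.subset_union_right
  · exact Set.subset_union_left

theorem exists_first_of_mem_piece (hD : D.Fits) {z : Coloring D} {c : Bool} {p : ℝ × ℝ}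
    (hp : p ∈ z.piece c) (h : p.2 = D.firstBand.top) :
    ∃ i, p.1 = D.firstBand.strand i p.2 ∧ z.first.get i = c := by
  cases D with
  | last B => exact hp.2
  | cons B L D =>
    rcases hp with hp | hp
    · exact hp.2
    · have := (hD.2.2.2.2.le_top (piece_subset _ _ hp)).trans_eq hD.2.2.1
      exact absurd B.bot_lt_top (this.trans' h.ge).not_gt

/-- Strands meet only at nodes, where compatible colours agree. `htop` carries this information from
the row above into the induction; at the top line it holds because legs are distinct. -/
theorem Compat.eq_of_mem_piece (hD : D.Fits) {z : Coloring D}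
    (hz : z.Compat Level.StrandCompat)
    (htop : ∀ i j, D.firstBand.strand i D.firstBand.top = D.firstBand.strand j D.firstBand.top →
      z.first.get i = z.first.get j)
    {a b : Bool} {p : ℝ × ℝ} (ha : p ∈ z.piece a) (hb : p ∈ z.piece b) : a = b := by
  have band : ∀ {n : ℕ} (B : Band n) (x : Row n),
      (∀ i j, B.strand i B.top = B.strand j B.top → x.get i = x.get j) →
      (∀ i j, B.strand i B.bot = B.strand j B.bot → x.get i = x.get j) →
      p ∈ B.colored x a → p ∈ B.colored x b → a = b := by
    rintro n B x ht hbot ⟨hp, i, hi, rfl⟩ ⟨-, j, hj, rfl⟩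
    rcases hp.2.eq_or_lt with h | h
    · exact ht i j (by rw [← h, ← hi, hj])
    rcases hp.1.eq_or_lt with h' | h'
    · exact hbot i j (by rw [h', ← hi, hj])
    · rw [(B.strictMono p.2 ⟨h', h⟩).injective (hi.symm.trans hj)]
  induction D with
  | last B => exact band B z htop (fun i j h => by rw [StrictMono.injective hD h]) ha hb
  | cons B L D ih =>
    obtain ⟨hL, hin, hbot, hout, hD⟩ := hD
    obtain ⟨ψ, hx, hy⟩ := hz.1.exists_nodes hL
    -- A point in both the band and the rest lies on the line of nodes between them; its colour is
    -- that of its node.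
    have cross : ∀ {a b : Bool}, p ∈ B.colored z.1 a → p ∈ z.2.piece b → a = b := by
      rintro a b ⟨hp, i, hi, rfl⟩ hb
      have h : p.2 = D.firstBand.top :=
        le_antisymm (hD.le_top (piece_subset _ _ hb)) (hbot.trans_le hp.1)
      obtain ⟨j, hj, rfl⟩ := exists_first_of_mem_piece hD hb h
      rw [hx, hy, ← hin, ← hout, ← h, ← hj, hi, h, hbot]
    rcases ha with ha | ha <;> rcases hb with hb | hb
    · exact band B z.1 htop (fun i j h => by rw [hx, hx, ← hin, ← hin, h]) ha hb
    · exact cross ha hb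
    · exact (cross hb ha).symm
    · exact ih hD hz.2 (fun i j h => by rw [hy, hy, ← hout, ← hout, h]) ha hb

/-- All strands have the same colour. -/
def const (c : Bool) : {m n : ℕ} → (D : Drawing m n) → Coloring D
  | _, _, .last (n := n) _ => Row.const n c
  | _, _, .cons (m := m) _ _ D => (Row.const m c, const c D)

theorem first_const (c : Bool) (D : Drawing m n) : (const c D).first = Row.const m c := by
  cases D <;> rfl

theorem compat_const (c : Bool) (D : Drawing m n) :
    (const c D).Compat Level.StrandCompat := by
  induction D with
  | last B => trivial
  | cons B L D ih =>
    refine ⟨?_, ih⟩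
    have := L.strandCompat_const c
    rwa [← first_const c D] at this

/-- A band contains its bottom line, so every strand contributes a point of its own colour. -/
theorem eq_const_of_piece_empty {z : Coloring D} {c : Bool} (h : z.piece (!c) = ∅) :
    z = const c D := by
  have band : ∀ {n : ℕ} (B : Band n) (x : Row n), B.colored x (!c) = ∅ → x = Row.const n c := by
    intro n B x h
    refine Row.ext_get fun i => ?_
    rw [Row.get_const]
    by_contra hi
    have : (B.strand i B.bot, B.bot) ∈ B.colored x (!c) :=
      ⟨⟨le_rfl, B.bot_lt_top.le⟩, i, rfl, Bool.eq_not.2 hi⟩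
    rw [h] at this
    exact this
  induction D with
  | last B => exact band B z h
  | cons B L D ih =>
    obtain ⟨h1, h2⟩ := Set.union_empty_iff.1 h
    exact Prod.ext (band B z.1 h1) (ih h2)

theorem piece_const_not (c : Bool) : (const c D).piece (!c) = ∅ := by
  have band : ∀ {n : ℕ} (B : Band n), B.colored (Row.const n c) (!c) = ∅ := by
    intro n B
    refine Set.eq_empty_of_forall_notMem ?_
    rintro p ⟨-, i, -, hi⟩
    rw [Row.get_const] at hi
    cases c <;> cases hi
  induction D with
  | last B => exact band B
  | cons B L D ih => exact Set.union_empty_iff.2 ⟨band B, ih⟩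

end Coloring

/-- The strands of a connected diagram are only coloured by constants. -/
theorem PlanarDiagram.count_eq_two {m n : ℕ} (Γ : PlanarDiagram m n)
    (h : _root_.IsConnected Γ.carrier) : (Γ.drawing.evalIn StrandHom).count = 2 := by
  classical
  change _root_.IsConnected Γ.drawing.carrier at h
  rw [Drawing.count_strandHom, Fintype.card_subtype]
  have hne : Coloring.const true Γ.drawing ≠ Coloring.const false Γ.drawing := by
    intro he
    obtain ⟨p, hp⟩ := h.nonempty
    rw [← Coloring.piece_union (Coloring.const true Γ.drawing)] at hp
    rcases hp with hp | hp
    · rw [he] at hp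
      exact (Coloring.piece_const_not false).subset hp
    · exact (Coloring.piece_const_not true).subset hp
  rw [← Finset.card_pair hne]
  congr 1
  ext z
  simp only [Finset.mem_filter, Finset.mem_univ, true_and, Finset.mem_insert,
    Finset.mem_singleton]
  constructor
  · intro hz
    by_contra! hcon
    -- For a non-constant colouring both colour pieces are closed and nonempty; connectedness makes
    -- them meet.
    have hpc := isPreconnected_closed_iff.1 h.isPreconnected _ _ (z.isCompact_piece true).isClosed
      (z.isCompact_piece false).isClosed (Coloring.piece_union z).ge
      (by
        rw [Set.inter_eq_self_of_subset_right (z.piece_subset true)]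
        exact Set.nonempty_iff_ne_empty.2 fun he => hcon.2 (Coloring.eq_const_of_piece_empty he))
      (by
        rw [Set.inter_eq_self_of_subset_right (z.piece_subset false)]
        exact Set.nonempty_iff_ne_empty.2 fun he => hcon.1 (Coloring.eq_const_of_piece_empty he))
    obtain ⟨p, -, h1, h2⟩ := hpc
    have := hz.eq_of_mem_piece Γ.fits
      (fun i j hij => by rw [Γ.top_strictMono.injective hij]) h1 h2
    cases this
  · rintro (rfl | rfl) <;> exact Coloring.compat_const _ _

end PlanarSpider

/-! ### Region colours along a horizontal line and across a row of nodes. -/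

namespace PlanarSpider

open Filter Topology

namespace Row

/-- The colour at `t` if the region to the right of `pos i` has the `i`-th colour of a row, and
the leftmost region has colour `c`. -/
noncomputable def colorAt (c : Bool) : {n : ℕ} → Row n → (Fin n → ℝ) → ℝ → Bool
  | 0, _, _, _ => c
  | _ + 1, x, pos, t =>
    open Classical in if pos 0 < t then colorAt x.1 x.2 (Fin.tail pos) t else c

/-- The `k`-th colour of a row, starting with the leftmost colour `c`. -/
def gapColor (c : Bool) : {n : ℕ} → Row n → ℕ → Bool
  | 0, _, _ => c
  | _ + 1, _, 0 => c
  | _ + 1, x, k + 1 => gapColor x.1 x.2 k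

/-- The rightmost colour. -/
def last (c : Bool) : {n : ℕ} → Row n → Bool
  | 0, _ => c
  | _ + 1, x => last x.1 x.2

variable {n : ℕ} {c : Bool} {x x' : Row n} {pos pos' : Fin n → ℝ} {t t' : ℝ}

theorem colorAt_congr (h : ∀ i, pos i < t ↔ pos' i < t') :
    colorAt c x pos t = colorAt c x pos' t' := by
  induction n generalizing c with
  | zero => rfl
  | succ n ih =>
    simp only [colorAt, h 0, ih (pos := Fin.tail pos) (pos' := Fin.tail pos') fun i => h i.succ]

theorem colorAt_of_le (h : ∀ i, t ≤ pos i) : colorAt c x pos t = c := by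
  cases n with
  | zero => rfl
  | succ n => exact if_neg (h 0).not_gt

theorem colorAt_of_lt (h : ∀ i, pos i < t) : colorAt c x pos t = last c x := by
  induction n generalizing c with
  | zero => rfl
  | succ n ih => exact (if_pos (h 0)).trans (ih fun i => h i.succ)

theorem colorAt_const : colorAt c (const n c) pos t = c := by
  induction n with
  | zero => rfl
  | succ n ih => simp only [colorAt, const, ih, ite_self]

theorem last_const : last c (const n c) = c := by
  induction n with
  | zero => rfl
  | succ n ih => exact ih

theorem colorAt_eq_gapColor {k : ℕ} (h : ∀ i, pos i < t ↔ i.val < k) :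
    colorAt c x pos t = gapColor c x k := by
  induction n generalizing c k with
  | zero => rfl
  | succ n ih =>
    cases k with
    | zero => exact if_neg fun h0 => absurd ((h 0).1 h0) (Nat.not_lt_zero _)
    | succ k =>
      exact (if_pos ((h 0).2 (Nat.succ_pos k))).trans
        (ih fun i => (h i.succ).trans Nat.succ_lt_succ_iff)

theorem ext_gapColor (h : ∀ k ≤ n, gapColor c x k = gapColor c x' k) : x = x' := by
  induction n generalizing c with
  | zero => rfl
  | succ n ih =>
    have h1 : x.1 = x'.1 := by
      have := h 1 (Nat.succ_le_succ (Nat.zero_le n))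
      cases n <;> exact this
    refine Prod.ext h1 (ih (c := x.1) fun k hk => ?_)
    have := h (k + 1) (Nat.succ_le_succ hk)
    simp only [gapColor] at this
    rw [this, h1]

theorem gapColor_const (k : ℕ) : gapColor c (const n c) k = c := by
  induction n generalizing k with
  | zero => rfl
  | succ n ih => cases k; exacts [rfl, ih _]

theorem exists_gapColor (n : ℕ) (a : ℕ → Bool) :
    ∃ x : Row n, ∀ k ≤ n, gapColor (a 0) x k = a k := by
  induction n generalizing a with
  | zero =>
    refine ⟨(), fun k hk => ?_⟩
    rw [Nat.le_zero.1 hk]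
    rfl
  | succ n ih =>
    obtain ⟨x, hx⟩ := ih fun k => a (k + 1)
    refine ⟨(a 1, x), fun k hk => ?_⟩
    cases k with
    | zero => rfl
    | succ k => exact hx k (Nat.le_of_succ_le_succ hk)

end Row

/-- No bound on `k` is needed: for `k ≥ n` the point lies right of all positions. -/
theorem exists_mem_gap {n : ℕ} {pos : Fin n → ℝ} (hpos : StrictMono pos) (k : ℕ) :
    ∃ t, ∀ i : Fin n, (i.val < k → pos i < t) ∧ (k ≤ i.val → t < pos i) := by
  classical
  obtain ⟨t, h1, h2⟩ := Order.exists_between_finsets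
    ((Finset.univ.filter fun i : Fin n => i.val < k).image pos)
    ((Finset.univ.filter fun i : Fin n => k ≤ i.val).image pos) (by
      simp only [Finset.mem_image, Finset.mem_filter, Finset.mem_univ, true_and]
      rintro _ ⟨i, hi, rfl⟩ _ ⟨j, hj, rfl⟩
      exact hpos (Fin.lt_def.2 (hi.trans_le hj)))
  exact ⟨t, fun i => ⟨fun hi => h1 _ (Finset.mem_image_of_mem _ (by simpa)),
    fun hi => h2 _ (Finset.mem_image_of_mem _ (by simpa))⟩⟩

theorem exists_gap {n : ℕ} {pos : Fin n → ℝ} (hpos : StrictMono pos) {t : ℝ}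
    (ht : ∀ i, pos i ≠ t) :
    ∃ k ≤ n, ∀ i : Fin n, (i.val < k → pos i < t) ∧ (k ≤ i.val → t < pos i) := by
  induction n with
  | zero => exact ⟨0, le_rfl, fun i => i.elim0⟩
  | succ n ih =>
    rcases (ht 0).lt_or_gt with h | h
    · obtain ⟨k, hk, hi⟩ := ih (pos := Fin.tail pos)
        (fun i j hij => hpos (Fin.succ_lt_succ_iff.2 hij)) fun i => ht i.succ
      refine ⟨k + 1, Nat.succ_le_succ hk, Fin.cases ?_ fun i => ?_⟩
      · exact ⟨fun _ => h, fun h' => absurd h' (Nat.not_succ_le_zero k)⟩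
      · exact ⟨fun h' => (hi i).1 (Nat.lt_of_succ_lt_succ h'),
          fun h' => (hi i).2 (Nat.le_of_succ_le_succ h')⟩
    · exact ⟨0, Nat.zero_le _, fun i => ⟨fun h' => absurd h' (Nat.not_lt_zero _),
        fun _ => h.trans_le (hpos.monotone (Fin.zero_le i))⟩⟩

namespace Level

open Row

variable {m n : ℕ}

theorem colorAt_inPos_of_le {L : Level m n} {t : ℝ} (h : ∀ s ∈ L.nodes, t ≤ s) (c : Bool)
    (x : Row m) : colorAt c x L.inPos t = c :=
  colorAt_of_le fun i => h _ (L.inPos_mem i)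

theorem colorAt_outPos_of_le {L : Level m n} {t : ℝ} (h : ∀ s ∈ L.nodes, t ≤ s) (c : Bool)
    (y : Row n) : colorAt c y L.outPos t = c :=
  colorAt_of_le fun i => h _ (L.outPos_mem i)

theorem RegionCompat.last_eq {L : Level m n} {c : Bool} {x : Row m} {y : Row n}
    (h : L.RegionCompat c x y) : last c x = last c y := by
  induction L generalizing c with
  | nil => rfl
  | strand _ _ ih | mul _ _ ih | comul _ _ ih =>
    have := ih h.2
    simp only [last]
    rwa [h.1]
  | cup _ _ ih | cap _ _ ih | unit _ _ ih | counit _ _ ih =>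
    have := ih h.2
    simp only [last]
    rwa [h.1]

/-- Two legs at one node enclose no interval of the line, so the colour between them is not read
there. At the node itself both sides read the colour on its left, since `colorAt` compares strictly.
-/
theorem RegionCompat.colorAt_eq {L : Level m n} (hL : L.nodes.Pairwise (· < ·)) {c : Bool}
    {x : Row m} {y : Row n} (h : L.RegionCompat c x y) (t : ℝ) :
    colorAt c x L.inPos t = colorAt c y L.outPos t := by
  induction L generalizing c with
  | nil => rfl
  | strand s L ih =>
    obtain ⟨-, hL⟩ := List.pairwise_cons.1 hL
    have := ih hL h.2
    simp only [colorAt, inPos, outPos, Fin.cons_zero, Fin.tail_cons, this, h.1]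
  | mul s L ih =>
    obtain ⟨-, hL⟩ := List.pairwise_cons.1 hL
    have := ih hL h.2
    simp only [colorAt, inPos, outPos, Fin.cons_zero, Fin.tail_cons, this, h.1]
    split_ifs <;> rfl
  | comul s L ih =>
    obtain ⟨-, hL⟩ := List.pairwise_cons.1 hL
    have := ih hL h.2
    simp only [colorAt, inPos, outPos, Fin.cons_zero, Fin.tail_cons, this, h.1]
    split_ifs <;> rfl
  | cup s L ih =>
    obtain ⟨hs, hL⟩ := List.pairwise_cons.1 hL
    have := ih hL h.2
    simp only [colorAt, inPos, outPos, Fin.cons_zero, Fin.tail_cons, this, h.1]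
    split_ifs with hst
    · rfl
    · exact (colorAt_outPos_of_le (fun r hr => (not_lt.1 hst).trans (hs r hr).le) _ _).symm
  | cap s L ih =>
    obtain ⟨hs, hL⟩ := List.pairwise_cons.1 hL
    have := ih hL h.2
    simp only [colorAt, inPos, outPos, Fin.cons_zero, Fin.tail_cons, ← this, h.1]
    split_ifs with hst
    · rfl
    · exact colorAt_inPos_of_le (fun r hr => (not_lt.1 hst).trans (hs r hr).le) _ _
  | unit s L ih =>
    obtain ⟨hs, hL⟩ := List.pairwise_cons.1 hL
    have := ih hL h.2
    simp only [colorAt, inPos, outPos, Fin.cons_zero, Fin.tail_cons, ← this, h.1]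
    split_ifs with hst
    · rfl
    · exact colorAt_inPos_of_le (fun r hr => (not_lt.1 hst).trans (hs r hr).le) _ _
  | counit s L ih =>
    obtain ⟨hs, hL⟩ := List.pairwise_cons.1 hL
    have := ih hL h.2
    simp only [colorAt, inPos, outPos, Fin.cons_zero, Fin.tail_cons, this, h.1]
    split_ifs with hst
    · rfl
    · exact (colorAt_outPos_of_le (fun r hr => (not_lt.1 hst).trans (hs r hr).le) _ _).symm

/-- Points off the nodes suffice, because between consecutive nodes there is room to read the
colour. -/
theorem regionCompat_of_colorAt_eq {L : Level m n} (hL : L.nodes.Pairwise (· < ·)) {c : Bool}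
    {x : Row m} {y : Row n}
    (h : ∀ t ∉ L.nodes, colorAt c x L.inPos t = colorAt c y L.outPos t) :
    L.RegionCompat c x y := by
  have right : ∀ {m n : ℕ} {L : Level m n} {s : ℝ}, (∀ r ∈ L.nodes, s < r) →
      ∃ t, s < t ∧ ∀ r ∈ L.nodes, t < r := by
    intro m n L s hs
    obtain ⟨t, h1, h2⟩ := Order.exists_between_finsets {s} L.nodes.toFinset (by simpa using hs)
    exact ⟨t, h1 s (by simp), fun r hr => h2 r (by simpa using hr)⟩
  -- Reading just right of the node `s` gives the colours on its right above and below; left of all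
  -- remaining nodes both sides are then constant.
  have key : ∀ {m n : ℕ} {L : Level m n} {s : ℝ}, (∀ r ∈ L.nodes, s < r) →
      ∀ {a b : Bool} {x : Row m} {y : Row n},
      (∀ t ∉ L.nodes, s < t → colorAt a x L.inPos t = colorAt b y L.outPos t) →
      b = a ∧ ∀ t ∉ L.nodes, colorAt a x L.inPos t = colorAt a y L.outPos t := by
    intro m n L s hs a b x y h
    obtain ⟨t, hst, ht⟩ := right hs
    have hab : a = b := by
      have := h t (fun h => (ht t h).false) hst
      rwa [colorAt_inPos_of_le fun r hr => (ht r hr).le,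
        colorAt_outPos_of_le fun r hr => (ht r hr).le] at this
    subst hab
    refine ⟨rfl, fun t ht => ?_⟩
    rcases lt_or_ge s t with hst | hst
    · exact h t ht hst
    · rw [colorAt_inPos_of_le fun r hr => hst.trans (hs r hr).le,
        colorAt_outPos_of_le fun r hr => hst.trans (hs r hr).le]
  induction L generalizing c with
  | nil => trivial
  | strand s L ih | mul s L ih | comul s L ih =>
    obtain ⟨hs, hL⟩ := List.pairwise_cons.1 hL
    obtain ⟨h1, h2⟩ := key hs fun t ht hst => by
      have := h t (by simp [nodes, hst.ne', ht])
      simpa only [colorAt, inPos, outPos, Fin.cons_zero, Fin.tail_cons, if_pos hst] using this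
    exact ⟨h1, ih hL h2⟩
  | cup s L ih | counit s L ih =>
    obtain ⟨hs, hL⟩ := List.pairwise_cons.1 hL
    obtain ⟨h1, h2⟩ := key hs fun t ht hst => by
      have := h t (by simp [nodes, hst.ne', ht])
      simpa only [colorAt, inPos, outPos, Fin.cons_zero, Fin.tail_cons, if_pos hst] using this
    subst h1
    exact ⟨rfl, ih hL h2⟩
  | cap s L ih | unit s L ih =>
    obtain ⟨hs, hL⟩ := List.pairwise_cons.1 hL
    obtain ⟨h1, h2⟩ := key hs fun t ht hst => by
      have := h t (by simp [nodes, hst.ne', ht])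
      simpa only [colorAt, inPos, outPos, Fin.cons_zero, Fin.tail_cons, if_pos hst] using this
    exact ⟨h1, ih hL h2⟩

end Level

end PlanarSpider

/-! ### Region colourings as locally constant functions off the drawing. -/

namespace PlanarSpider

open Filter Topology Row

namespace Band

variable {n : ℕ} (B : Band n)

theorem eventually_lt_iff {p : ℝ × ℝ} (hp : p.2 ∈ Set.Icc B.bot B.top)
    (h : ∀ i, B.strand i p.2 ≠ p.1) :
    ∀ᶠ q in 𝓝 p, q.2 ∈ Set.Icc B.bot B.top →
      ∀ i, (B.strand i q.2 < q.1 ↔ B.strand i p.2 < p.1) ∧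
        (q.1 < B.strand i q.2 ↔ p.1 < B.strand i p.2) := by
  have key : ∀ᶠ q in 𝓝[{q : ℝ × ℝ | q.2 ∈ Set.Icc B.bot B.top}] p,
      ∀ i, (B.strand i q.2 < q.1 ↔ B.strand i p.2 < p.1) ∧
        (q.1 < B.strand i q.2 ↔ p.1 < B.strand i p.2) := by
    refine eventually_all.2 fun i => ?_
    have hc : ContinuousWithinAt (fun q : ℝ × ℝ => B.strand i q.2)
        {q : ℝ × ℝ | q.2 ∈ Set.Icc B.bot B.top} p :=
      (B.continuousOn i p.2 hp).comp continuous_snd.continuousWithinAt fun q hq => hq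
    have hf : ContinuousWithinAt (fun q : ℝ × ℝ => q.1)
        {q : ℝ × ℝ | q.2 ∈ Set.Icc B.bot B.top} p := continuous_fst.continuousWithinAt
    rcases (h i).lt_or_gt with h | h
    · filter_upwards [hc.eventually_lt hf h] with q hq
      exact ⟨iff_of_true hq h, iff_of_false hq.not_gt h.not_gt⟩
    · filter_upwards [hf.eventually_lt hc h] with q hq
      exact ⟨iff_of_false hq.not_gt h.not_gt, iff_of_true hq h⟩
  exact eventually_nhdsWithin_iff.1 key

/-- The colour of the region at a point at the height of the band. -/
noncomputable def colorAt (c : Bool) (x : Row n) (p : ℝ × ℝ) : Bool :=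
  Row.colorAt c x (fun i => B.strand i p.2) p.1

theorem eventually_colorAt_eq (c : Bool) (x : Row n) {p : ℝ × ℝ}
    (hp : p.2 ∈ Set.Icc B.bot B.top) (h : ∀ i, B.strand i p.2 ≠ p.1) :
    ∀ᶠ q in 𝓝 p, q.2 ∈ Set.Icc B.bot B.top → B.colorAt c x q = B.colorAt c x p := by
  filter_upwards [B.eventually_lt_iff hp h] with q hq hq2
  exact colorAt_congr fun i => (hq hq2 i).1

/-- Colours of the regions determined in the interior of a band are determined on its boundary. -/
theorem colorAt_eq_of_interior {c : Bool} {x : Row n} {ψ : ℝ × ℝ → Bool}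
    (hψ : ∀ q : ℝ × ℝ, q.2 ∈ Set.Ioo B.bot B.top → (∀ i, B.strand i q.2 ≠ q.1) →
      B.colorAt c x q = ψ q) {p : ℝ × ℝ} (hp : p.2 ∈ Set.Icc B.bot B.top)
    (h : ∀ i, B.strand i p.2 ≠ p.1) (hc : ∀ᶠ q in 𝓝 p, ψ q = ψ p) :
    B.colorAt c x p = ψ p := by
  have : (𝓝[Set.Ioo B.bot B.top] p.2).NeBot := by
    rw [← mem_closure_iff_nhdsWithin_neBot, closure_Ioo B.bot_lt_top.ne]
    exact hp
  have ht : Tendsto (fun y => (p.1, y)) (𝓝[Set.Ioo B.bot B.top] p.2) (𝓝 p) :=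
    (Continuous.prodMk_right p.1).continuousAt.tendsto.mono_left nhdsWithin_le_nhds
  -- A nearby point straight above or below `p`, inside the band, where both colours equal their
  -- values at `p`.
  obtain ⟨y, ⟨⟨h1, h2⟩, h3⟩, hy⟩ := ((ht.eventually (B.eventually_lt_iff hp h)).and
    (ht.eventually hc) |>.and (ht.eventually (B.eventually_colorAt_eq c x hp h)) |>.and
    self_mem_nhdsWithin).exists
  have hy' : y ∈ Set.Icc B.bot B.top := Set.Ioo_subset_Icc_self hy
  rw [← h2, ← h3 hy']
  refine hψ _ hy fun i hi => ?_
  have h1 := h1 hy' i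
  rcases (h i).lt_or_gt with hlt | hlt
  · exact (h1.1.2 hlt).ne hi
  · exact (h1.2.2 hlt).ne' hi

/-- The region between two consecutive strands. -/
def gap (k : ℕ) : Set (ℝ × ℝ) :=
  {p | p.2 ∈ Set.Ioo B.bot B.top ∧
    ∀ i : Fin n, (i.val < k → B.strand i p.2 < p.1) ∧ (k ≤ i.val → p.1 < B.strand i p.2)}

variable {B} {k : ℕ} {p q : ℝ × ℝ}

theorem ne_of_mem_gap (hp : p ∈ B.gap k) (i : Fin n) : B.strand i p.2 ≠ p.1 := by
  rcases lt_or_ge i.val k with h | h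
  · exact ((hp.2 i).1 h).ne
  · exact ((hp.2 i).2 h).ne'

theorem colorAt_of_mem_gap (hp : p ∈ B.gap k) (c : Bool) (x : Row n) :
    B.colorAt c x p = gapColor c x k := by
  refine colorAt_eq_gapColor fun i => ⟨fun h => ?_, (hp.2 i).1⟩
  by_contra hk
  exact ((hp.2 i).2 (not_lt.1 hk)).not_gt h

/-- A locally constant function on the interior of a band is constant between two consecutive
strands. -/
theorem eq_of_mem_gap {ψ : ℝ × ℝ → Bool}
    (hψ : ∀ p : ℝ × ℝ, p.2 ∈ Set.Ioo B.bot B.top → (∀ i, B.strand i p.2 ≠ p.1) →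
      ∀ᶠ q in 𝓝 p, ψ q = ψ p) (hp : p ∈ B.gap k) (hq : q ∈ B.gap k) : ψ p = ψ q := by
  have hcont : ContinuousOn ψ (B.gap k) := fun p hp =>
    (continuousAt_const.congr
      ((hψ p hp.1 (ne_of_mem_gap hp)).mono fun q hq => hq.symm)).continuousWithinAt
  have horiz : ∀ {p q : ℝ × ℝ}, p ∈ B.gap k → q ∈ B.gap k → p.2 = q.2 → ψ p = ψ q := by
    intro p q hp hq hpq
    have hpre : _root_.IsPreconnected ((fun t => (t, p.2)) '' Set.uIcc p.1 q.1) :=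
      isPreconnected_uIcc.image _ (Continuous.prodMk_left p.2).continuousOn
    refine hpre.constant (hcont.mono ?_) ⟨p.1, Set.left_mem_uIcc, rfl⟩
      ⟨q.1, Set.right_mem_uIcc, Prod.ext rfl hpq⟩
    rintro _ ⟨t, ht, rfl⟩
    refine ⟨hp.1, fun i => ⟨fun hi => ?_, fun hi => ?_⟩⟩
    · refine (lt_min ((hp.2 i).1 hi) ?_).trans_le ht.1
      rw [hpq]
      exact (hq.2 i).1 hi
    · refine ht.2.trans_lt (max_lt ((hp.2 i).2 hi) ?_)
      rw [hpq]
      exact (hq.2 i).2 hi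
  have hex : ∀ y ∈ Set.Ioo B.bot B.top, ∃ t, (t, y) ∈ B.gap k := fun y hy =>
    (exists_mem_gap (B.strictMono y hy) k).imp fun t ht => ⟨hy, ht⟩
  choose! τ hτ using hex
  -- The chosen points `τ y` need not vary continuously. For nearby heights a vertical move stays in
  -- the gap, and a horizontal one then reaches `τ y'`.
  have hconst : ContinuousOn (fun y => ψ (τ y, y)) (Set.Ioo B.bot B.top) := by
    intro y hy
    refine (continuousAt_const.congr (f := fun _ => ψ (τ y, y)) ?_).continuousWithinAt
    have ht : Tendsto (fun y' => (τ y, y')) (𝓝 y) (𝓝 (τ y, y)) :=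
      (Continuous.prodMk_right (τ y)).continuousAt.tendsto
    filter_upwards [ht.eventually (hψ _ hy (ne_of_mem_gap (hτ y hy))),
      ht.eventually (B.eventually_lt_iff (Set.Ioo_subset_Icc_self hy) (ne_of_mem_gap (hτ y hy))),
      isOpen_Ioo.mem_nhds hy] with y' h1 h2 hy'
    rw [← h1]
    refine horiz ⟨hy', fun i => ?_⟩ (hτ y' hy') rfl
    have := h2 (Set.Ioo_subset_Icc_self hy') i
    exact ⟨fun hi => this.1.2 (((hτ y hy).2 i).1 hi), fun hi => this.2.2 (((hτ y hy).2 i).2 hi)⟩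
  calc ψ p = ψ (τ p.2, p.2) := horiz hp (hτ _ hp.1) rfl
    _ = ψ (τ q.2, q.2) := isPreconnected_Ioo.constant hconst hp.1 hq.1
    _ = ψ q := horiz (hτ _ hq.1) hq rfl

/-- A locally constant function on the interior of a band is given by a row of colours. -/
theorem exists_colorAt_eq {ψ : ℝ × ℝ → Bool} {c : Bool} {R : ℝ}
    (hψ : ∀ p : ℝ × ℝ, p.2 ∈ Set.Ioo B.bot B.top → (∀ i, B.strand i p.2 ≠ p.1) →
      ∀ᶠ q in 𝓝 p, ψ q = ψ p) (hR : ∀ p : ℝ × ℝ, p.1 < R → ψ p = c) :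
    ∃ x : Row n, ∀ p : ℝ × ℝ, p.2 ∈ Set.Ioo B.bot B.top → (∀ i, B.strand i p.2 ≠ p.1) →
      B.colorAt c x p = ψ p := by
  obtain ⟨y, hy⟩ := exists_between B.bot_lt_top
  have hex : ∀ k, ∃ p, p ∈ B.gap k := fun k =>
    (exists_mem_gap (B.strictMono y hy) k).imp' (fun t => (t, y)) fun t ht => ⟨hy, ht⟩
  choose a ha using hex
  have h0 : ψ (a 0) = c := by
    obtain ⟨t, ht⟩ := Set.finite_range (fun i => B.strand i y) |>.bddBelow
    -- This point is left of all strands at height `y` and also left of `R`, where `ψ` is known.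
    have : (min t R - 1, y) ∈ B.gap 0 := by
      refine ⟨hy, fun i => ⟨fun h => absurd h (Nat.not_lt_zero _), fun _ => ?_⟩⟩
      have h1 := ht ⟨i, rfl⟩
      have h2 := min_le_left t R
      change min t R - 1 < B.strand i y
      simp only at h1
      linarith
    rw [eq_of_mem_gap hψ (ha 0) this]
    exact hR _ ((sub_one_lt _).trans_le (min_le_right _ _))
  obtain ⟨x, hx⟩ := exists_gapColor n fun k => ψ (a k)
  refine ⟨x, fun p hp h => ?_⟩
  obtain ⟨k, hk, hi⟩ := exists_gap (B.strictMono p.2 hp) h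
  have hpk : p ∈ B.gap k := ⟨hp, hi⟩
  rw [colorAt_of_mem_gap hpk, eq_of_mem_gap hψ hpk (ha k), ← hx k hk, ← h0]

theorem notMem_carrier_iff (hp : p.2 ∈ Set.Icc B.bot B.top) :
    p ∉ B.carrier ↔ ∀ i, B.strand i p.2 ≠ p.1 :=
  ⟨fun h i hi => h ⟨hp, i, hi.symm⟩, fun h ⟨_, i, hi⟩ => h i hi.symm⟩

end Band

namespace Drawing

variable {m n : ℕ} {D : Drawing m n}

/-- The height of the bottom line. -/
def bottom : {m n : ℕ} → Drawing m n → ℝ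
  | _, _, last B => B.bot
  | _, _, cons _ _ D => D.bottom

theorem Fits.bottom_le (hD : D.Fits) : D.bottom ≤ D.firstBand.bot := by
  induction D with
  | last B => exact le_rfl
  | cons B L D ih =>
    exact (ih hD.2.2.2.2).trans (D.firstBand.bot_lt_top.le.trans hD.2.2.1.le)

theorem firstBand_subset (D : Drawing m n) : D.firstBand.carrier ⊆ D.carrier := by
  cases D with
  | last B => exact subset_rfl
  | cons B L D => exact Set.subset_union_left

theorem Fits.mem_firstBand (hD : D.Fits) {p : ℝ × ℝ} (hp : p ∈ D.carrier)
    (h : D.firstBand.bot < p.2) : p ∈ D.firstBand.carrier := by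
  cases D with
  | last B => exact hp
  | cons B L D =>
    rcases hp with hp | hp
    · exact hp
    · exact absurd ((hD.2.2.2.2.le_top hp).trans_eq hD.2.2.1) h.not_ge

theorem Fits.mem_firstBand_of_top (hD : D.Fits) {p : ℝ × ℝ} (hp : p ∈ D.carrier)
    (h : p.2 = D.firstBand.top) : p ∈ D.firstBand.carrier :=
  hD.mem_firstBand hp (h ▸ D.firstBand.bot_lt_top)

theorem Fits.bottom_le_of_mem (hD : D.Fits) {p : ℝ × ℝ} (hp : p ∈ D.carrier) :
    D.bottom ≤ p.2 := by
  induction D with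
  | last B => exact hp.1.1
  | cons B L D ih =>
    rcases hp with hp | hp
    · exact hD.bottom_le.trans hp.1.1
    · exact ih hD.2.2.2.2 hp

end Drawing

namespace Coloring

variable {m n : ℕ} {D : Drawing m n} {c : Bool} {z : Coloring D} {p : ℝ × ℝ}

/-- The colour of the region at a point not above the drawing. -/
noncomputable def regionAt (c : Bool) : {m n : ℕ} → {D : Drawing m n} → Coloring D → ℝ × ℝ → Bool
  | _, _, .last B, z, p => open Classical in if B.bot ≤ p.2 then B.colorAt c z p else c
  | _, _, .cons B _ _, z, p =>
    open Classical in if B.bot ≤ p.2 then B.colorAt c z.1 p else regionAt c z.2 p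

theorem regionAt_first (z : Coloring D) (h : D.firstBand.bot ≤ p.2) :
    z.regionAt c p = D.firstBand.colorAt c z.first p := by
  cases D <;> exact if_pos h

theorem regionAt_of_lt_bottom (hD : D.Fits) (z : Coloring D) (h : p.2 < D.bottom) :
    z.regionAt c p = c := by
  induction D with
  | last B => exact if_neg h.not_ge
  | cons B L D ih => exact (if_neg (h.trans_le hD.bottom_le).not_ge).trans (ih hD.2.2.2.2 z.2 h)

/-- A row of nodes preserves the rightmost colour, so it is carried up from the bottom line. -/
theorem last_first (hz : z.Compat (Level.RegionCompat c)) (hf : z.final = Row.const n c) :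
    Row.last c z.first = c := by
  induction D with
  | last B =>
    change Row.last c z = c
    rw [show z = _ from hf]
    exact last_const
  | cons B L D ih => exact hz.1.last_eq.trans (ih hz.2 hf)

theorem regionAt_of_far (hD : D.Fits) (hz : z.Compat (Level.RegionCompat c))
    (hf : z.final = Row.const n c) {R : ℝ} (hR : ∀ q ∈ D.carrier, |q.1| ≤ R)
    (hp : p.2 ≤ D.firstBand.top) (h : R < |p.1|) : z.regionAt c p = c := by
  have band : ∀ {n : ℕ} (B : Band n) (x : Row n), (∀ q ∈ B.carrier, |q.1| ≤ R) →
      Row.last c x = c → p.2 ∈ Set.Icc B.bot B.top → B.colorAt c x p = c := by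
    intro n B x hR hx hp
    have hi : ∀ i, |B.strand i p.2| ≤ R := fun i => hR (B.strand i p.2, p.2) ⟨hp, i, rfl⟩
    rcases lt_abs.1 h with h | h
    · exact (colorAt_of_lt fun i => (abs_le.1 (hi i)).2.trans_lt h).trans hx
    · exact colorAt_of_le fun i => by linarith [(abs_le.1 (hi i)).1]
  induction D with
  | last B =>
    unfold regionAt
    split_ifs with hb
    · exact band B z hR (last_first hz hf) ⟨hb, hp⟩
    · rfl
  | cons B L D ih =>
    unfold regionAt
    split_ifs with hb
    · exact band B z.1 (fun q hq => hR q (.inl hq)) (last_first hz hf) ⟨hb, hp⟩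
    · exact ih hD.2.2.2.2 hz.2 hf (fun q hq => hR q (.inr hq))
        ((not_le.1 hb).le.trans hD.2.2.1.ge)

/-- Inside a band this is continuity of the strands, on a line of nodes it is compatibility, and at
the bottom line it is the constant last row. -/
theorem eventually_regionAt_eq (hD : D.Fits) (hz : z.Compat (Level.RegionCompat c))
    (hf : z.final = Row.const n c) (hp : p ∉ D.carrier) (ht : p.2 < D.firstBand.top) :
    ∀ᶠ q in 𝓝 p, z.regionAt c q = z.regionAt c p := by
  have htop : ∀ᶠ q : ℝ × ℝ in 𝓝 p, q.2 < D.firstBand.top :=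
    continuous_snd.continuousAt.eventually_lt continuousAt_const ht
  induction D with
  | last B =>
    replace hf : z = Row.const _ c := hf
    rcases lt_or_ge p.2 B.bot with h | h
    · have : ∀ᶠ q : ℝ × ℝ in 𝓝 p, q.2 < B.bot :=
        continuous_snd.continuousAt.eventually_lt continuousAt_const h
      filter_upwards [this] with q hq
      exact (if_neg hq.not_ge).trans (if_neg h.not_ge).symm
    · have hc : ∀ q, B.colorAt c z q = c := fun q => by
        rw [hf]
        exact colorAt_const
      refine Eventually.of_forall fun q => ?_
      unfold regionAt
      simp only [hc, ite_self]
  | cons B L D ih =>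
    rcases lt_or_ge p.2 B.bot with h | h
    · have : ∀ᶠ q : ℝ × ℝ in 𝓝 p, q.2 < B.bot :=
        continuous_snd.continuousAt.eventually_lt continuousAt_const h
      have hbot := hD.2.2.1
      filter_upwards [this, ih hD.2.2.2.2 hz.2 hf (fun h => hp (.inr h)) (by rwa [hbot])
        (by simpa only [hbot] using this)] with q hq1 hq2
      exact (if_neg hq1.not_ge).trans (hq2.trans (if_neg h.not_ge).symm)
    · have hpI : p.2 ∈ Set.Icc B.bot B.top := ⟨h, ht.le⟩
      have hpB := (Band.notMem_carrier_iff hpI).1 fun h => hp (.inl h)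
      have hB := B.eventually_colorAt_eq c z.1 hpI hpB
      rcases h.lt_or_eq with h' | h'
      · have : ∀ᶠ q : ℝ × ℝ in 𝓝 p, B.bot < q.2 :=
          continuousAt_const.eventually_lt continuous_snd.continuousAt h'
        filter_upwards [hB, htop, this] with q hq h1 h2
        exact (if_pos h2.le).trans ((hq ⟨h2.le, h1.le⟩).trans (if_pos h).symm)
      -- On a line of nodes a neighbourhood meets both adjacent bands, whose colours agree at `p`.
      · obtain ⟨hL, hin, hbot, hout, hD⟩ := hD
        have hpD : p.2 ∈ Set.Icc D.firstBand.bot D.firstBand.top :=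
          ⟨(D.firstBand.bot_lt_top.trans_eq (hbot.trans h')).le, (hbot.trans h').ge⟩
        have hpF := (Band.notMem_carrier_iff hpD).1 fun h => hp (.inr (D.firstBand_subset h))
        have hDB := D.firstBand.eventually_colorAt_eq c z.2.first hpD hpF
        have heq : B.colorAt c z.1 p = D.firstBand.colorAt c z.2.first p := by
          have h1 : (fun i => B.strand i p.2) = L.inPos := funext fun i => by rw [← h', hin]
          have h2 : (fun i => D.firstBand.strand i p.2) = L.outPos :=
            funext fun i => by rw [← h', ← hbot, hout]
          unfold Band.colorAt
          rw [h1, h2]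
          exact hz.1.colorAt_eq hL p.1
        have : ∀ᶠ q : ℝ × ℝ in 𝓝 p, D.firstBand.bot < q.2 :=
          continuousAt_const.eventually_lt continuous_snd.continuousAt
            (D.firstBand.bot_lt_top.trans_eq (hbot.trans h'))
        filter_upwards [hB, hDB, htop, this] with q hq1 hq2 h1 h2
        refine Eq.trans ?_ (if_pos h).symm
        unfold regionAt
        split_ifs with hq
        · exact hq1 ⟨hq, h1.le⟩
        · rw [regionAt_first _ h2.le, heq]
          exact hq2 ⟨h2.le, (not_le.1 hq).le.trans hbot.ge⟩

/-- Every gap of every band contains a point of the complement, so each entry of the colouring can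
be read off. -/
theorem ext_regionAt (hD : D.Fits) {z z' : Coloring D}
    (h : ∀ p : ℝ × ℝ, p ∉ D.carrier → p.2 < D.firstBand.top → z.regionAt c p = z'.regionAt c p) :
    z = z' := by
  have band : ∀ {n : ℕ} (B : Band n) (x x' : Row n), (∀ p : ℝ × ℝ, p.2 ∈ Set.Ioo B.bot B.top →
      (∀ i, B.strand i p.2 ≠ p.1) → B.colorAt c x p = B.colorAt c x' p) → x = x' := by
    intro n B x x' h
    obtain ⟨y, hy⟩ := exists_between B.bot_lt_top
    refine ext_gapColor (c := c) fun k _ => ?_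
    obtain ⟨t, ht⟩ := exists_mem_gap (B.strictMono y hy) k
    have hk : (t, y) ∈ B.gap k := ⟨hy, ht⟩
    rw [← Band.colorAt_of_mem_gap hk, ← Band.colorAt_of_mem_gap hk]
    exact h _ hy (Band.ne_of_mem_gap hk)
  have hfirst : z.first = z'.first := by
    refine band D.firstBand _ _ fun p hp hs => ?_
    rw [← regionAt_first _ hp.1.le, ← regionAt_first _ hp.1.le]
    refine h p (fun hp' => ?_) hp.2
    exact (Band.notMem_carrier_iff (Set.Ioo_subset_Icc_self hp)).2 hs (hD.mem_firstBand hp' hp.1)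
  induction D with
  | last B => exact hfirst
  | cons B L D ih =>
    have hD' := hD.2.2.2.2
    have hbot := hD.2.2.1
    have hrest : ∀ p : ℝ × ℝ, p ∉ D.carrier → p.2 < D.firstBand.top →
        z.2.regionAt c p = z'.2.regionAt c p := by
      intro p hp ht
      have hb : p.2 < B.bot := ht.trans_eq hbot
      have := h p (fun h' => h'.elim (fun h' => hb.not_ge h'.1.1) hp) (hb.trans B.bot_lt_top)
      unfold regionAt at this
      rwa [if_neg hb.not_ge, if_neg hb.not_ge] at this
    refine Prod.ext hfirst (ih hD' hrest ?_)
    refine band D.firstBand _ _ fun p hp hs => ?_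
    rw [← regionAt_first _ hp.1.le, ← regionAt_first _ hp.1.le]
    refine hrest p (fun hp' => ?_) hp.2
    exact (Band.notMem_carrier_iff (Set.Ioo_subset_Icc_self hp)).2 hs (hD'.mem_firstBand hp' hp.1)

/-- A locally constant function on the complement of a drawing is given by a colouring. -/
theorem exists_regionAt_eq (hD : D.Fits) {ψ : ℝ × ℝ → Bool} {R : ℝ}
    (hψ : ∀ p : ℝ × ℝ, p ∉ D.carrier → p.2 < D.firstBand.top → ∀ᶠ q in 𝓝 p, ψ q = ψ p)
    (hR : ∀ p : ℝ × ℝ, p.1 < R → ψ p = c) (hbot : ∀ p : ℝ × ℝ, p.2 < D.bottom → ψ p = c) :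
    ∃ z : Coloring D, z.Compat (Level.RegionCompat c) ∧ z.final = Row.const n c ∧
      ∀ p : ℝ × ℝ, p ∉ D.carrier → p.2 < D.firstBand.top → z.regionAt c p = ψ p := by
  have hfirst : ∃ x, ∀ p : ℝ × ℝ, p.2 ∈ Set.Icc D.firstBand.bot D.firstBand.top →
      p.2 < D.firstBand.top → p ∉ D.carrier → D.firstBand.colorAt c x p = ψ p := by
    have hint : ∀ p : ℝ × ℝ, p.2 ∈ Set.Ioo D.firstBand.bot D.firstBand.top →
        (∀ i, D.firstBand.strand i p.2 ≠ p.1) → p ∉ D.carrier := fun p hp hs hp' =>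
      (Band.notMem_carrier_iff (Set.Ioo_subset_Icc_self hp)).2 hs (hD.mem_firstBand hp' hp.1)
    obtain ⟨x, hx⟩ := Band.exists_colorAt_eq (B := D.firstBand) (ψ := ψ) (c := c) (R := R)
      (fun p hp hs => hψ p (hint p hp hs) hp.2) hR
    refine ⟨x, fun p hp ht hpD => D.firstBand.colorAt_eq_of_interior hx hp ?_ (hψ p hpD ht)⟩
    exact (Band.notMem_carrier_iff hp).1 fun h => hpD (D.firstBand_subset h)
  obtain ⟨x, hx⟩ := hfirst
  induction D with
  | last B =>
    refine ⟨x, trivial, ?_, fun p hp ht => ?_⟩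
    -- The legs end at distinct points, so the gap reaches the bottom line. There `ψ` agrees with
    -- its values just below, which are `c`.
    · refine ext_gapColor (c := c) fun k _ => ?_
      obtain ⟨t, ht⟩ := exists_mem_gap (show StrictMono fun i => B.strand i B.bot from hD) k
      have hne : ∀ i, B.strand i B.bot ≠ t := fun i => by
        rcases lt_or_ge i.val k with h | h
        · exact ((ht i).1 h).ne
        · exact ((ht i).2 h).ne'
      have hI : B.bot ∈ Set.Icc B.bot B.top := ⟨le_rfl, B.bot_lt_top.le⟩
      have hmem : (t, B.bot) ∉ B.carrier := (Band.notMem_carrier_iff (p := (t, B.bot)) hI).2 hne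
      have h1 : B.colorAt c x (t, B.bot) = ψ (t, B.bot) := hx _ hI B.bot_lt_top hmem
      have h2 : B.colorAt c x (t, B.bot) = gapColor c x k :=
        colorAt_eq_gapColor fun i => ⟨fun h => by
          by_contra hk
          exact ((ht i).2 (not_lt.1 hk)).not_gt h, (ht i).1⟩
      have hlim : Tendsto (fun y => (t, y)) (𝓝[<] B.bot) (𝓝 (t, B.bot)) :=
        (Continuous.prodMk_right t).continuousAt.tendsto.mono_left nhdsWithin_le_nhds
      obtain ⟨y, h3, h4⟩ := ((hlim.eventually (hψ _ hmem B.bot_lt_top)).and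
        self_mem_nhdsWithin).exists
      change gapColor c x k = _
      rw [gapColor_const, ← h2, h1, ← h3]
      exact hbot _ h4
    · by_cases hb : B.bot ≤ p.2
      · exact (if_pos hb).trans (hx p ⟨hb, ht.le⟩ ht hp)
      · exact (if_neg hb).trans (hbot p (not_le.1 hb)).symm
  | cons B L D ih =>
    obtain ⟨hL, hin, htop, hout, hD'⟩ := id hD
    have hD'c : ∀ p : ℝ × ℝ, p ∉ D.carrier → p.2 < D.firstBand.top →
        p ∉ (Drawing.cons B L D).carrier ∧ p.2 < B.top := fun p hp ht => by
      have hb : p.2 < B.bot := ht.trans_eq htop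
      exact ⟨fun h' => h'.elim (fun h' => hb.not_ge h'.1.1) hp, hb.trans B.bot_lt_top⟩
    have hψ' : ∀ p : ℝ × ℝ, p ∉ D.carrier → p.2 < D.firstBand.top →
        ∀ᶠ q in 𝓝 p, ψ q = ψ p := fun p hp ht =>
      hψ p (hD'c p hp ht).1 (hD'c p hp ht).2
    have hint : ∀ p : ℝ × ℝ, p.2 ∈ Set.Ioo D.firstBand.bot D.firstBand.top →
        (∀ i, D.firstBand.strand i p.2 ≠ p.1) → p ∉ D.carrier := fun p hp hs hp' =>
      (Band.notMem_carrier_iff (Set.Ioo_subset_Icc_self hp)).2 hs (hD'.mem_firstBand hp' hp.1)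
    obtain ⟨x', hx'⟩ := Band.exists_colorAt_eq (B := D.firstBand) (ψ := ψ) (c := c) (R := R)
      (fun p hp hs => hψ' p (hint p hp hs) hp.2) hR
    obtain ⟨z, hz, hzf, hzψ⟩ := ih hD' hψ' hbot x' fun p hp ht hpD =>
      D.firstBand.colorAt_eq_of_interior hx' hp
        ((Band.notMem_carrier_iff hp).1 fun h => hpD (D.firstBand_subset h)) (hψ' p hpD ht)
    refine ⟨(x, z), ⟨Level.regionCompat_of_colorAt_eq hL fun t ht => ?_, hz⟩, hzf,
      fun p hp ht => ?_⟩
    -- At a point of the line off the nodes, the rows above and below both give the value of `ψ`.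
    · have hI : B.bot ∈ Set.Icc B.bot B.top := ⟨le_rfl, B.bot_lt_top.le⟩
      have hneB : ∀ i, B.strand i B.bot ≠ t := fun i hi =>
        ht (hi ▸ hin i ▸ L.inPos_mem i)
      have hneD : ∀ i, D.firstBand.strand i B.bot ≠ t := fun i hi => by
        rw [← htop, hout i] at hi
        exact ht (hi ▸ L.outPos_mem i)
      have hID : B.bot ∈ Set.Icc D.firstBand.bot D.firstBand.top :=
        ⟨(D.firstBand.bot_lt_top.trans_eq htop).le, htop.ge⟩
      have hmem : (t, B.bot) ∉ (Drawing.cons B L D).carrier := by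
        rintro (h | h)
        · exact (Band.notMem_carrier_iff (p := (t, B.bot)) hI).2 hneB h
        · exact (Band.notMem_carrier_iff (p := (t, B.bot)) hID).2 hneD
            (hD'.mem_firstBand_of_top h htop.symm)
      have h1 := hx (t, B.bot) hI B.bot_lt_top hmem
      have h2 := D.firstBand.colorAt_eq_of_interior (c := c) (x := z.first) (ψ := ψ)
        (fun q hq hs => by
          rw [← regionAt_first _ hq.1.le]
          exact hzψ q (hint q hq hs) hq.2) (p := (t, B.bot)) hID hneD (hψ _ hmem B.bot_lt_top)
      have e1 : (fun i => B.strand i B.bot) = L.inPos := funext hin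
      have e2 : (fun i => D.firstBand.strand i B.bot) = L.outPos :=
        funext fun i => by rw [← htop, hout]
      have := h1.trans h2.symm
      unfold Band.colorAt at this
      rwa [show (fun i => (Drawing.cons B L D).firstBand.strand i (t, B.bot).2) = L.inPos from e1,
        show (fun i => D.firstBand.strand i (t, B.bot).2) = L.outPos from e2] at this
    · by_cases hb : B.bot ≤ p.2
      · exact (if_pos hb).trans (hx p ⟨hb, ht.le⟩ ht hp)
      · refine (if_neg hb).trans ?_
        exact hzψ p (fun h => hp (.inr h)) ((not_le.1 hb).trans_eq htop.symm)

end Coloring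

end PlanarSpider

/-! ### Counting bounded components, and the conclusion. -/

namespace PlanarSpider

open Filter Topology Row

section Components

variable {U : Set (ℝ × ℝ)} {c : Bool}

theorem eq_of_mem_connectedComponentIn {f : ℝ × ℝ → Bool} (hf : ContinuousOn f U) {p q : ℝ × ℝ}
    (hp : p ∈ U) (hq : q ∈ connectedComponentIn U p) : f q = f p :=
  isPreconnected_connectedComponentIn.constant (hf.mono (connectedComponentIn_subset U p)) hq
    (mem_connectedComponentIn hp)

/-- The number of bounded components of an open set is found by counting the locally constant
two-valued functions with a given value on the unbounded components. -/
theorem encard_boundedComponents (hU : IsOpen U) {j : ℕ} {Z : Type} [Fintype Z]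
    (hZ : Fintype.card Z = 2 ^ j) (Φ : Z → ℝ × ℝ → Bool) (hΦ : ∀ z, ContinuousOn (Φ z) U)
    (hc : ∀ z, ∀ p ∈ U, ¬ Bornology.IsBounded (connectedComponentIn U p) → Φ z p = c)
    (hinj : ∀ z z', Set.EqOn (Φ z) (Φ z') U → z = z')
    (hsurj : ∀ ψ : ℝ × ℝ → Bool, ContinuousOn ψ U →
      (∀ p ∈ U, ¬ Bornology.IsBounded (connectedComponentIn U p) → ψ p = c) →
      ∃ z, Set.EqOn (Φ z) ψ U) :
    (boundedComponents U).encard = (j : ℕ∞) := by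
  classical
  have hex : ∀ K : boundedComponents U, ∃ p ∈ U, K.1 = connectedComponentIn U p := fun K => K.2.1
  choose a ha hK using hex
  have hbij : Function.Bijective fun (z : Z) (K : boundedComponents U) => Φ z (a K) := by
    constructor
    · intro z z' h
      refine hinj z z' fun p hp => ?_
      by_cases hb : Bornology.IsBounded (connectedComponentIn U p)
      · let K : boundedComponents U := ⟨_, ⟨p, hp, rfl⟩, hb⟩
        have hpK : p ∈ connectedComponentIn U (a K) := hK K ▸ mem_connectedComponentIn hp
        rw [eq_of_mem_connectedComponentIn (hΦ z) (ha K) hpK,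
          eq_of_mem_connectedComponentIn (hΦ z') (ha K) hpK]
        exact congrFun h K
      · rw [hc z p hp hb, hc z' p hp hb]
    · intro g
      -- Prescribed on bounded components; elsewhere the outer colour `c`.
      let ψ : ℝ × ℝ → Bool := fun p =>
        if h : p ∈ U ∧ Bornology.IsBounded (connectedComponentIn U p) then
          g ⟨_, ⟨p, h.1, rfl⟩, h.2⟩ else c
      have hψ : ∀ {p q : ℝ × ℝ}, p ∈ U → q ∈ connectedComponentIn U p → ψ q = ψ p := by
        intro p q hp hq
        have he := connectedComponentIn_eq hq
        have hqU := connectedComponentIn_subset U p hq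
        by_cases hb : Bornology.IsBounded (connectedComponentIn U p)
        · simp only [ψ, hp, hqU, ← he, hb, and_self, dif_pos]
        · simp only [ψ, ← he, hb, and_false, dif_neg, not_false_eq_true]
      have hcont : ContinuousOn ψ U := fun p hp => by
        refine (continuousAt_const.congr (f := fun _ => ψ p) ?_).continuousWithinAt
        filter_upwards [hU.connectedComponentIn.mem_nhds (mem_connectedComponentIn hp)] with q hq
        exact (hψ hp hq).symm
      obtain ⟨z, hz⟩ := hsurj ψ hcont fun p hp hb => dif_neg fun h => hb h.2
      refine ⟨z, funext fun K => ?_⟩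
      have hb : Bornology.IsBounded (connectedComponentIn U (a K)) := hK K ▸ K.2.2
      exact (hz (ha K)).trans ((dif_pos ⟨ha K, hb⟩).trans (congrArg g (Subtype.ext (hK K).symm)))
  -- Finiteness is a conclusion: colourings surject onto these functions, and components embed among
  -- them by their indicators.
  have : Finite (boundedComponents U → Bool) := Finite.of_surjective _ hbij.2
  have : Finite (boundedComponents U) :=
    Finite.of_injective (fun K K' : boundedComponents U => decide (K = K')) fun K K' h => by
      simpa using congrFun h K'
  have : Fintype (boundedComponents U) := Fintype.ofFinite _
  have h1 := Fintype.card_of_bijective hbij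
  rw [hZ, Fintype.card_fun, Fintype.card_bool] at h1
  rw [Set.encard, ENat.card_eq_coe_fintype_card, Nat.pow_right_injective le_rfl h1]

theorem not_isBounded_connectedComponentIn {p : ℝ × ℝ} {s : Set (ℝ × ℝ)}
    (hs : _root_.IsPreconnected s) (hp : p ∈ s) (hsU : s ⊆ U) (hb : ¬ Bornology.IsBounded s) :
    ¬ Bornology.IsBounded (connectedComponentIn U p) := fun h =>
  hb (h.subset (hs.subset_connectedComponentIn hp hsU))

/-- A half-plane of `ℝ × ℝ` lies in an unbounded component of each set that contains it. -/
theorem not_isBounded_connectedComponentIn_of_halfPlane (φ : ℝ × ℝ →ₗ[ℝ] ℝ) {v : ℝ × ℝ}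
    (hv : 0 < φ v) {r : ℝ} (hU : ∀ q, r < φ q → q ∈ U) {p : ℝ × ℝ} (hp : r < φ p) :
    ¬ Bornology.IsBounded (connectedComponentIn U p) := by
  refine not_isBounded_connectedComponentIn (convex_halfSpace_gt φ.isLinear r).isPreconnected hp hU
    fun hb => ?_
  obtain ⟨N, hN⟩ := hb.exists_norm_le
  have hv0 : 0 < ‖v‖ := norm_pos_iff.2 fun h => by simp [h] at hv
  -- A displacement of length `N + ‖p‖ + 1` leaves the ball of radius `N`, and along `v` it stays in
  -- the half-plane.
  have h1 := hN (p + ((N + ‖p‖ + 1) / ‖v‖) • v) (by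
    have hN0 : 0 ≤ N := (norm_nonneg _).trans (hN p hp)
    have : 0 ≤ (N + ‖p‖ + 1) / ‖v‖ := by positivity
    simp only [Set.mem_ofPred_eq, map_add, map_smul, smul_eq_mul]
    nlinarith [mul_nonneg this hv.le])
  have hN0 : 0 ≤ N := (norm_nonneg _).trans (hN p hp)
  have h2 : ‖((N + ‖p‖ + 1) / ‖v‖) • v‖ = N + ‖p‖ + 1 := by
    rw [norm_smul, Real.norm_of_nonneg (by positivity), div_mul_cancel₀ _ hv0.ne']
  have h3 := norm_sub_le (p + ((N + ‖p‖ + 1) / ‖v‖) • v) p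
  rw [add_sub_cancel_left, h2] at h3
  linarith

end Components

theorem Drawing.isCompact_carrier {m n : ℕ} (D : Drawing m n) : IsCompact D.carrier := by
  rw [← (Coloring.const true D).piece_union]
  exact (Coloring.isCompact_piece _ _).union (Coloring.isCompact_piece _ _)

namespace PlanarDiagram

variable {m n : ℕ} (Γ : PlanarDiagram m n) {c : Bool}

/-- The colours of the regions of the plane given by a colouring whose outer colour is `c`. -/
noncomputable def colorOf (c : Bool) (z : Coloring Γ.drawing) (p : ℝ × ℝ) : Bool :=
  if p.2 < Γ.drawing.firstBand.top then z.regionAt c p else c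

variable {Γ} {z z' : Coloring Γ.drawing}

/-- Below the top line this is `eventually_regionAt_eq`. At the top line it uses the constant first
row, which continues the outer colour. -/
theorem continuousOn_colorOf (hz : z.Compat (Level.RegionCompat c))
    (h1 : z.first = Row.const m c) (h2 : z.final = Row.const n c) :
    ContinuousOn (Γ.colorOf c z) Γ.carrierᶜ := by
  intro p hp
  refine (continuousAt_const.congr (f := fun _ => Γ.colorOf c z p) ?_).continuousWithinAt
  rcases lt_or_ge p.2 Γ.drawing.firstBand.top with h | h
  · have htop : ∀ᶠ q : ℝ × ℝ in 𝓝 p, q.2 < Γ.drawing.firstBand.top :=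
      continuous_snd.continuousAt.eventually_lt continuousAt_const h
    filter_upwards [htop, Coloring.eventually_regionAt_eq Γ.fits hz h2 hp h] with q hq1 hq2
    exact (if_pos h).trans (hq2.symm.trans (if_pos hq1).symm)
  · have hbot : ∀ᶠ q : ℝ × ℝ in 𝓝 p, Γ.drawing.firstBand.bot < q.2 :=
      continuousAt_const.eventually_lt continuous_snd.continuousAt
        (Γ.drawing.firstBand.bot_lt_top.trans_le h)
    filter_upwards [hbot] with q hq
    refine (if_neg h.not_gt).trans (Eq.symm ?_)
    unfold colorOf
    split_ifs
    · rw [z.regionAt_first hq.le, h1]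
      exact colorAt_const
    · rfl

/-- An unbounded component has a point beside the drawing, below it, or at or above its top line;
the colour is `c` there. -/
theorem colorOf_of_not_isBounded (hz : z.Compat (Level.RegionCompat c))
    (h1 : z.first = Row.const m c) (h2 : z.final = Row.const n c) {p : ℝ × ℝ}
    (hp : p ∈ Γ.carrierᶜ) (hb : ¬ Bornology.IsBounded (connectedComponentIn Γ.carrierᶜ p)) :
    Γ.colorOf c z p = c := by
  obtain ⟨R, hR⟩ := Γ.drawing.isCompact_carrier.isBounded.exists_norm_le
  rw [isBounded_iff_forall_norm_le] at hb
  push Not at hb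
  obtain ⟨q, hq, hqR⟩ := hb (max R (max |Γ.drawing.bottom| |Γ.drawing.firstBand.top|))
  rw [← eq_of_mem_connectedComponentIn (continuousOn_colorOf hz h1 h2) hp hq]
  unfold colorOf
  split_ifs with ht
  · rw [Prod.norm_def, lt_max_iff] at hqR
    rcases hqR with h | h
    · exact Coloring.regionAt_of_far Γ.fits hz h2
        (fun q hq => (norm_fst_le q).trans (hR q hq)) ht.le (max_lt_iff.1 h).1
    · refine z.regionAt_of_lt_bottom Γ.fits ?_
      have h3 := le_abs_self Γ.drawing.firstBand.top
      have h4 := neg_abs_le Γ.drawing.bottom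
      rw [Real.norm_eq_abs] at h
      obtain ⟨h5, h6⟩ := max_lt_iff.1 (max_lt_iff.1 h).2
      rcases lt_abs.1 h6 with h7 | h7
      · linarith
      · have h8 : q.2 < 0 := by linarith [abs_nonneg Γ.drawing.firstBand.top]
        rw [abs_of_neg h8] at h5
        linarith
  · rfl

theorem eq_of_colorOf_eq (h : Set.EqOn (Γ.colorOf c z) (Γ.colorOf c z') Γ.carrierᶜ) : z = z' := by
  refine Coloring.ext_regionAt (c := c) Γ.fits fun p hp ht => ?_
  have := h hp
  unfold colorOf at this
  rwa [if_pos ht, if_pos ht] at this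

/-- The half-planes to the left, below and above miss the drawing and lie in unbounded components,
which supplies the boundary values for `exists_regionAt_eq`. -/
theorem exists_colorOf_eq (Γ : PlanarDiagram m n) {ψ : ℝ × ℝ → Bool}
    (hψ : ContinuousOn ψ Γ.carrierᶜ)
    (hc : ∀ p ∈ Γ.carrierᶜ, ¬ Bornology.IsBounded (connectedComponentIn Γ.carrierᶜ p) → ψ p = c) :
    ∃ z : Coloring Γ.drawing, (z.Compat (Level.RegionCompat c) ∧ z.first = Row.const m c ∧
      z.final = Row.const n c) ∧ Set.EqOn (Γ.colorOf c z) ψ Γ.carrierᶜ := by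
  obtain ⟨R, hR⟩ := Γ.drawing.isCompact_carrier.isBounded.exists_norm_le
  have hopen : IsOpen Γ.carrierᶜ := Γ.drawing.isCompact_carrier.isClosed.isOpen_compl
  have hev : ∀ p ∈ Γ.carrierᶜ, ∀ᶠ q in 𝓝 p, ψ q = ψ p := fun p hp => by
    have := (hψ.continuousAt (hopen.mem_nhds hp)).tendsto
    rwa [nhds_discrete Bool, tendsto_pure] at this
  have half : ∀ (φ : ℝ × ℝ →ₗ[ℝ] ℝ) (v : ℝ × ℝ) (r : ℝ), 0 < φ v →
      (∀ q ∈ Γ.carrier, φ q ≤ r) → ∀ p, r < φ p → ψ p = c := by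
    intro φ v r hv hr p hp
    have hU : ∀ q, r < φ q → q ∈ Γ.carrierᶜ := fun q hq hqc => (hr q hqc).not_gt hq
    exact hc p (hU p hp) (not_isBounded_connectedComponentIn_of_halfPlane φ hv hU hp)
  have hleft : ∀ p : ℝ × ℝ, p.1 < -R → ψ p = c := fun p hp =>
    half (-LinearMap.fst ℝ ℝ ℝ) (-1, 0) R (by simp)
      (fun q hq => (neg_le_abs q.1).trans ((norm_fst_le q).trans (hR q hq))) p (lt_neg_of_lt_neg hp)
  have hbot : ∀ p : ℝ × ℝ, p.2 < Γ.drawing.bottom → ψ p = c := fun p hp =>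
    half (-LinearMap.snd ℝ ℝ ℝ) (0, -1) (-Γ.drawing.bottom) (by simp)
      (fun q hq => neg_le_neg (Γ.fits.bottom_le_of_mem hq)) p (neg_lt_neg hp)
  have habove : ∀ p : ℝ × ℝ, Γ.drawing.firstBand.top < p.2 → ψ p = c := fun p hp =>
    half (LinearMap.snd ℝ ℝ ℝ) (0, 1) Γ.drawing.firstBand.top (by simp)
      (fun q hq => Γ.fits.le_top hq) p hp
  have htop : ∀ p ∈ Γ.carrierᶜ, Γ.drawing.firstBand.top ≤ p.2 → ψ p = c := by
    intro p hp ht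
    have hlim : Tendsto (fun y => (p.1, y)) (𝓝[>] p.2) (𝓝 p) :=
      (Continuous.prodMk_right p.1).continuousAt.tendsto.mono_left nhdsWithin_le_nhds
    obtain ⟨y, h1, h2⟩ := ((hlim.eventually (hev p hp)).and self_mem_nhdsWithin).exists
    rw [← h1]
    exact habove _ (ht.trans_lt h2)
  obtain ⟨z, hz, hzf, hzψ⟩ := Coloring.exists_regionAt_eq (c := c) Γ.fits (ψ := ψ)
    (fun p hp _ => hev p hp) hleft hbot
  refine ⟨z, ⟨hz, ?_, hzf⟩, fun p hp => ?_⟩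
  -- Distinct legs at the top line let every gap reach it, where `ψ` is `c`.
  · set B := Γ.drawing.firstBand with hB
    refine ext_gapColor (c := c) fun k _ => ?_
    obtain ⟨t, ht⟩ := exists_mem_gap Γ.top_strictMono k
    have hne : ∀ i, B.strand i B.top ≠ t := fun i => by
      rcases lt_or_ge i.val k with h | h
      · exact ((ht i).1 h).ne
      · exact ((ht i).2 h).ne'
    have hI : B.top ∈ Set.Icc B.bot B.top := ⟨B.bot_lt_top.le, le_rfl⟩
    have hmem : (t, B.top) ∈ Γ.carrierᶜ := fun h =>
      (Band.notMem_carrier_iff (p := (t, B.top)) hI).2 hne (Γ.fits.mem_firstBand_of_top h rfl)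
    have h1 := B.colorAt_eq_of_interior (c := c) (x := z.first) (ψ := ψ)
      (fun q hq hs => by
        rw [← Coloring.regionAt_first _ hq.1.le]
        refine hzψ q (fun hq' => ?_) hq.2
        exact (Band.notMem_carrier_iff (Set.Ioo_subset_Icc_self hq)).2 hs
          (Γ.fits.mem_firstBand hq' hq.1)) (p := (t, B.top)) hI hne (hev _ hmem)
    have h2 : B.colorAt c z.first (t, B.top) = gapColor c z.first k :=
      colorAt_eq_gapColor fun i => ⟨fun h => by
        by_contra hk
        exact ((ht i).2 (not_lt.1 hk)).not_gt h, (ht i).1⟩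
    rw [gapColor_const, ← h2, h1]
    exact htop _ hmem le_rfl
  · unfold colorOf
    split_ifs with ht
    · exact hzψ p hp ht
    · exact (htop p hp (not_lt.1 ht)).symm

open Classical in
/-- The bounded regions of a diagram are counted by the region colourings. -/
theorem encard_boundedComponents (Γ : PlanarDiagram m n) {j : ℕ}
    (h : (Γ.drawing.evalIn RegionHom).app c (fun r => if r = Row.const m c then 1 else 0)
      (Row.const n c) = 2 ^ j) :
    (boundedComponents Γ.carrierᶜ).encard = (j : ℕ∞) := by
  rw [Drawing.card_regionHom] at h
  refine PlanarSpider.encard_boundedComponents (c := c)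
    Γ.drawing.isCompact_carrier.isClosed.isOpen_compl h (fun z => Γ.colorOf c z.1)
    (fun z => continuousOn_colorOf z.2.1 z.2.2.1 z.2.2.2)
    (fun z p hp hb => colorOf_of_not_isBounded z.2.1 z.2.2.1 z.2.2.2 hp hb)
    (fun z z' h => Subtype.ext (eq_of_colorOf_eq h)) fun ψ hψ hc => ?_
  obtain ⟨z, hz, he⟩ := Γ.exists_colorOf_eq hψ hc
  exact ⟨⟨z, hz⟩, he⟩

/-- The `StrandHom` factor certifies connectedness. Projecting the resulting identity to `PowHom A`
and to `RegionHom` gives the map and the number of regions for one `j`; the outer colour `true` is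
an arbitrary choice. -/
theorem exists_eval_eq_standard {C : Type u} [Category.{v} C] [MonoidalCategory C] (A : C)
    [MonObj A] [ComonObj A] [FrobeniusObj A] (Γ : PlanarDiagram m n)
    (h : _root_.IsConnected Γ.carrier) :
    ∃ j : ℕ, (boundedComponents Γ.carrierᶜ).encard = (j : ℕ∞) ∧ Γ.eval A = standard A m n j := by
  let φ : TowerHom (ProdHom StrandHom (ProdHom (PowHom A) RegionHom)) StrandHom := TowerHom.fst
  let φ' : TowerHom (ProdHom StrandHom (ProdHom (PowHom A) RegionHom))
    (ProdHom (PowHom A) RegionHom) := TowerHom.snd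
  obtain ⟨j, hj⟩ := RWord.eq_std_of_count φ (Γ.drawing.rword _)
    (by rw [φ.map_evalIn]; exact Γ.count_eq_two h)
  have hj' := congrArg φ'.map hj
  rw [φ'.map_evalIn, φ'.map_std] at hj'
  have h1 := congrArg TowerHom.fst.map hj'
  have h2 := congrArg TowerHom.snd.map hj'
  rw [TowerHom.map_evalIn, TowerHom.map_std] at h1 h2
  refine ⟨j, Γ.encard_boundedComponents (c := true) ?_, ?_⟩
  · rw [h2, RegionHom.std_app]
  · exact (Drawing.evalIn_powHom A Γ.drawing).symm.trans (h1.trans (std_powHom A m n j))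

end PlanarDiagram

end PlanarSpider

theorem corollary2p4 {C : Type u} [Category.{v} C] [MonoidalCategory C] (A : C)
    [MonObj A] [ComonObj A] [PlanarSpider.FrobeniusObj A] :
    (∀ (m n : ℕ) (Γ : PlanarSpider.PlanarDiagram m n), _root_.IsConnected Γ.carrier →
      ∃ j : ℕ, (PlanarSpider.boundedComponents Γ.carrierᶜ).encard = (j : ℕ∞) ∧
        Γ.eval A = PlanarSpider.standard A m n j) ∧
    (∀ Γ : PlanarSpider.PlanarDiagram 0 0, _root_.IsConnected Γ.carrier →
      ∃ j : ℕ, (PlanarSpider.boundedComponents Γ.carrierᶜ).encard = (j : ℕ∞) ∧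
        Γ.eval A = PlanarSpider.higherDim A j) :=
  -- For no legs, `standard` unfolds definitionally to `higherDim`.
  ⟨fun _ _ Γ h => Γ.exists_eval_eq_standard A h, fun Γ h => Γ.exists_eval_eq_standard A h⟩
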